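/- Let $\mathcal H$ be an infinite-dimensional separable complex Hilbert space and let $\mathcal L_{\mathcal H}$ be its bounded operators. Write $L$ for the lag operator, $\Delta=1-L$, and $c_{Z,U}(v,w)=E\big(\langle v,Z-EZ\rangle\overline{\langle w,U-EU\rangle}\big)$. An $\mathcal H$-valued process $(\varepsilon_t)_{t\in\mathbb Z}$ is white noise if $0<E\|\varepsilon_t\|^2<\infty$, $E\varepsilon_t=0$, $c_{\varepsilon_t,\varepsilon_s}=c_{\varepsilon_{t+u},\varepsilon_{s+u}}$ for all $s,t,u$, and $c_{\varepsilon_t,\varepsilon_s}=0$ for $s\ne t$. It is nonsingular if $c_{\varepsilon_t,\varepsilon_t}(v,v)\neq0$ for all $v\ne0$. **Order of integration.** An $\mathcal H$-valued process $z_t$ is $I(d)$ if $\Delta^d z_t$ is integrable and $\Delta^dz_t-E(\Delta^dz_t)=\sum_{n\ge0}B_n\eta_{t-n}$ a.s. for every $t$, for some nonsingular $\mathcal H$-valued white noise $\eta$ and some $B_n\in\mathcal L_{\mathcal H}$ with $B_0=I$, $\sum_n\|B_n\||z|^n<\infty$ for $|z|<\rho$ for some $\rho>1$, and $\sum_nB_n\neq0$.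 A scalar process formed from $v$-characteristics $\langle v,z_t\rangle$ is $I(b)$, $b\ge 0$, if its $b$-th difference has such a representation with bounded functionals $B_n:\mathcal H\to\mathbb C$ (without the normalisation $B_0=I$). The cointegrating space of $z_t\sim I(d)$ is $\{v:\langle v,z_t\rangle\sim I(b)\text{ for some }b<d\}\cup\{0\}$, and its orthogonal complement is the attractor space. **The process.** Let $A^\circ_1,\dots,A^\circ_k\in\mathcal L_{\mathcal H}$ and $A(z)=I-\sum_{h=1}^kA_h^\circ z^h$. Suppose that $A(1)$ is Fredholm (with closed range) and not injective, and that $A(z)$ is invertible for all $z\neq1$ with $|z|<\rho$, for some $\rho>1$ (a unit root of finite type). Let $\varepsilon_t$ be a nonsingular $\mathcal H$-valued white noise, and let $x_t$, $t\in\mathbb Z$, be a square-integrable solution of $x_t=A^\circ_1x_{t-1}+\dots+A^\circ_kx_{t-k}+\varepsilon_t$ for which $E\|x_t\|^2$ grows at most polynomially as $t\to-\infty$. **Recursive objects.** Write $A(z)=\sum_{n\ge0}A_n(1-z)^n$, and let $P_\eta$ and $S^+$ denote the orthogonal projection on $\eta$ and the Moore–Penrose inverse of $S$. Put $S_0=A_0$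 and, for all $h\geq 0$, $\zeta_h=\operatorname{Im}S_h$ and $\tau_h=(\operatorname{Ker}S_h)^\perp$. For $h\ge1$ put $\mathscr Z_h=\zeta_0\oplus\dots\oplus\zeta_{h-1}$, $\mathscr T_h=\tau_0\oplus\dots\oplus\tau_{h-1}$ and $S_h=P_{\mathscr Z_h^\perp}A_{h,1}P_{\mathscr T_h^\perp}$, where for $n\ge1$ $$A_{1,n}=A_n,\qquad A_{h,n}=A_{h-1,n+1}-A_{h-1,1}\sum_{j=0}^{h-2}S_j^+A_{j+1,n}\quad(h\ge2).$$ **Theorem.** Let $d\ge1$. Then $x_t$ is $I(d)$ if and only if $\mathcal H=\tau_0\oplus\tau_1\oplus\dots\oplus\tau_d$ (orthogonal direct sum) with $\tau_d\neq\{0\}$. In this case: 1. There are $C_n\in\mathcal L_{\mathcal H}$, of finite rank for $n<d$, with $A(z)^{-1}=\sum_{n\ge0}C_n(1-z)^{n-d}$ in a punctured disc around $1$, and $D_n\in\mathcal L_{\mathcal H}$ such that, for some $\rho'>1$, the series $\sum_nD_nz^n$ converges absolutely for $|z|<\rho'$ and equals $A(z)^{-1}-\sum_{n<d}C_n(1-z)^{n-d}$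 for $|z|<\rho'$, $z\ne1$. Almost surely for every $t$, $$x_t=C_0s_{d,t}+C_1s_{d-1,t}+\dots+C_{d-1}s_{1,t}+y_t+\mu_t,$$ where $s_{h,t}=\mathcal S^h\varepsilon_t$ with $\mathcal Sw_t=1_{(t\ge1)}\sum_{i=1}^tw_i-1_{(t\le-1)}\sum_{i=t+1}^0w_i$, $y_t=\sum_{n\ge0}D_n\varepsilon_{t-n}$ has mean zero, and $\mu_t=\sum_{n<d}v_nt^n$ with square-integrable $\mathcal H$-valued random elements $v_n$ and $E(x_t)=E(\mu_t)$. 2. $\operatorname{Im}C_0=\tau_d$ is the attractor space and is finite dimensional; $\tau_0\oplus\dots\oplus\tau_{d-1}$ is the cointegrating space and is infinite dimensional. 3. For $h=0,1,\dots,d$ and every nonzero $v\in\tau_h$, $$\langle v,x_t\rangle+\sum_{n=1}^{d-h-1}\langle v,S_h^+A_{h+1,n}\Delta^nx_t\rangle\sim I(h)$$ (empty sums are $0$). 4. $\tau_h\subsetneq(\tau_0\oplus\dots\oplus\tau_{h-1})^\perp$ for $1\le h\le d-1$, and $\tau_d=(\tau_0\oplus\dots\oplus\tau_{d-1})^\perp\ne\{0\}$.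 -/

import Mathlib

open MeasureTheory Finset
open scoped InnerProductSpace

noncomputable section

/-! ## Processes indexed by `ℤ` -/

section Processes

variable {Ω : Type*} {E : Type*} [AddCommGroup E]

/-- The difference operator `Δ = 1 - L`. Its powers are `diffOp^[n]`. -/
def diffOp (z : ℤ → Ω → E) : ℤ → Ω → E :=
  fun t ω => z t ω - z (t - 1) ω

/-- The integral (cumulation) operator `𝒮`:
`𝒮 w_t = 1_{t ≥ 1} ∑_{i=1}^t w_i - 1_{t ≤ -1} ∑_{i=t+1}^0 w_i`. -/
def cumOp (w : ℤ → Ω → E) : ℤ → Ω → E :=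
  fun t ω =>
    (if 1 ≤ t then ∑ i ∈ Finset.Icc 1 t, w i ω else 0)
      - (if t ≤ -1 then ∑ i ∈ Finset.Icc (t + 1) 0, w i ω else 0)

end Processes

/-! ## Second-order notions for Hilbert-space valued processes -/

section SecondOrder

variable {Ω : Type*} [MeasurableSpace Ω]
variable {F : Type*} [NormedAddCommGroup F] [InnerProductSpace ℂ F] [CompleteSpace F]
variable {E : Type*} [NormedAddCommGroup E] [InnerProductSpace ℂ E] [CompleteSpace E]

/-- The cross-covariance function
`c_{Z,U}(v,w) = E(⟨v, Z - E Z⟩ conj ⟨w, U - E U⟩)`. -/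
def crossCov (P : Measure Ω) (Z U : Ω → F) (v w : F) : ℂ :=
  ∫ ω, ⟪v, Z ω - ∫ ω', Z ω' ∂P⟫_ℂ * (starRingEnd ℂ) ⟪w, U ω - ∫ ω', U ω' ∂P⟫_ℂ ∂P

/-- Weak stationarity: `0 < E‖ε_t‖² < ∞`, constant mean, and shift-invariant cross-covariances.
The case `s = t` of the last clause says that the covariance operator does not depend on `t`. -/
structure IsWeaklyStationary (P : Measure Ω) (ε : ℤ → Ω → F) : Prop where
  memLp : ∀ t, MemLp (ε t) 2 P
  pos : ∀ t, 0 < ∫ ω, ‖ε t ω‖ ^ 2 ∂P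
  mean : ∀ s t, ∫ ω, ε s ω ∂P = ∫ ω, ε t ω ∂P
  cov : ∀ (s t u : ℤ) (v w : F),
    crossCov P (ε t) (ε s) v w = crossCov P (ε (t + u)) (ε (s + u)) v w

/-- White noise: weakly stationary, centred, and uncorrelated at different times. -/
structure IsWhiteNoise (P : Measure Ω) (ε : ℤ → Ω → F) : Prop
    extends IsWeaklyStationary P ε where
  mean_zero : ∀ t, ∫ ω, ε t ω ∂P = 0
  uncorrelated : ∀ (s t : ℤ) (v w : F), s ≠ t → crossCov P (ε t) (ε s) v w = 0

/-- The covariance operator of `ε_t` is injective: no nonzero characteristic `⟨v, ε_t⟩` has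
zero variance. -/
def HasNonsingularCov (P : Measure Ω) (ε : ℤ → Ω → F) : Prop :=
  ∀ (t : ℤ) (v : F), v ≠ 0 → crossCov P (ε t) (ε t) v v ≠ 0

/-- `B(z) = ∑ B_n z^n` is absolutely convergent on `D(0,ρ)` for some `ρ > 1`. -/
def IsAbsConvergent (B : ℕ → F →L[ℂ] E) : Prop :=
  ∃ ρ : ℝ, 1 < ρ ∧ ∀ z : ℂ, ‖z‖ < ρ → Summable fun n => ‖B n‖ * ‖z‖ ^ n

/-- `u_t - E(u_t) = ∑_{n ≥ 0} B_n ε_{t-n}` almost surely for every `t`, where `B(z)` is absolutely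
convergent on a disc of radius larger than one. The mean may depend on `t`. -/
def IsLinearIn (P : Measure Ω) (ε : ℤ → Ω → F) (B : ℕ → F →L[ℂ] E) (u : ℤ → Ω → E) : Prop :=
  IsAbsConvergent B ∧ (∀ t, Integrable (u t) P) ∧
    ∀ t, ∀ᵐ ω ∂P, HasSum (fun n : ℕ => B n (ε (t - n) ω)) (u t ω - ∫ ω', u t ω' ∂P)

/-- `z_t ∼ I(d)` for a Hilbert-space valued process: `Δ^d z_t` is a linear process `B(L) η_t`
up to its mean, with `B_0 = I` and `B(1) ≠ 0`, for some white noise `η_t` with values in the same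
space and injective covariance operator. -/
def IsIntegrated (P : Measure Ω) (d : ℕ) (z : ℤ → Ω → F) : Prop :=
  ∃ (η : ℤ → Ω → F) (B : ℕ → F →L[ℂ] F),
    IsWhiteNoise P η ∧ HasNonsingularCov P η ∧ B 0 = 1 ∧
      IsLinearIn P η B (diffOp^[d] z) ∧ ∑' n, B n ≠ 0

variable (F) in
/-- `u_t ∼ I(b)` for a scalar process built from characteristics of an `F`-valued process:
`Δ^b u_t` is, up to its mean, linear in some `F`-valued white noise with injective covariance
operator, `∑ B_n η_{t-n}`, and `B(1) ≠ 0`. The coefficients `B_n` are bounded functionals on `F`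
(for `⟨v, x_t⟩` with `x_t = ∑ C_n η_{t-n}` they are `⟨v, C_n ·⟩`), so that the normalisation
`B_0 = I` has no counterpart. -/
def IsCharIntegrated (P : Measure Ω) (b : ℕ) (u : ℤ → Ω → ℂ) : Prop :=
  ∃ (η : ℤ → Ω → F) (B : ℕ → F →L[ℂ] ℂ),
    IsWhiteNoise P η ∧ HasNonsingularCov P η ∧
      IsLinearIn P η B (diffOp^[b] u) ∧ ∑' n, B n ≠ 0

/-- The cointegrating space `{v : ⟨v, z_t⟩ ∼ I(b) for some b < d} ∪ {0}` of a process of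
order `d`. -/
def cointegratingSpace (P : Measure Ω) (d : ℕ) (z : ℤ → Ω → F) : Set F :=
  {v | ∃ b < d, IsCharIntegrated F P b fun t ω => ⟪v, z t ω⟫_ℂ} ∪ {0}

/-- The attractor space: the orthogonal complement of the cointegrating space. -/
def attractorSpace (P : Measure Ω) (d : ℕ) (z : ℤ → Ω → F) : Submodule ℂ F :=
  (Submodule.span ℂ (cointegratingSpace P d z))ᗮ

end SecondOrder

/-! ## Operators -/

section Operators

variable {H : Type*} [NormedAddCommGroup H] [InnerProductSpace ℂ H] [CompleteSpace H]

/-- The four Penrose identities. -/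
structure IsGenInverse (A X : H →L[ℂ] H) : Prop where
  left : A * X * A = A
  right : X * A * X = X
  selfAdjoint_left : IsSelfAdjoint (A * X)
  selfAdjoint_right : IsSelfAdjoint (X * A)

theorem IsGenInverse.unique {A X Y : H →L[ℂ] H} (hX : IsGenInverse A X)
    (hY : IsGenInverse A Y) : X = Y := by
  have h1 : A * X = A * Y := by
    calc A * X = star (A * X) := hX.selfAdjoint_left.star_eq.symm
      _ = star ((A * Y) * (A * X)) := by rw [← mul_assoc, hY.left]
      _ = star (A * X) * star (A * Y) := star_mul _ _
      _ = (A * X) * (A * Y) := by rw [hX.selfAdjoint_left.star_eq, hY.selfAdjoint_left.star_eq]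
      _ = A * Y := by rw [← mul_assoc, hX.left]
  have h2 : X * A = Y * A := by
    calc X * A = star (X * A) := hX.selfAdjoint_right.star_eq.symm
      _ = star ((X * A) * (Y * A)) := by rw [mul_assoc, ← mul_assoc A Y A, hY.left]
      _ = star (Y * A) * star (X * A) := star_mul _ _
      _ = (Y * A) * (X * A) := by rw [hX.selfAdjoint_right.star_eq, hY.selfAdjoint_right.star_eq]
      _ = Y * A := by rw [mul_assoc, ← mul_assoc A X A, hX.left]
  calc X = X * A * X := hX.right.symm
    _ = Y * (A * X) := by rw [h2, mul_assoc]
    _ = Y * A * Y := by rw [h1, mul_assoc]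
    _ = Y := hY.right

open Classical in
/-- The generalized (Moore–Penrose) inverse `A⁺`. It exists, as a bounded operator, when the range
of `A` is closed, and it is unique by `IsGenInverse.unique`; otherwise the value is `0`. -/
def genInverse (A : H →L[ℂ] H) : H →L[ℂ] H :=
  if h : ∃ X, IsGenInverse A X then h.choose else 0

/-- `A(z) = I - ∑_{h=1}^k A_h z^h`. -/
def arOp (k : ℕ) (A : ℕ → H →L[ℂ] H) (z : ℂ) : H →L[ℂ] H :=
  1 - ∑ h ∈ Finset.Icc 1 k, z ^ h • A h

/-- The coefficients of the expansion `A(z) = ∑ A_n (1-z)^n`, namely `A_0 = I - ∑_{h=1}^k A_h`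
and `A_n = (-1)^{n+1} ∑_{j=n}^k binom(j,n) A_j` for `n ≥ 1` (on the right the `A_j` are the
autoregressive coefficients). -/
def arCoeff (k : ℕ) (A : ℕ → H →L[ℂ] H) (n : ℕ) : H →L[ℂ] H :=
  if n = 0 then 1 - ∑ h ∈ Finset.Icc 1 k, A h
  else (-1 : ℂ) ^ (n + 1) • ∑ j ∈ Finset.Icc n k, (j.choose n : ℂ) • A j

/-- `z₀` is an eigenvalue of finite type of the operator function `W`. -/
structure IsEigenvalueOfFiniteType (W : ℂ → H →L[ℂ] H) (z₀ : ℂ) : Prop where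
  fredholm : (W z₀).IsFredholm
  eigenvalue : ∃ v : H, v ≠ 0 ∧ W z₀ v = 0
  isolated : ∃ δ : ℝ, 0 < δ ∧ ∀ z : ℂ, 0 < ‖z - z₀‖ → ‖z - z₀‖ < δ → IsUnit (W z)

/-- `A(z)` has an eigenvalue of finite type at `z = 1` and is invertible on `D(0,ρ) \ {1}` for some
`ρ > 1`. -/
def HasUnitRootOfFiniteType (k : ℕ) (A : ℕ → H →L[ℂ] H) : Prop :=
  IsEigenvalueOfFiniteType (arOp k A) 1 ∧
    ∃ ρ : ℝ, 1 < ρ ∧ ∀ z : ℂ, ‖z‖ < ρ → z ≠ 1 → IsUnit (arOp k A z)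

/-- The orthogonal projection `P_{U^⊥}`. -/
def projPerp (U : Submodule ℂ H) : H →L[ℂ] H :=
  Submodule.starProjection (Submodule.orthogonal U)

/-- The pair `(S_h, n ↦ A_{h+1,n})`, by recursion on `h`, for `A(z) = ∑ a_n (1-z)^n`. -/
def lrf (a : ℕ → H →L[ℂ] H) : ℕ → (H →L[ℂ] H) × (ℕ → H →L[ℂ] H)
  | 0 => (a 0, a)
  | h + 1 =>
    (projPerp (⨆ j : Fin (h + 1), (lrf a j).1.range) * (lrf a h).2 1
        * projPerp (⨆ j : Fin (h + 1), Submodule.orthogonal (lrf a j).1.ker),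
      fun n => (lrf a h).2 (n + 1)
        - (lrf a h).2 1 * ∑ j : Fin (h + 1), genInverse (lrf a j).1 * (lrf a j).2 n)
termination_by h => h
decreasing_by all_goals omega

/-- `S_h`. -/
def lrfS (a : ℕ → H →L[ℂ] H) (h : ℕ) : H →L[ℂ] H := (lrf a h).1

/-- `A_{h,n}`, for `h ≥ 1` and `n ≥ 1`. -/
def lrfA (a : ℕ → H →L[ℂ] H) (h n : ℕ) : H →L[ℂ] H := (lrf a (h - 1)).2 n

/-- `ζ_h = Im S_h`. -/
def lrfZeta (a : ℕ → H →L[ℂ] H) (h : ℕ) : Submodule ℂ H := (lrfS a h).range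

/-- `τ_h = (Ker S_h)^⊥`. -/
def lrfTau (a : ℕ → H →L[ℂ] H) (h : ℕ) : Submodule ℂ H := (lrfS a h).kerᗮ

/-- `𝒵_h = ζ_0 ⊕ ⋯ ⊕ ζ_{h-1}`. -/
def lrfZ (a : ℕ → H →L[ℂ] H) (h : ℕ) : Submodule ℂ H := ⨆ j : Fin h, lrfZeta a j

/-- `𝒯_h = τ_0 ⊕ ⋯ ⊕ τ_{h-1}`. -/
def lrfT (a : ℕ → H →L[ℂ] H) (h : ℕ) : Submodule ℂ H := ⨆ j : Fin h, lrfTau a j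

theorem lrfS_zero (a : ℕ → H →L[ℂ] H) : lrfS a 0 = a 0 := by
  rw [lrfS, lrf]

theorem lrfS_of_pos (a : ℕ → H →L[ℂ] H) {h : ℕ} (hh : 1 ≤ h) :
    lrfS a h = projPerp (lrfZ a h) * lrfA a h 1 * projPerp (lrfT a h) := by
  obtain ⟨m, rfl⟩ : ∃ m, h = m + 1 := ⟨h - 1, by omega⟩
  rw [lrfS, lrf]
  rfl

theorem lrfA_one (a : ℕ → H →L[ℂ] H) (n : ℕ) : lrfA a 1 n = a n := by
  simp [lrfA, lrf]

theorem lrfA_of_two_le (a : ℕ → H →L[ℂ] H) {h : ℕ} (hh : 2 ≤ h) (n : ℕ) :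
    lrfA a h n = lrfA a (h - 1) (n + 1)
      - lrfA a (h - 1) 1 * ∑ j ∈ Finset.range (h - 1),
          genInverse (lrfS a j) * lrfA a (j + 1) n := by
  obtain ⟨m, rfl⟩ : ∃ m, h = m + 2 := ⟨h - 2, by omega⟩
  rw [Finset.sum_range]
  simp only [lrfA, lrfS, Nat.add_sub_cancel, show m + 2 - 1 = m + 1 by omega]
  rw [lrf]
  rfl

/-- The condition `H = τ_0 ⊕ ⋯ ⊕ τ_d` (orthogonal direct sum), `τ_d ≠ {0}`. -/
def PoleCondition (a : ℕ → H →L[ℂ] H) (d : ℕ) : Prop :=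
  (∀ i j, i ≤ d → j ≤ d → i ≠ j → lrfTau a i ⟂ lrfTau a j) ∧
    lrfT a (d + 1) = ⊤ ∧ lrfTau a d ≠ ⊥

/-- `A(z)⁻¹ = ∑_{n ≥ 0} C_n (1-z)^{n-d}` on a punctured disc around `1`. -/
def IsLaurentExpansion (k : ℕ) (A : ℕ → H →L[ℂ] H) (d : ℕ) (C : ℕ → H →L[ℂ] H) : Prop :=
  ∃ δ : ℝ, 0 < δ ∧ ∀ z : ℂ, 0 < ‖z - 1‖ → ‖z - 1‖ < δ →
    IsUnit (arOp k A z) ∧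
      HasSum (fun n : ℕ => (1 - z) ^ ((n : ℤ) - (d : ℤ)) • C n) (Ring.inverse (arOp k A z))

/-- `D(z) = ∑ D_n z^n` is the part `A(z)⁻¹ - ∑_{n<d} C_n (1-z)^{n-d}` of the inverse that remains
after removing the principal part; it is absolutely convergent on `D(0,ρ)` for some `ρ > 1`. -/
def IsRegularPart (k : ℕ) (A : ℕ → H →L[ℂ] H) (d : ℕ) (C D : ℕ → H →L[ℂ] H) : Prop :=
  ∃ ρ : ℝ, 1 < ρ ∧ ∀ z : ℂ, ‖z‖ < ρ → (Summable fun n => ‖D n‖ * ‖z‖ ^ n) ∧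
    (z ≠ 1 → IsUnit (arOp k A z) ∧
      HasSum (fun n : ℕ => z ^ n • D n)
        (Ring.inverse (arOp k A z)
          - ∑ n ∈ Finset.range d, (1 - z) ^ ((n : ℤ) - (d : ℤ)) • C n))

end Operators

/-! ## The autoregressive process -/

section AR

variable {Ω : Type*} [MeasurableSpace Ω]
variable {H : Type*} [NormedAddCommGroup H] [InnerProductSpace ℂ H] [CompleteSpace H]

/-- `x_t = A_1 x_{t-1} + ⋯ + A_k x_{t-k} + ε_t` for all `t ∈ ℤ`, almost surely, where `x_t` is square
integrable and its second moment grows at most polynomially as `t → -∞`. The last clause excludes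
the explosive solutions of the homogeneous equation. -/
structure IsARProcess (P : Measure Ω) (k : ℕ) (A : ℕ → H →L[ℂ] H) (ε x : ℤ → Ω → H) : Prop where
  memLp : ∀ t, MemLp (x t) 2 P
  eqn : ∀ t : ℤ, ∀ᵐ ω ∂P, x t ω = (∑ h ∈ Finset.Icc 1 k, A h (x (t - h) ω)) + ε t ω
  growth : ∃ (K : ℝ) (m : ℕ), ∀ t : ℤ, t ≤ 0 → ∫ ω, ‖x t ω‖ ^ 2 ∂P ≤ K * (1 + |(t : ℝ)|) ^ m

/-- The common trends representation
`x_t = C_0 s_{d,t} + ⋯ + C_{d-1} s_{1,t} + y_t + μ_t`, with `s_{h,t} = 𝒮^h ε_t`,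
`y_t = ∑ D_n ε_{t-n}` and `μ_t = ∑_{n<d} v_n t^n`. The `v_n` are square integrable random
elements (they depend on initial values), and `∑_{n<d} E(v_n) t^n` is the expectation of `x_t`. -/
def HasCommonTrends (P : Measure Ω) (d : ℕ) (C D : ℕ → H →L[ℂ] H) (ε x : ℤ → Ω → H) : Prop :=
  ∃ (y : ℤ → Ω → H) (v : ℕ → Ω → H),
    IsLinearIn P ε D y ∧ (∀ t, ∫ ω, y t ω ∂P = 0) ∧ (∀ n, MemLp (v n) 2 P) ∧
    (∀ t : ℤ, ∀ᵐ ω ∂P,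
      x t ω = (∑ n ∈ Finset.range d, C n (cumOp^[d - n] ε t ω)) + y t ω
        + ∑ n ∈ Finset.range d, ((t : ℂ) ^ n) • v n ω) ∧
    ∀ t : ℤ, ∫ ω, x t ω ∂P = ∑ n ∈ Finset.range d, ((t : ℂ) ^ n) • ∫ ω, v n ω ∂P

end AR

end

/-!
Put `w = 1 - z`, so that `A(z) = ∑ w^n A_n`, and let `P_j = S_j⁺ S_j` be the orthogonal projection
on `τ_j`. The recursion for `S_h` and `A_{h,n}` is a Gaussian elimination: there are polynomials
`F_h(w)` with `F_h(0) = I` and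
`S_h⁺ F_h(w) A(z) = w^h (P_h + ∑_{n ≥ 1} w^n S_h⁺ A_{h+1,n})`
(`HasGenInverses.genInverse_mul_lrfF_mul_polyOp`). If `τ_0 ⊕ ⋯ ⊕ τ_d` is the whole space, the `P_h`
with `h ≤ d` sum to the identity, and the sum of these identities multiplied by `w^{d-h}` reads
`M(w) A(z) = w^d N(w)` with `N(0) = I` and `M(0) = S_d⁺`. Hence `f(z) = (1 - z)^d A(z)⁻¹` extends
holomorphically to `z = 1`, where its value is `S_d⁺`, whose range is `τ_d`
(`HasUnitRootOfFiniteType.exists_inverse`). The elimination does terminate, since a vector left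
over by all steps would yield a holomorphic `y ≠ 0` such that `A(z) y(z)` vanishes to infinite order
at `z = 1` (`exists_lrfT_eq_top`).

For a function `f` holomorphic on a disc of radius larger than one, `f(L)` acts on all paths that
grow at `-∞` slower than every exponential, and `f ↦ f(L)` is multiplicative (`lagOp_comp`). White
noise and, by the growth condition, the solution `x_t` have such paths almost surely. So every
identity `g(z) A(z) = Q(z)` yields `Q(L) x_t = g(L) ε_t` (`IsARProcess.ae_lagOp_eq`), and all the
representations are instances: `Δ^d x_t = f(L) ε_t`; the common trends, from the expansion of
`f` at `z = 1`, where the remainder is annihilated by `Δ^d` and therefore is a polynomial in `t`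
(`eq_polynomial_of_pathDiff_iterate_eq_zero`); and the relations for `⟨v, x_t⟩`, `v ∈ τ_h`,
from the elimination identities (`PoleCondition.isCharIntegrated`).

Orders of integration are unique because `f(L) ε_t = Δ^p g(L) η_t` with `p ≥ 1` forces `f(1) = 0`
(`IsWhiteNoise.apply_one_eq_zero`): otherwise a functional of white noise would be the
difference of a process bounded in `L²`, while the second moments of its partial sums grow linearly.
With the existence of a pole order this gives the equivalence, and also the cointegrating space:
`⟨v, x_t⟩` has an order below `d` exactly when `⟨v, S_d⁺ ·⟩ = 0`, that is, when `v ⟂ τ_d`.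
-/


open Filter Topology

/-! ### Moore–Penrose inverses -/

section GenInverse

variable {H : Type*} [NormedAddCommGroup H] [InnerProductSpace ℂ H] [CompleteSpace H]

/-- An operator with closed range has a bounded generalized inverse: restrict it to a bijection of
`(Ker A)ᗮ` onto `Im A` and invert. -/
theorem exists_isGenInverse (A : H →L[ℂ] H) (hA : IsClosed (A.range : Set H)) :
    ∃ X, IsGenInverse A X := by
  have : CompleteSpace A.range := hA.completeSpace_coe
  let K : Submodule ℂ H := A.kerᗮ
  let f : K →L[ℂ] A.range := (A.comp K.subtypeL).codRestrict A.range (fun x => ⟨x, rfl⟩)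
  have : CompleteSpace A.ker := (ContinuousLinearMap.isClosed_ker A).completeSpace_coe
  have hfinj : f.ker = ⊥ := by
    rw [Submodule.eq_bot_iff]
    rintro ⟨x, hx⟩ hfx
    have h0 : A x = 0 := congrArg Subtype.val hfx
    have : x ∈ A.ker ⊓ A.kerᗮ := ⟨h0, hx⟩
    rw [Submodule.inf_orthogonal_eq_bot] at this
    exact Subtype.ext this
  have hAproj : ∀ x, A (K.starProjection x) = A x := by
    intro x
    have h1 : A.kerᗮ.starProjection x + A.ker.starProjection x = x := by
      rw [add_comm]; exact A.ker.starProjection_add_starProjection_orthogonal x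
    have h2 : A (A.ker.starProjection x) = 0 := A.ker.starProjection_apply_mem x
    conv_rhs => rw [← h1, map_add, h2, add_zero]
  have hfsurj : f.range = ⊤ := by
    rw [Submodule.eq_top_iff']
    rintro ⟨_, x, rfl⟩
    exact ⟨⟨K.starProjection x, K.starProjection_apply_mem x⟩, Subtype.ext (hAproj x)⟩
  let e := ContinuousLinearEquiv.ofBijective f hfinj hfsurj
  let X : H →L[ℂ] H := K.subtypeL ∘L (e.symm : A.range →L[ℂ] K) ∘L A.range.orthogonalProjectionOnto
  have hAX : A * X = A.range.starProjection := by
    ext x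
    have : f (e.symm (A.range.orthogonalProjectionOnto x)) = A.range.orthogonalProjectionOnto x :=
      e.apply_symm_apply _
    exact congrArg Subtype.val this
  have hXA : X * A = K.starProjection := by
    ext x
    have h1 : A.range.orthogonalProjectionOnto (A x)
        = f ⟨K.starProjection x, K.starProjection_apply_mem x⟩ := by
      apply Subtype.ext
      have : A.range.starProjection (A x) = A x :=
        Submodule.starProjection_eq_self_iff.2 ⟨x, rfl⟩
      exact this.trans (hAproj x).symm
    have h2 : e.symm (A.range.orthogonalProjectionOnto (A x))
        = ⟨K.starProjection x, K.starProjection_apply_mem x⟩ := by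
      rw [h1]; exact e.symm_apply_apply _
    exact congrArg Subtype.val h2
  refine ⟨X, ?_, ?_, ?_, ?_⟩
  · rw [hAX]; ext x
    exact Submodule.starProjection_eq_self_iff.2 ⟨x, rfl⟩
  · rw [hXA]; ext x
    exact Submodule.starProjection_eq_self_iff.2 (e.symm (A.range.orthogonalProjectionOnto x)).2
  · rw [hAX]; exact isSelfAdjoint_starProjection _
  · rw [hXA]; exact isSelfAdjoint_starProjection _

theorem genInverse_spec {A : H →L[ℂ] H} (hA : IsClosed (A.range : Set H)) :
    IsGenInverse A (genInverse A) := by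
  have h := exists_isGenInverse A hA
  rw [genInverse, dif_pos h]
  exact h.choose_spec

/-- `1 - p` for a self-adjoint idempotent `p` is the projection on `Uᗮ` whenever `Uᗮ` is the kernel
of `p`; the subspace `U` need not be closed. -/
theorem projPerp_eq_one_sub {U : Submodule ℂ H} {p : H →L[ℂ] H} (hidem : p * p = p)
    (hsa : IsSelfAdjoint p) (hU : ∀ x, x ∈ Uᗮ ↔ p x = 0) : projPerp U = 1 - p := by
  have hp2 : ∀ x, p (p x) = p x := fun x => congrArg (fun T : H →L[ℂ] H => T x) hidem
  have hsym : ∀ x y, ⟪p x, y⟫_ℂ = ⟪x, p y⟫_ℂ := hsa.isSymmetric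
  ext x
  refine Submodule.eq_starProjection_of_mem_orthogonal (K := Uᗮ) ?_ ?_
  · rw [hU]; simp [hp2]
  · have : x - (1 - p) x = p x := by simp
    rw [this, Submodule.mem_orthogonal']
    intro u hu
    rw [hsym, (hU u).1 hu, inner_zero_right]

theorem IsGenInverse.left_mul_eq_zero_iff {A X : H →L[ℂ] H} (h : IsGenInverse A X) (x : H) :
    (A * X) x = 0 ↔ x ∈ A.rangeᗮ := by
  have hsym : ∀ x y, ⟪(A * X) x, y⟫_ℂ = ⟪x, (A * X) y⟫_ℂ := h.selfAdjoint_left.isSymmetric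
  rw [Submodule.mem_orthogonal']
  constructor
  · rintro hx _ ⟨y, rfl⟩
    have h1 : A y = (A * X) (A y) := (congrArg (fun T : H →L[ℂ] H => T y) h.left).symm
    change ⟪x, A y⟫_ℂ = 0
    rw [h1, ← hsym, hx, inner_zero_left]
  · intro hx
    rw [← inner_self_eq_zero (𝕜 := ℂ), hsym]
    exact hx _ ⟨_, rfl⟩

theorem IsGenInverse.right_mul_eq_zero_iff {A X : H →L[ℂ] H} (h : IsGenInverse A X) (x : H) :
    (X * A) x = 0 ↔ x ∈ A.ker := by
  constructor
  · intro hx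
    have h1 : A x = A ((X * A) x) := (congrArg (fun T : H →L[ℂ] H => T x) h.left).symm
    change A x = 0
    rw [h1, hx, map_zero]
  · intro hx
    have h1 : A x = 0 := hx
    change X (A x) = 0
    rw [h1, map_zero]

end GenInverse

/-! ### The projections on `τ_j` and `ζ_j` -/

section Projections

variable {H : Type*} [NormedAddCommGroup H] [InnerProductSpace ℂ H] [CompleteSpace H]

/-- The orthogonal projection `S_j⁺ S_j` on `τ_j`. -/
noncomputable def lrfP (a : ℕ → H →L[ℂ] H) (j : ℕ) : H →L[ℂ] H := genInverse (lrfS a j) * lrfS a j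

/-- The orthogonal projection `S_j S_j⁺` on `ζ_j`. -/
noncomputable def lrfQ (a : ℕ → H →L[ℂ] H) (j : ℕ) : H →L[ℂ] H := lrfS a j * genInverse (lrfS a j)

/-- All the operators `S_j` have closed range, so that the `S_j⁺` are generalized inverses. -/
def HasGenInverses (a : ℕ → H →L[ℂ] H) : Prop :=
  ∀ j, IsGenInverse (lrfS a j) (genInverse (lrfS a j))

variable {a : ℕ → H →L[ℂ] H}

theorem mem_orthogonal_lrfZ {h : ℕ} {x : H} : x ∈ (lrfZ a h)ᗮ ↔ ∀ j < h, x ∈ (lrfZeta a j)ᗮ := by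
  rw [lrfZ, ← Submodule.iInf_orthogonal, Submodule.mem_iInf]
  exact ⟨fun H j hj => H ⟨j, hj⟩, fun H j => H j j.2⟩

theorem mem_orthogonal_lrfT {h : ℕ} {x : H} : x ∈ (lrfT a h)ᗮ ↔ ∀ j < h, lrfS a j x = 0 := by
  rw [lrfT, ← Submodule.iInf_orthogonal, Submodule.mem_iInf]
  have key : ∀ j, x ∈ (lrfTau a j)ᗮ ↔ lrfS a j x = 0 := by
    intro j
    have : CompleteSpace (lrfS a j).ker :=
      (ContinuousLinearMap.isClosed_ker (lrfS a j)).completeSpace_coe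
    rw [lrfTau, Submodule.orthogonal_orthogonal]
    rfl
  exact ⟨fun H j hj => (key j).1 (H ⟨j, hj⟩), fun H j => (key j).2 (H j j.2)⟩

theorem lrfTau_le_lrfT {j h : ℕ} (hj : j < h) : lrfTau a j ≤ lrfT a h :=
  le_iSup (fun i : Fin h => lrfTau a i) ⟨j, hj⟩

theorem lrfT_mono {i j : ℕ} (hij : i ≤ j) : lrfT a i ≤ lrfT a j :=
  iSup_le fun l => lrfTau_le_lrfT (l.2.trans_le hij)

theorem lrfT_succ (h : ℕ) : lrfT a (h + 1) = lrfT a h ⊔ lrfTau a h := by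
  refine le_antisymm (iSup_le fun l => ?_)
    (sup_le (lrfT_mono h.le_succ) (lrfTau_le_lrfT h.lt_succ_self))
  rcases Nat.lt_succ_iff_lt_or_eq.1 l.2 with hl | hl
  · exact (lrfTau_le_lrfT hl).trans le_sup_left
  · rw [hl]; exact le_sup_right

theorem lrfS_mem_orthogonal_lrfZ (h : ℕ) (x : H) : lrfS a h x ∈ (lrfZ a h)ᗮ := by
  rcases Nat.eq_zero_or_pos h with rfl | hh
  · rw [mem_orthogonal_lrfZ]; intro j hj; omega
  · rw [lrfS_of_pos a hh]
    exact Submodule.starProjection_apply_mem _ _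

theorem lrfS_apply_of_mem_lrfT {h : ℕ} {x : H} (hx : x ∈ lrfT a h) : lrfS a h x = 0 := by
  rcases Nat.eq_zero_or_pos h with rfl | hh
  · have : lrfT a 0 = ⊥ := by simp [lrfT]
    rw [this, Submodule.mem_bot] at hx
    rw [hx, map_zero]
  · rw [lrfS_of_pos a hh]
    have : projPerp (lrfT a h) x = 0 := by
      rw [projPerp, Submodule.starProjection_apply_eq_zero_iff]
      exact Submodule.le_orthogonal_orthogonal _ hx
    change projPerp (lrfZ a h) (lrfA a h 1 (projPerp (lrfT a h) x)) = 0
    rw [this, map_zero, map_zero]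

theorem lrfTau_le_orthogonal_lrfT (h : ℕ) : lrfTau a h ≤ (lrfT a h)ᗮ :=
  Submodule.orthogonal_le fun _ hx => lrfS_apply_of_mem_lrfT hx

theorem lrfTau_isOrtho {i j : ℕ} (hij : i ≠ j) : lrfTau a i ⟂ lrfTau a j := by
  rcases lt_or_gt_of_ne hij with h | h
  · refine Submodule.IsOrtho.symm ?_
    exact (lrfTau_le_orthogonal_lrfT j).trans (Submodule.orthogonal_le (lrfTau_le_lrfT h))
  · exact (lrfTau_le_orthogonal_lrfT i).trans (Submodule.orthogonal_le (lrfTau_le_lrfT h))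

namespace HasGenInverses

theorem lrfP_apply_mem (hG : HasGenInverses a) (j : ℕ) (x : H) : lrfP a j x ∈ lrfTau a j := by
  rw [lrfTau, Submodule.mem_orthogonal']
  intro u hu
  have hsym : ⟪lrfP a j x, u⟫_ℂ = ⟪x, lrfP a j u⟫_ℂ := (hG j).selfAdjoint_right.isSymmetric x u
  rw [hsym, show lrfP a j u = 0 from ((hG j).right_mul_eq_zero_iff u).2 hu, inner_zero_right]

theorem lrfP_mul_self (hG : HasGenInverses a) (j : ℕ) : lrfP a j * lrfP a j = lrfP a j := by
  simp only [lrfP]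
  rw [← mul_assoc, (hG j).right]

theorem lrfQ_mul_self (hG : HasGenInverses a) (j : ℕ) : lrfQ a j * lrfQ a j = lrfQ a j := by
  simp only [lrfQ]
  rw [← mul_assoc, (hG j).left]

theorem lrfP_apply_of_mem (hG : HasGenInverses a) {j : ℕ} {x : H} (hx : x ∈ lrfTau a j) :
    lrfP a j x = x := by
  have h1 : lrfP a j x - x ∈ (lrfS a j).ker := by
    rw [← (hG j).right_mul_eq_zero_iff, map_sub]
    exact sub_eq_zero.2 (congrArg (fun T : H →L[ℂ] H => T x) (hG.lrfP_mul_self j))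
  have h2 : lrfP a j x - x ∈ (lrfS a j).kerᗮ := Submodule.sub_mem _ (hG.lrfP_apply_mem j x) hx
  have h3 : lrfP a j x - x ∈ (lrfS a j).ker ⊓ (lrfS a j).kerᗮ := ⟨h1, h2⟩
  rw [Submodule.inf_orthogonal_eq_bot] at h3
  exact sub_eq_zero.1 h3

theorem lrfP_mul_of_ne (hG : HasGenInverses a) {i j : ℕ} (hij : i ≠ j) :
    lrfP a i * lrfP a j = 0 := by
  ext x
  have h1 : lrfP a j x ∈ (lrfTau a i)ᗮ := (lrfTau_isOrtho hij.symm) (hG.lrfP_apply_mem j x)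
  have : CompleteSpace (lrfS a i).ker :=
    (ContinuousLinearMap.isClosed_ker (lrfS a i)).completeSpace_coe
  rw [lrfTau, Submodule.orthogonal_orthogonal] at h1
  exact ((hG i).right_mul_eq_zero_iff _).2 h1

theorem lrfQ_mul_of_lt (hG : HasGenInverses a) {i j : ℕ} (hij : i < j) :
    lrfQ a i * lrfQ a j = 0 := by
  ext x
  refine ((hG i).left_mul_eq_zero_iff _).2 ?_
  exact mem_orthogonal_lrfZ.1 (lrfS_mem_orthogonal_lrfZ (a := a) j _) i hij

theorem lrfQ_mul_of_ne (hG : HasGenInverses a) {i j : ℕ} (hij : i ≠ j) :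
    lrfQ a i * lrfQ a j = 0 := by
  rcases lt_or_gt_of_ne hij with h | h
  · exact hG.lrfQ_mul_of_lt h
  · have h1 := congrArg star (hG.lrfQ_mul_of_lt h)
    rwa [star_mul, star_zero, show star (lrfQ a i) = lrfQ a i from (hG i).selfAdjoint_left.star_eq,
      show star (lrfQ a j) = lrfQ a j from (hG j).selfAdjoint_left.star_eq] at h1

end HasGenInverses

theorem sum_mul_sum_of_orthogonal {R : Type*} [Ring R] {p : ℕ → R} (h1 : ∀ j, p j * p j = p j)
    (h2 : ∀ i j, i ≠ j → p i * p j = 0) (h : ℕ) {i : ℕ} (hi : i < h) :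
    p i * ∑ j ∈ range h, p j = p i := by
  rw [Finset.mul_sum, Finset.sum_eq_single i (fun j _ hj => h2 i j hj.symm)
    (fun hn => absurd (Finset.mem_range.2 hi) hn), h1]

namespace HasGenInverses

theorem projPerp_lrfT (hG : HasGenInverses a) (h : ℕ) :
    projPerp (lrfT a h) = 1 - ∑ j ∈ range h, lrfP a j := by
  have key := fun {i} => sum_mul_sum_of_orthogonal (i := i) hG.lrfP_mul_self
    (fun i j => hG.lrfP_mul_of_ne) h
  refine projPerp_eq_one_sub ?_ ?_ ?_
  · rw [Finset.sum_mul]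
    exact Finset.sum_congr rfl fun i hi => key (Finset.mem_range.1 hi)
  · exact isSelfAdjoint_sum _ fun j _ => (hG j).selfAdjoint_right
  · intro x
    rw [mem_orthogonal_lrfT]
    constructor
    · intro hx
      rw [_root_.sum_apply]
      refine Finset.sum_eq_zero fun j hj => ?_
      exact ((hG j).right_mul_eq_zero_iff x).2 (hx j (Finset.mem_range.1 hj))
    · intro hx j hj
      refine ((hG j).right_mul_eq_zero_iff x).1 ?_
      have := congrArg (fun T : H →L[ℂ] H => T x) (key hj)
      change lrfP a j ((∑ j ∈ range h, lrfP a j) x) = lrfP a j x at this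
      rw [hx, map_zero] at this
      exact this.symm

theorem projPerp_lrfZ (hG : HasGenInverses a) (h : ℕ) :
    projPerp (lrfZ a h) = 1 - ∑ j ∈ range h, lrfQ a j := by
  have key := fun {i} => sum_mul_sum_of_orthogonal (i := i) hG.lrfQ_mul_self
    (fun i j => hG.lrfQ_mul_of_ne) h
  refine projPerp_eq_one_sub ?_ ?_ ?_
  · rw [Finset.sum_mul]
    exact Finset.sum_congr rfl fun i hi => key (Finset.mem_range.1 hi)
  · exact isSelfAdjoint_sum _ fun j _ => (hG j).selfAdjoint_left
  · intro x
    rw [mem_orthogonal_lrfZ]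
    constructor
    · intro hx
      rw [_root_.sum_apply]
      refine Finset.sum_eq_zero fun j hj => ?_
      exact ((hG j).left_mul_eq_zero_iff x).2 (hx j (Finset.mem_range.1 hj))
    · intro hx j hj
      refine ((hG j).left_mul_eq_zero_iff x).1 ?_
      have := congrArg (fun T : H →L[ℂ] H => T x) (key hj)
      change lrfQ a j ((∑ j ∈ range h, lrfQ a j) x) = lrfQ a j x at this
      rw [hx, map_zero] at this
      exact this.symm

theorem lrfQ_mul_lrfS_of_ne (hG : HasGenInverses a) {i j : ℕ} (hij : i ≠ j) :
    lrfQ a i * lrfS a j = 0 := by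
  rw [← (hG j).left]
  change lrfQ a i * (lrfQ a j * lrfS a j) = 0
  rw [← mul_assoc, hG.lrfQ_mul_of_ne hij, zero_mul]

theorem genInverse_mul_lrfQ (hG : HasGenInverses a) (j : ℕ) :
    genInverse (lrfS a j) * lrfQ a j = genInverse (lrfS a j) := by
  rw [lrfQ, ← mul_assoc, (hG j).right]

theorem genInverse_mul_lrfQ_of_ne (hG : HasGenInverses a) {i j : ℕ} (hij : i ≠ j) :
    genInverse (lrfS a i) * lrfQ a j = 0 := by
  rw [← hG.genInverse_mul_lrfQ, mul_assoc, hG.lrfQ_mul_of_ne hij, mul_zero]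

theorem lrfP_mul_genInverse (hG : HasGenInverses a) (j : ℕ) :
    lrfP a j * genInverse (lrfS a j) = genInverse (lrfS a j) := (hG j).right

theorem lrfP_mul_genInverse_of_ne (hG : HasGenInverses a) {i j : ℕ} (hij : i ≠ j) :
    lrfP a i * genInverse (lrfS a j) = 0 := by
  rw [← hG.lrfP_mul_genInverse, ← mul_assoc, hG.lrfP_mul_of_ne hij, zero_mul]

theorem genInverse_mul_lrfS_of_ne (hG : HasGenInverses a) {i j : ℕ} (hij : i ≠ j) :
    genInverse (lrfS a i) * lrfS a j = 0 := by
  rw [← hG.genInverse_mul_lrfQ, mul_assoc, hG.lrfQ_mul_lrfS_of_ne hij, mul_zero]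

theorem genInverse_mul_projPerp (hG : HasGenInverses a) (h : ℕ) :
    genInverse (lrfS a h) * projPerp (lrfZ a h) = genInverse (lrfS a h) := by
  rw [hG.projPerp_lrfZ, mul_sub, mul_one, Finset.mul_sum, Finset.sum_eq_zero, sub_zero]
  intro j hj
  exact hG.genInverse_mul_lrfQ_of_ne (Finset.mem_range.1 hj).ne'

theorem projPerp_succ_mul_projPerp (hG : HasGenInverses a) (h : ℕ) :
    projPerp (lrfZ a (h + 1)) * projPerp (lrfZ a h) = projPerp (lrfZ a (h + 1)) := by
  have key := fun {i} => sum_mul_sum_of_orthogonal (i := i) hG.lrfQ_mul_self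
    (fun i j => hG.lrfQ_mul_of_ne) h
  have h1 : (∑ j ∈ range h, lrfQ a j) * ∑ j ∈ range h, lrfQ a j = ∑ j ∈ range h, lrfQ a j := by
    rw [Finset.sum_mul]
    exact Finset.sum_congr rfl fun i hi => key (Finset.mem_range.1 hi)
  have h2 : lrfQ a h * ∑ j ∈ range h, lrfQ a j = 0 := by
    rw [Finset.mul_sum]
    exact Finset.sum_eq_zero fun j hj => hG.lrfQ_mul_of_ne (Finset.mem_range.1 hj).ne'
  rw [hG.projPerp_lrfZ, hG.projPerp_lrfZ, Finset.sum_range_succ]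
  rw [mul_sub, mul_one, sub_mul, add_mul, h1, h2]
  simp

theorem projPerp_succ_mul_lrfS (hG : HasGenInverses a) (h : ℕ) :
    projPerp (lrfZ a (h + 1)) * lrfS a h = 0 := by
  rw [hG.projPerp_lrfZ, sub_mul, one_mul, Finset.sum_mul, Finset.sum_eq_single h, lrfQ, (hG h).left,
    sub_self]
  · intro j _ hj; exact hG.lrfQ_mul_lrfS_of_ne hj
  · simp

theorem lrfT_eq_top_iff (hG : HasGenInverses a) (h : ℕ) :
    lrfT a h = ⊤ ↔ ∑ j ∈ range h, lrfP a j = 1 := by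
  constructor
  · intro ht
    have h1 := hG.projPerp_lrfT h
    rw [ht, projPerp] at h1
    have : (⊤ : Submodule ℂ H)ᗮ.starProjection = 0 := by
      rw [Submodule.starProjection_orthogonal', Submodule.starProjection_top', sub_self]
    rw [this] at h1
    exact (sub_eq_zero.1 h1.symm).symm
  · intro hs
    rw [Submodule.eq_top_iff']
    intro x
    have : x = (∑ j ∈ range h, lrfP a j) x := by rw [hs]; rfl
    rw [this, _root_.sum_apply]
    exact Submodule.sum_mem _ fun j hj =>
      lrfTau_le_lrfT (Finset.mem_range.1 hj) (hG.lrfP_apply_mem j x)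

end HasGenInverses

/-- For Fredholm `A_0` the operators `S_h`, `h ≥ 1`, have finite rank, so every `S_h` has closed
range. -/
theorem hasGenInverses_of_isFredholm (h0 : (a 0).IsFredholm) : HasGenInverses a := by
  intro j
  apply genInverse_spec
  rcases Nat.eq_zero_or_pos j with rfl | hj
  · rw [lrfS_zero]; exact h0.isClosed_range
  · have h1 : (lrfS a j).range ≤ (a 0).rangeᗮ := by
      rintro _ ⟨x, rfl⟩
      have := mem_orthogonal_lrfZ.1 (lrfS_mem_orthogonal_lrfZ (a := a) j x) 0 hj
      rwa [lrfZeta, lrfS_zero] at this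
    have h2 : FiniteDimensional ℂ (a 0).rangeᗮ :=
      Module.Finite.iff_fg.2 (h0.finite_coker.fg_of_disjoint (Submodule.orthogonal_disjoint _).symm)
    have : FiniteDimensional ℂ (lrfS a j).range := Submodule.finiteDimensional_of_le h1
    exact Submodule.closed_of_finiteDimensional _

end Projections

/-! ### Gaussian elimination of the operator polynomial -/

section Elimination

variable {H : Type*} [NormedAddCommGroup H] [InnerProductSpace ℂ H] [CompleteSpace H]
  (a : ℕ → H →L[ℂ] H) (k : ℕ)

/-- The row multipliers `F_h(w)` of the elimination, with `w = 1 - z`: `F_0 = 1` and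
`F_{h+1}(w) = F_h(w) - A_{h+1,1} ∑_{j ≤ h} w^{h+1-j} S_j⁺ F_j(w)`. -/
noncomputable def lrfF : ℕ → ℂ → (H →L[ℂ] H)
  | 0 => fun _ => 1
  | h + 1 => fun w => lrfF h w - lrfA a (h + 1) 1 *
      ∑ j : Fin (h + 1), w ^ (h + 1 - (j : ℕ)) • (genInverse (lrfS a j) * lrfF j w)
termination_by h => h
decreasing_by all_goals omega

/-- The tail `∑_{n=1}^k w^n A_{h+1,n}` of the operator polynomial obtained in step `h` of the
elimination. -/
noncomputable def lrfTail (h : ℕ) (w : ℂ) : H →L[ℂ] H :=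
  ∑ n ∈ Icc 1 k, w ^ n • lrfA a (h + 1) n

/-- The operator polynomial `∑_{n ≤ k} w^n A_n` in the variable `w = 1 - z`. -/
noncomputable def polyOp (w : ℂ) : H →L[ℂ] H := a 0 + lrfTail a k 0 w

theorem lrfF_zero (w : ℂ) : lrfF a 0 w = 1 := by rw [lrfF]

theorem lrfF_succ (h : ℕ) (w : ℂ) : lrfF a (h + 1) w = lrfF a h w - lrfA a (h + 1) 1 *
    ∑ j ∈ range (h + 1), w ^ (h + 1 - j) • (genInverse (lrfS a j) * lrfF a j w) := by
  rw [lrfF, Finset.sum_range fun j => w ^ (h + 1 - j) • (genInverse (lrfS a j) * lrfF a j w)]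

theorem lrfF_at_zero (h : ℕ) : lrfF a h 0 = 1 := by
  induction h with
  | zero => rw [lrfF_zero]
  | succ h ih =>
    rw [lrfF_succ, ih, Finset.sum_eq_zero, mul_zero, sub_zero]
    intro j hj
    rw [zero_pow (by have := Finset.mem_range.1 hj; omega), zero_smul]

theorem lrfTail_zero (h : ℕ) : lrfTail a k h 0 = 0 := by
  refine Finset.sum_eq_zero fun n hn => ?_
  rw [zero_pow (by have := Finset.mem_Icc.1 hn; omega), zero_smul]

theorem differentiable_lrfTail (h : ℕ) : Differentiable ℂ (lrfTail a k h) := by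
  unfold lrfTail; fun_prop

theorem differentiable_polyOp : Differentiable ℂ (polyOp a k) :=
  (differentiable_lrfTail a k 0).const_add _

theorem differentiable_lrfF (h : ℕ) : Differentiable ℂ (lrfF a h) := by
  induction h using Nat.strong_induction_on with
  | _ h ih =>
    rcases h with _ | h
    · rw [show lrfF a 0 = fun _ => 1 from funext (lrfF_zero a)]
      exact differentiable_const _
    · rw [show lrfF a (h + 1) = _ from funext (lrfF_succ a h)]
      refine (ih h h.lt_succ_self).sub ((differentiable_const _).mul
        (Differentiable.fun_sum fun j hj => ?_))
      have := ih j (Finset.mem_range.1 hj)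
      fun_prop

variable {a k}

theorem lrfA_succ_succ (h n : ℕ) : lrfA a (h + 2) n = lrfA a (h + 1) (n + 1)
    - lrfA a (h + 1) 1 * ∑ j ∈ range (h + 1), genInverse (lrfS a j) * lrfA a (j + 1) n :=
  lrfA_of_two_le a (by omega) n

theorem lrfA_eq_zero (ha : ∀ n, k < n → a n = 0) (h : ℕ) {n : ℕ} (hn : k < n) :
    lrfA a (h + 1) n = 0 := by
  induction h using Nat.strong_induction_on generalizing n with
  | _ h ih =>
    rcases h with _ | h
    · rw [lrfA_one]; exact ha n hn
    · rw [lrfA_succ_succ, ih h h.lt_succ_self (by omega), Finset.sum_eq_zero, mul_zero, sub_zero]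
      intro j hj
      rw [ih j (Finset.mem_range.1 hj) hn, mul_zero]

theorem lrfTail_eq_add (ha : ∀ n, k < n → a n = 0) (h : ℕ) (w : ℂ) :
    lrfTail a k h w = w • (lrfA a (h + 1) 1 + ∑ n ∈ Icc 1 k, w ^ n • lrfA a (h + 1) (n + 1)) := by
  have e1 : ∀ f : ℕ → H →L[ℂ] H, ∑ n ∈ Icc 1 k, f n = ∑ n ∈ range k, f (n + 1) := by
    intro f
    rw [← Finset.Ico_add_one_right_eq_Icc, Finset.sum_Ico_eq_sum_range]
    simp [add_comm]
  have e2 : lrfTail a k h w = ∑ n ∈ range (k + 1), w ^ (n + 1) • lrfA a (h + 1) (n + 1) := by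
    rw [Finset.sum_range_succ, lrfA_eq_zero ha h k.lt_succ_self, smul_zero, add_zero, lrfTail, e1]
  rw [e2, e1, Finset.sum_range_succ', smul_add, Finset.smul_sum, add_comm]
  simp [smul_smul, pow_succ']

namespace HasGenInverses

/-- The elimination identity: the multiplier `F_h` brings the operator polynomial to the form
`w^h (S_h + O(w))` on `(ζ_0 ⊕ ⋯ ⊕ ζ_{h-1})ᗮ`. -/
theorem projPerp_mul_lrfF_mul_polyOp (hG : HasGenInverses a) (ha : ∀ n, k < n → a n = 0) (h : ℕ)
    (w : ℂ) : projPerp (lrfZ a h) * (lrfF a h w * polyOp a k w)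
      = w ^ h • (lrfS a h + projPerp (lrfZ a h) * lrfTail a k h w) := by
  induction h using Nat.strong_induction_on with
  | _ h ih =>
    rcases h with _ | h
    · have : projPerp (lrfZ a 0) = 1 := by rw [hG.projPerp_lrfZ]; simp
      rw [this, lrfF_zero, lrfS_zero, polyOp]; simp
    · have e1 : projPerp (lrfZ a (h + 1)) * (lrfF a h w * polyOp a k w)
          = w ^ h • (projPerp (lrfZ a (h + 1)) * lrfTail a k h w) := by
        rw [← hG.projPerp_succ_mul_projPerp h, mul_assoc, ih h h.lt_succ_self, mul_smul_comm,
          mul_add, hG.projPerp_succ_mul_lrfS, zero_add, mul_assoc]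
      have e2 : ∀ j ∈ range (h + 1), w ^ (h + 1 - j) •
            (genInverse (lrfS a j) * lrfF a j w) * polyOp a k w
          = w ^ (h + 1) • (lrfP a j + ∑ n ∈ Icc 1 k, w ^ n •
              (genInverse (lrfS a j) * lrfA a (j + 1) n)) := by
        intro j hj
        have hj' := Finset.mem_range.1 hj
        have h1 : genInverse (lrfS a j) * lrfF a j w * polyOp a k w
            = w ^ j • (lrfP a j + genInverse (lrfS a j) * lrfTail a k j w) := by
          rw [← hG.genInverse_mul_projPerp, mul_assoc, mul_assoc, ih j hj', mul_smul_comm, mul_add,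
            ← mul_assoc, hG.genInverse_mul_projPerp, lrfP]
        rw [smul_mul_assoc, h1, smul_smul, ← pow_add, Nat.sub_add_cancel hj'.le, lrfTail,
          Finset.mul_sum]
        simp only [mul_smul_comm]
      have e3 : lrfS a (h + 1) = projPerp (lrfZ a (h + 1)) *
          (lrfA a (h + 1) 1 * (1 - ∑ j ∈ range (h + 1), lrfP a j)) := by
        rw [lrfS_of_pos a (by omega), hG.projPerp_lrfT, mul_assoc]
      have e4 : lrfTail a k (h + 1) w = (∑ n ∈ Icc 1 k, w ^ n • lrfA a (h + 1) (n + 1))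
          - lrfA a (h + 1) 1 * ∑ j ∈ range (h + 1), ∑ n ∈ Icc 1 k, w ^ n •
              (genInverse (lrfS a j) * lrfA a (j + 1) n) := by
        rw [lrfTail, Finset.sum_comm, Finset.mul_sum, ← Finset.sum_sub_distrib]
        refine Finset.sum_congr rfl fun n _ => ?_
        rw [lrfA_succ_succ, smul_sub, ← Finset.smul_sum, mul_smul_comm]
      rw [lrfF_succ, sub_mul, mul_sub, e1, lrfTail_eq_add ha, mul_assoc, Finset.sum_mul,
        Finset.sum_congr rfl e2, ← Finset.smul_sum, Finset.sum_add_distrib, e3, e4]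
      simp only [mul_smul_comm, smul_smul, ← pow_succ, ← smul_sub]
      congr 1
      noncomm_ring

theorem genInverse_mul_lrfF_mul_polyOp (hG : HasGenInverses a) (ha : ∀ n, k < n → a n = 0) (h : ℕ)
    (w : ℂ) : genInverse (lrfS a h) * lrfF a h w * polyOp a k w
      = w ^ h • (lrfP a h + genInverse (lrfS a h) * lrfTail a k h w) := by
  rw [← hG.genInverse_mul_projPerp, mul_assoc, mul_assoc, hG.projPerp_mul_lrfF_mul_polyOp ha,
    mul_smul_comm, mul_add, ← mul_assoc, hG.genInverse_mul_projPerp, lrfP]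

/-- If `τ_0 ⊕ ⋯ ⊕ τ_d` is the whole space, then `w^d A⁻¹` extends holomorphically to `w = 0` with
the value `S_d⁺`. -/
theorem exists_analytic_inverse (hG : HasGenInverses a) (ha : ∀ n, k < n → a n = 0) {d : ℕ}
    (hd : lrfT a (d + 1) = ⊤) :
    ∃ f : ℂ → H →L[ℂ] H, AnalyticAt ℂ f 0 ∧ f 0 = genInverse (lrfS a d) ∧
      ∀ᶠ w in 𝓝 0, f w * polyOp a k w = w ^ d • 1 := by
  rw [hG.lrfT_eq_top_iff] at hd
  -- the elimination identities of all steps, weighted by `w^(d-h)`, sum to `M A = w^d N`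
  let N : ℂ → H →L[ℂ] H := fun w =>
    1 + ∑ h ∈ range (d + 1), genInverse (lrfS a h) * lrfTail a k h w
  let M : ℂ → H →L[ℂ] H := fun w =>
    ∑ h ∈ range (d + 1), w ^ (d - h) • (genInverse (lrfS a h) * lrfF a h w)
  have hNd : Differentiable ℂ N := by
    refine Differentiable.const_add _ (Differentiable.fun_sum fun h _ => ?_)
    exact (differentiable_const _).mul (differentiable_lrfTail a k h)
  have hMd : Differentiable ℂ M := by
    refine Differentiable.fun_sum fun h _ => ?_
    have := differentiable_lrfF a h
    fun_prop
  have hN0 : N 0 = 1 := by simp [N, lrfTail_zero]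
  have hM0 : M 0 = genInverse (lrfS a d) := by
    simp only [M]
    rw [Finset.sum_range_succ, Finset.sum_eq_zero, zero_add, Nat.sub_self, pow_zero, one_smul,
      lrfF_at_zero, mul_one]
    intro h hh
    rw [zero_pow (by have := Finset.mem_range.1 hh; omega), zero_smul]
  have hMA : ∀ w, M w * polyOp a k w = w ^ d • N w := by
    intro w
    simp only [M, N]
    rw [← hd, ← Finset.sum_add_distrib, Finset.sum_mul, Finset.smul_sum]
    refine Finset.sum_congr rfl fun h hh => ?_
    rw [smul_mul_assoc, hG.genInverse_mul_lrfF_mul_polyOp ha, smul_smul, ← pow_add,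
      Nat.sub_add_cancel (by have := Finset.mem_range.1 hh; omega)]
  have hinv : AnalyticAt ℂ (fun w => Ring.inverse (N w)) 0 := by
    refine AnalyticAt.comp (g := Ring.inverse) ?_ (hNd.analyticAt 0)
    rw [hN0]
    exact analyticAt_inverse (𝕜 := ℂ) (1 : (H →L[ℂ] H)ˣ)
  refine ⟨fun w => Ring.inverse (N w) * M w, hinv.mul (hMd.analyticAt 0), ?_, ?_⟩
  · simp [hN0, hM0]
  · have hu : ∀ᶠ w in 𝓝 0, IsUnit (N w) :=
      hNd.continuous.continuousAt.eventually (by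
        rw [hN0]; exact Units.isOpen.mem_nhds isUnit_one)
    filter_upwards [hu] with w hw
    rw [mul_assoc, hMA, mul_smul_comm, Ring.inverse_mul_cancel _ hw]

end HasGenInverses

/-- The elimination terminates. Otherwise the complements of `τ_0 ⊕ ⋯ ⊕ τ_{h-1}` are eventually a
constant space `K ≠ 0`, and each `v ∈ K` is the value at `w = 0` of a holomorphic `y` for which
`A(w) y(w)` vanishes to infinite order at `w = 0`, hence identically. -/
theorem exists_lrfT_eq_top (h0 : (a 0).IsFredholm) (ha : ∀ n, k < n → a n = 0)
    (hinv : ∀ᶠ w in 𝓝[≠] 0, IsUnit (polyOp a k w)) : ∃ h, lrfT a h = ⊤ := by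
  have hG := hasGenInverses_of_isFredholm h0
  by_contra! hne
  have hker : FiniteDimensional ℂ (a 0).ker := h0.finite_ker
  have hfin : ∀ h, FiniteDimensional ℂ (lrfT a (h + 1))ᗮ := by
    intro h
    refine Submodule.finiteDimensional_of_le (S₂ := (a 0).ker) fun x hx => ?_
    have := mem_orthogonal_lrfT.1 hx 0 (by omega)
    rwa [lrfS_zero] at this
  -- the step from which the complements are constant
  let m : ℕ := Function.argmin fun h => Module.finrank ℂ (lrfT a (h + 1))ᗮ
  have hm : ∀ h, Module.finrank ℂ (lrfT a (m + 1))ᗮ ≤ Module.finrank ℂ (lrfT a (h + 1))ᗮ :=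
    fun h => Function.argmin_le (fun h => Module.finrank ℂ (lrfT a (h + 1))ᗮ) h
  have hconst : ∀ h, m ≤ h → (lrfT a (h + 1))ᗮ = (lrfT a (m + 1))ᗮ := fun h hh =>
    Submodule.eq_of_le_of_finrank_le (Submodule.orthogonal_le (lrfT_mono (by omega))) (hm h)
  have htau : ∀ h, m < h → lrfTau a h = ⊥ := by
    intro h hh
    have h1 : lrfTau a h ≤ (lrfT a (h + 1))ᗮ := by
      obtain ⟨i, rfl⟩ : ∃ i, h = i + 1 := ⟨h - 1, by omega⟩
      rw [hconst (i + 1) hh.le, ← hconst i (by omega)]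
      exact lrfTau_le_orthogonal_lrfT (i + 1)
    have h2 : lrfTau a h ≤ lrfT a (h + 1) := lrfTau_le_lrfT h.lt_succ_self
    exact le_bot_iff.1 ((le_inf h2 h1).trans_eq (Submodule.inf_orthogonal_eq_bot _))
  have hS : ∀ h, m < h → lrfS a h = 0 := by
    intro h hh
    ext x
    have h1 : lrfP a h x = 0 := by
      have := hG.lrfP_apply_mem h x
      rwa [htau h hh, Submodule.mem_bot] at this
    exact ((hG h).right_mul_eq_zero_iff x).1 h1
  have hQ : ∀ h, m < h → lrfQ a h = 0 := fun h hh => by rw [lrfQ, hS h hh, zero_mul]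
  have hZ : ∀ h, m < h → projPerp (lrfZ a h) = 1 - ∑ j ∈ range (m + 1), lrfQ a j := by
    intro h hh
    rw [hG.projPerp_lrfZ, ← Finset.sum_subset (s₁ := range (m + 1))]
    · intro x; simp only [Finset.mem_range]; omega
    · intro x _ hx; exact hQ x (by simpa using hx)
  obtain ⟨v, hvK, hv0⟩ : ∃ v, v ∈ (lrfT a (m + 1))ᗮ ∧ v ≠ 0 := by
    refine Submodule.exists_mem_ne_zero_of_ne_bot fun hbot => hne (m + 1) ?_
    rw [hG.lrfT_eq_top_iff]
    have h1 := hG.projPerp_lrfT (m + 1)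
    have h2 : projPerp (lrfT a (m + 1)) = 0 := by
      ext x
      have : projPerp (lrfT a (m + 1)) x ∈ (lrfT a (m + 1))ᗮ :=
        Submodule.starProjection_apply_mem _ _
      rwa [hbot, Submodule.mem_bot] at this
    rw [h2] at h1
    exact (sub_eq_zero.1 h1.symm).symm
  have hPv : ∀ j ∈ range (m + 1), lrfP a j v = 0 := fun j hj =>
    ((hG j).right_mul_eq_zero_iff v).2 (mem_orthogonal_lrfT.1 hvK j (Finset.mem_range.1 hj))
  -- `y` solves `N y = v`, where `P_i N = P_i + S_i⁺ (tail of step i)` for `i ≤ m`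
  let N : ℂ → H →L[ℂ] H := fun w =>
    1 + ∑ h ∈ range (m + 1), genInverse (lrfS a h) * lrfTail a k h w
  have hNd : Differentiable ℂ N := by
    refine Differentiable.const_add _ (Differentiable.fun_sum fun h _ => ?_)
    exact (differentiable_const _).mul (differentiable_lrfTail a k h)
  have hN0 : N 0 = 1 := by simp [N, lrfTail_zero]
  let y : ℂ → H := fun w => Ring.inverse (N w) v
  have hy : AnalyticAt ℂ y 0 := by
    have : AnalyticAt ℂ (fun w => Ring.inverse (N w)) 0 := by
      refine AnalyticAt.comp (g := Ring.inverse) ?_ (hNd.analyticAt 0)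
      rw [hN0]
      exact analyticAt_inverse (𝕜 := ℂ) (1 : (H →L[ℂ] H)ˣ)
    exact ((ContinuousLinearMap.apply ℂ H v).analyticAt _).comp this
  have hy0 : y 0 = v := by simp [y, hN0]
  have hNy : ∀ᶠ w in 𝓝 0, N w (y w) = v := by
    have hu : ∀ᶠ w in 𝓝 0, IsUnit (N w) :=
      hNd.continuous.continuousAt.eventually (by
        rw [hN0]; exact Units.isOpen.mem_nhds isUnit_one)
    filter_upwards [hu] with w hw
    exact congrArg (fun T : H →L[ℂ] H => T v) (Ring.mul_inverse_cancel _ hw)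
  -- the components of `A y` along `ζ_0, …, ζ_m` are eliminated exactly
  have hQg : ∀ᶠ w in 𝓝 0, ∀ i ∈ range (m + 1), lrfQ a i (lrfF a i w (polyOp a k w (y w))) = 0 := by
    filter_upwards [hNy] with w hw i hi
    have h1 : lrfP a i * N w = lrfP a i + genInverse (lrfS a i) * lrfTail a k i w := by
      simp only [N]
      rw [mul_add, mul_one, Finset.mul_sum, Finset.sum_eq_single i]
      · rw [← mul_assoc, hG.lrfP_mul_genInverse]
      · intro j _ hj; rw [← mul_assoc, hG.lrfP_mul_genInverse_of_ne hj.symm, zero_mul]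
      · intro hn; exact absurd hi hn
    have h2 : (genInverse (lrfS a i) * lrfF a i w * polyOp a k w) (y w) = 0 := by
      rw [hG.genInverse_mul_lrfF_mul_polyOp ha, ← h1]
      change w ^ i • lrfP a i (N w (y w)) = 0
      rw [hw, hPv i hi, smul_zero]
    change lrfS a i ((genInverse (lrfS a i) * lrfF a i w * polyOp a k w) (y w)) = 0
    rw [h2, map_zero]
  let g : ℂ → H := fun w => polyOp a k w (y w)
  have hg : AnalyticAt ℂ g 0 :=
    ((ContinuousLinearMap.id ℂ (H →L[ℂ] H)).analyticAt_bilinear (polyOp a k 0, y 0)).comp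
      (f := fun w => (polyOp a k w, y w)) (((differentiable_polyOp a k).analyticAt 0).prod hy)
  have hgzero : ∀ᶠ w in 𝓝 0, g w = 0 := by
    -- otherwise `A y = w^n f` with `f 0 ≠ 0`, but step `h ≥ n` shows `U f = O(w)` with `U 0 = 1`
    by_contra hcon
    obtain ⟨n, f, hf, hf0, hgf⟩ := hg.exists_eventuallyEq_pow_smul_nonzero_iff.2 hcon
    let h := max n (m + 1)
    let U : ℂ → H →L[ℂ] H := fun w => ∑ i ∈ range (m + 1), lrfQ a i * lrfF a i w
      + (1 - ∑ i ∈ range (m + 1), lrfQ a i) * lrfF a h w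
    have hUd : Differentiable ℂ U := by
      refine Differentiable.add (Differentiable.fun_sum fun i _ => ?_) ?_
      · exact (differentiable_const _).mul (differentiable_lrfF a i)
      · exact (differentiable_const _).mul (differentiable_lrfF a h)
    have hU0 : U 0 = 1 := by simp [U, lrfF_at_zero]
    let r : ℂ → H := fun w => w ^ (h - n) •
      ((1 - ∑ i ∈ range (m + 1), lrfQ a i) * lrfTail a k h w) (y w)
    have hUf : ∀ᶠ w in 𝓝[≠] 0, U w (f w) = r w := by
      filter_upwards [hgf.filter_mono nhdsWithin_le_nhds, hQg.filter_mono nhdsWithin_le_nhds,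
        self_mem_nhdsWithin] with w h1 h2 h3
      have h4 := congrArg (fun T : H →L[ℂ] H => T (y w))
        (hG.projPerp_mul_lrfF_mul_polyOp (k := k) ha h w)
      rw [hS h (by omega), hZ h (by omega), zero_add] at h4
      have h5 : U w (g w) = w ^ n • r w := by
        have : U w (g w) = ∑ i ∈ range (m + 1), lrfQ a i (lrfF a i w (polyOp a k w (y w)))
          + (1 - ∑ i ∈ range (m + 1), lrfQ a i) (lrfF a h w (polyOp a k w (y w))) := by
          simp [U, g]
        rw [this, Finset.sum_eq_zero h2, zero_add]
        refine h4.trans ?_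
        simp only [r]
        rw [smul_smul, ← pow_add, Nat.add_sub_cancel' (le_max_left _ _)]
        rfl
      rw [h1, sub_zero, map_smul] at h5
      exact smul_right_injective _ (pow_ne_zero n h3) h5
    have hlim1 : Tendsto (fun w => U w (f w)) (𝓝[≠] 0) (𝓝 (f 0)) := by
      have : ContinuousAt (fun w => U w (f w)) 0 :=
        (hUd.continuous.continuousAt).clm_apply hf.continuousAt
      have h1 := this.tendsto
      simp only [hU0] at h1
      exact h1.mono_left nhdsWithin_le_nhds
    have hlim2 : Tendsto r (𝓝[≠] 0) (𝓝 0) := by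
      have : ContinuousAt r 0 := by
        refine ContinuousAt.smul (continuousAt_id.pow _) (ContinuousAt.clm_apply ?_ hy.continuousAt)
        exact continuousAt_const.mul (differentiable_lrfTail a k h).continuous.continuousAt
      have h1 : r 0 = 0 := by simp [r, lrfTail_zero]
      have h2 := this.tendsto
      rw [h1] at h2
      exact h2.mono_left nhdsWithin_le_nhds
    exact hf0 (tendsto_nhds_unique (hlim1.congr' hUf) hlim2)
  have hyzero : ∀ᶠ w in 𝓝[≠] 0, y w = 0 := by
    filter_upwards [hinv, hgzero.filter_mono nhdsWithin_le_nhds] with w hw hgw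
    have h1 := congrArg (fun T : H →L[ℂ] H => T (y w)) (Ring.inverse_mul_cancel _ hw)
    change Ring.inverse (polyOp a k w) (g w) = y w at h1
    rw [← h1, hgw, map_zero]
  refine hv0 ?_
  rw [← hy0]
  exact tendsto_nhds_unique (hy.continuousAt.tendsto.mono_left nhdsWithin_le_nhds)
    (tendsto_const_nhds.congr' (hyzero.mono fun _ h => h.symm))

end Elimination

/-! ### Taylor coefficients at the origin -/

section Taylor

variable {E : Type*} [NormedAddCommGroup E] [NormedSpace ℂ E]
variable {F : Type*} [NormedAddCommGroup F] [NormedSpace ℂ F]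
variable {G : Type*} [NormedAddCommGroup G] [NormedSpace ℂ G]

theorem differentiableOn_one_sub_pow_smul {f : ℂ → E} {s : Set ℂ} (hf : DifferentiableOn ℂ f s)
    (n : ℕ) : DifferentiableOn ℂ (fun z => (1 - z) ^ n • f z) s := by
  have h : DifferentiableOn ℂ (fun z : ℂ => (1 - z) ^ n) s :=
    Differentiable.differentiableOn (by fun_prop)
  exact h.smul hf

theorem differentiableOn_one_sub_smul {f : ℂ → E} {s : Set ℂ} (hf : DifferentiableOn ℂ f s) :
    DifferentiableOn ℂ (fun z => (1 - z) • f z) s := by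
  simpa using differentiableOn_one_sub_pow_smul hf 1

/-- The Taylor coefficients at `0` of a holomorphic function. -/
noncomputable def tCoeff (f : ℂ → E) (n : ℕ) : E := ((n.factorial : ℂ)⁻¹) • iteratedDeriv n f 0

theorem tCoeff_zero (f : ℂ → E) : tCoeff f 0 = f 0 := by
  simp [tCoeff]

theorem hasSum_tCoeff [CompleteSpace E] {f : ℂ → E} {ρ : ℝ}
    (hf : DifferentiableOn ℂ f (Metric.ball 0 ρ)) {z : ℂ} (hz : ‖z‖ < ρ) :
    HasSum (fun n => z ^ n • tCoeff f n) (f z) := by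
  have hρ : 0 ≤ ρ := (norm_nonneg z).trans hz.le
  have h := Complex.hasSum_taylorSeries_on_ball hf (z := z) (by simpa using hz)
  have e : (fun n => z ^ n • tCoeff f n)
      = fun n : ℕ => ((n.factorial : ℂ)⁻¹) • (z - 0) ^ n • iteratedDeriv n f 0 := by
    funext n
    rw [tCoeff, sub_zero, smul_comm]
  rwa [e]

theorem summable_norm_tCoeff [CompleteSpace E] {f : ℂ → E} {ρ : ℝ}
    (hf : DifferentiableOn ℂ f (Metric.ball 0 ρ)) {r : ℝ} (hr : 0 ≤ r) (hrρ : r < ρ) :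
    Summable fun n => ‖tCoeff f n‖ * r ^ n := by
  obtain ⟨s, hrs, hsρ⟩ := exists_between hrρ
  have hs : 0 < s := hr.trans_lt hrs
  have h1 : Summable fun n => (s : ℂ) ^ n • tCoeff f n :=
    (hasSum_tCoeff hf (z := (s : ℂ)) (by simpa [abs_of_pos hs] using hsρ)).summable
  obtain ⟨K, hK⟩ := h1.tendsto_atTop_zero.norm.bddAbove_range
  have hK' : ∀ n, s ^ n * ‖tCoeff f n‖ ≤ K := by
    intro n
    have := hK ⟨n, rfl⟩
    simpa [norm_smul, abs_of_pos hs] using this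
  refine Summable.of_nonneg_of_le (fun n => by positivity) (fun n => ?_)
    ((summable_geometric_of_lt_one (r := r / s) (by positivity) ((div_lt_one hs).2 hrs)).mul_left K)
  calc ‖tCoeff f n‖ * r ^ n = (s ^ n * ‖tCoeff f n‖) * (r / s) ^ n := by
        rw [div_pow]; field_simp
    _ ≤ K * (r / s) ^ n := mul_le_mul_of_nonneg_right (hK' n) (by positivity)

/-- The coefficients of a convergent power series are the Taylor coefficients of its sum. -/
theorem tCoeff_eq_of_hasSum [CompleteSpace E] {f : ℂ → E} {c : ℕ → E} {ρ : ℝ} (hρ : 0 < ρ)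
    (hc : ∀ z : ℂ, ‖z‖ < ρ → HasSum (fun n => z ^ n • c n) (f z))
    (hf : DifferentiableOn ℂ f (Metric.ball 0 ρ)) : tCoeff f = c := by
  let p : (ℕ → E) → FormalMultilinearSeries ℂ ℂ E := fun b n =>
    ContinuousMultilinearMap.mkPiRing ℂ (Fin n) (b n)
  have key : ∀ b : ℕ → E, (∀ z : ℂ, ‖z‖ < ρ → HasSum (fun n => z ^ n • b n) (f z)) →
      HasFPowerSeriesAt f (p b) 0 := by
    intro b hb
    refine hasFPowerSeriesAt_iff.2 ?_
    filter_upwards [Metric.ball_mem_nhds (0 : ℂ) hρ] with z hz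
    simpa [FormalMultilinearSeries.coeff, p] using hb z (by simpa using hz)
  have h1 := (key c hc).eq_formalMultilinearSeries
    (key (tCoeff f) fun z hz => hasSum_tCoeff hf hz)
  funext n
  have h2 := congrArg (fun p : FormalMultilinearSeries ℂ ℂ E => p.coeff n) h1
  simpa [FormalMultilinearSeries.coeff, p] using h2.symm

theorem tCoeff_polynomial [CompleteSpace E] (c : ℕ → E) (N n : ℕ) :
    tCoeff (fun z => ∑ m ∈ range N, z ^ m • c m) n = if n < N then c n else 0 := by
  have h := tCoeff_eq_of_hasSum (f := fun z : ℂ => ∑ m ∈ range N, z ^ m • c m)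
    (c := fun n => if n < N then c n else 0) one_pos (fun z _ => ?_) ?_
  · rw [h]
  · have h1 : ∑ m ∈ range N, z ^ m • c m
        = ∑ m ∈ range N, z ^ m • (if m < N then c m else 0) :=
      Finset.sum_congr rfl fun m hm => by rw [if_pos (Finset.mem_range.1 hm)]
    rw [h1]
    refine hasSum_sum_of_ne_finset_zero fun m hm => ?_
    rw [if_neg (by simpa using hm), smul_zero]
  · refine Differentiable.differentiableOn (Differentiable.fun_sum fun m _ => ?_)
    fun_prop

theorem tCoeff_add [CompleteSpace E] {f g : ℂ → E} {ρ : ℝ} (hρ : 0 < ρ)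
    (hf : DifferentiableOn ℂ f (Metric.ball 0 ρ)) (hg : DifferentiableOn ℂ g (Metric.ball 0 ρ)) :
    tCoeff (fun z => f z + g z) = fun n => tCoeff f n + tCoeff g n := by
  refine tCoeff_eq_of_hasSum hρ (fun z hz => ?_) (hf.add hg)
  simpa only [smul_add] using (hasSum_tCoeff hf hz).add (hasSum_tCoeff hg hz)

theorem tCoeff_congr {f g : ℂ → E} {ρ : ℝ} (hρ : 0 < ρ)
    (h : ∀ z : ℂ, ‖z‖ < ρ → f z = g z) : tCoeff f = tCoeff g := by
  funext n
  have : f =ᶠ[𝓝 0] g := by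
    filter_upwards [Metric.ball_mem_nhds (0 : ℂ) hρ] with z hz using h z (by simpa using hz)
  rw [tCoeff, tCoeff, this.iteratedDeriv_eq n]

theorem hasSum_sum_antidiagonal {M : Type*} [AddCommGroup M] [TopologicalSpace M]
    [IsTopologicalAddGroup M] [RegularSpace M] {f : ℕ × ℕ → M} {s : M} (h : HasSum f s) :
    HasSum (fun n => ∑ p ∈ antidiagonal n, f p) s :=
  ((Finset.HasAntidiagonal.sigmaAntidiagonalEquivProd (A := ℕ)).hasSum_iff.2 h).sigma
    fun n => by
      exact (antidiagonal n).hasSum f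

/-- The coefficients of a pointwise composition are given by the Cauchy product. -/
theorem tCoeff_comp [CompleteSpace E] [CompleteSpace F] {f : ℂ → F →L[ℂ] E} {g : ℂ → G →L[ℂ] F}
    {ρ : ℝ} (hρ : 0 < ρ) (hf : DifferentiableOn ℂ f (Metric.ball 0 ρ))
    (hg : DifferentiableOn ℂ g (Metric.ball 0 ρ)) :
    tCoeff (fun z => f z ∘L g z)
      = fun n => ∑ p ∈ antidiagonal n, tCoeff f p.1 ∘L tCoeff g p.2 := by
  refine tCoeff_eq_of_hasSum hρ (fun z hz => ?_) (hf.clm_comp hg)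
  let T : ℕ × ℕ → G →L[ℂ] E := fun p => (z ^ p.1 • tCoeff f p.1) ∘L (z ^ p.2 • tCoeff g p.2)
  have hsum : Summable T := by
    refine Summable.of_norm_bounded (Summable.mul_of_nonneg
      (summable_norm_tCoeff hf (norm_nonneg z) hz) (summable_norm_tCoeff hg (norm_nonneg z) hz)
      (fun n => by positivity) (fun n => by positivity)) fun p => ?_
    refine (ContinuousLinearMap.opNorm_comp_le _ _).trans_eq ?_
    rw [norm_smul, norm_smul, norm_pow, norm_pow, mul_comm ‖tCoeff f p.1‖, mul_comm ‖tCoeff g p.2‖]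
  have h1 : HasSum T (f z ∘L g z) := by
    have h2 := hsum.hasSum.prod_fiberwise
      (g := fun i => (z ^ i • tCoeff f i) ∘L g z) (fun i =>
        (hasSum_tCoeff hg hz).mapL (ContinuousLinearMap.compL ℂ G F E (z ^ i • tCoeff f i)))
    have h3 := (hasSum_tCoeff hf hz).mapL ((ContinuousLinearMap.compL ℂ G F E).flip (g z))
    have h4 : ∑' p, T p = f z ∘L g z := h2.unique h3
    rw [← h4]
    exact hsum.hasSum
  have e : (fun n => z ^ n • ∑ p ∈ antidiagonal n, tCoeff f p.1 ∘L tCoeff g p.2)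
      = fun n => ∑ p ∈ antidiagonal n, T p := ?_
  · rw [e]; exact hasSum_sum_antidiagonal h1
  funext n
  rw [Finset.smul_sum]
  refine Finset.sum_congr rfl fun p hp => ?_
  rw [← Finset.HasAntidiagonal.mem_antidiagonal.1 hp, pow_add]
  ext x
  simp [T, smul_smul, mul_comm]

end Taylor

/-! ### Holomorphic functions of the lag operator -/

section LagCalculus

/-- A path grows at `-∞` at most like `r^{-t}`. Power series in the lag operator with radius of
convergence larger than `r` can be applied to such a path. -/
def IsTame {E : Type*} [NormedAddCommGroup E] (r : ℝ) (u : ℤ → E) : Prop :=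
  ∃ K, ∀ n : ℕ, ‖u (-n)‖ ≤ K * r ^ n

theorem IsTame.shift {E : Type*} [NormedAddCommGroup E] {r : ℝ} (hr : 1 ≤ r) {u : ℤ → E}
    (hu : IsTame r u) (t : ℤ) : ∃ K, 0 ≤ K ∧ ∀ n : ℕ, ‖u (t - n)‖ ≤ K * r ^ n := by
  obtain ⟨K, hK⟩ := hu
  have hr0 : 0 < r := one_pos.trans_le hr
  have hK0 : 0 ≤ K := by simpa using (norm_nonneg _).trans (hK 0)
  refine ⟨K * r ^ t.natAbs + ∑ m ∈ range t.natAbs, ‖u (t - m)‖, by positivity, fun n => ?_⟩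
  have hS : 0 ≤ ∑ m ∈ range t.natAbs, ‖u (t - m)‖ := by positivity
  rw [add_mul]
  by_cases hn : n < t.natAbs
  · have h1 : ‖u (t - n)‖ ≤ ∑ m ∈ range t.natAbs, ‖u (t - m)‖ :=
      Finset.single_le_sum (f := fun m : ℕ => ‖u (t - m)‖) (fun m _ => norm_nonneg _)
        (Finset.mem_range.2 hn)
    have h2 : (∑ m ∈ range t.natAbs, ‖u (t - m)‖) * 1
        ≤ (∑ m ∈ range t.natAbs, ‖u (t - m)‖) * r ^ n :=
      mul_le_mul_of_nonneg_left (one_le_pow₀ hr) hS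
    have h3 : 0 ≤ K * r ^ t.natAbs * r ^ n := by positivity
    linarith
  · have e : t - n = -((n - t).toNat : ℤ) := by omega
    have h1 := hK (n - t).toNat
    rw [← e] at h1
    have h2 : r ^ (n - t).toNat ≤ r ^ t.natAbs * r ^ n := by
      rw [← pow_add]
      exact pow_le_pow_right₀ hr (by omega)
    have h3 := mul_le_mul_of_nonneg_left h2 hK0
    have h4 : 0 ≤ (∑ m ∈ range t.natAbs, ‖u (t - m)‖) * r ^ n := by positivity
    linarith

/-- The difference of a path. -/
def pathDiff {E : Type*} [AddCommGroup E] (u : ℤ → E) : ℤ → E := fun t => u t - u (t - 1)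

theorem diffOp_iterate_apply {Ω E : Type*} [AddCommGroup E] (n : ℕ) (x : ℤ → Ω → E) (t : ℤ)
    (ω : Ω) : diffOp^[n] x t ω = pathDiff^[n] (fun s => x s ω) t := by
  induction n generalizing x with
  | zero => rfl
  | succ n ih => rw [Function.iterate_succ_apply, Function.iterate_succ_apply, ih]; rfl

theorem pathDiff_iterate_add {E : Type*} [AddCommGroup E] (n : ℕ) (u v : ℤ → E) :
    pathDiff^[n] (u + v) = pathDiff^[n] u + pathDiff^[n] v := by
  induction n generalizing u v with
  | zero => rfl
  | succ n ih =>
    simp only [Function.iterate_succ_apply]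
    rw [← ih]
    congr 1
    funext t
    simp only [pathDiff, Pi.add_apply]
    abel

variable {E : Type*} [NormedAddCommGroup E] [NormedSpace ℂ E]
variable {F : Type*} [NormedAddCommGroup F] [NormedSpace ℂ F]
variable {G : Type*} [NormedAddCommGroup G] [NormedSpace ℂ G]

/-- The operator `f(L)` applied to a path `u`, for `f` holomorphic on a disc of radius larger than
`1`, with operator values: `∑ f_n u_{t-n}` with the Taylor coefficients `f_n` of `f`. The series
converges for tame paths (`summable_lagOp`). -/
noncomputable def lagOp (f : ℂ → F →L[ℂ] E) (u : ℤ → F) (t : ℤ) : E :=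
  ∑' n : ℕ, tCoeff f n (u (t - n))

theorem lagOp_congr {f g : ℂ → F →L[ℂ] E} {ρ : ℝ} (hρ : 0 < ρ)
    (h : ∀ z : ℂ, ‖z‖ < ρ → f z = g z) (u : ℤ → F) (t : ℤ) : lagOp f u t = lagOp g u t := by
  rw [lagOp, lagOp, tCoeff_congr hρ h]

variable [CompleteSpace E]

theorem summable_lagOp {f : ℂ → F →L[ℂ] E} {r ρ : ℝ} (hr : 1 ≤ r) (hrρ : r < ρ)
    (hf : DifferentiableOn ℂ f (Metric.ball 0 ρ)) {u : ℤ → F} (hu : IsTame r u) (t : ℤ) :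
    Summable fun n : ℕ => tCoeff f n (u (t - n)) := by
  obtain ⟨K, hK0, hK⟩ := hu.shift hr t
  have hr0 : 0 ≤ r := zero_le_one.trans hr
  refine Summable.of_norm_bounded ((summable_norm_tCoeff hf hr0 hrρ).mul_right K) fun n => ?_
  calc ‖tCoeff f n (u (t - n))‖ ≤ ‖tCoeff f n‖ * ‖u (t - n)‖ := ContinuousLinearMap.le_opNorm _ _
    _ ≤ ‖tCoeff f n‖ * (K * r ^ n) := mul_le_mul_of_nonneg_left (hK n) (norm_nonneg _)
    _ = ‖tCoeff f n‖ * r ^ n * K := by ring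

theorem IsTame.lagOp {f : ℂ → F →L[ℂ] E} {r ρ : ℝ} (hr : 1 ≤ r) (hrρ : r < ρ)
    (hf : DifferentiableOn ℂ f (Metric.ball 0 ρ)) {u : ℤ → F} (hu : IsTame r u) :
    IsTame r (lagOp f u) := by
  obtain ⟨K, hK⟩ := hu
  have hr0 : 0 ≤ r := zero_le_one.trans hr
  have hs := (summable_norm_tCoeff hf hr0 hrρ).mul_right K
  refine ⟨∑' m, ‖tCoeff f m‖ * r ^ m * K, fun n => ?_⟩
  rw [← tsum_mul_right]
  refine tsum_of_norm_bounded (hs.mul_right (r ^ n)).hasSum fun m => ?_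
  have h1 := hK (n + m)
  have e : (-(n : ℤ) - m) = -((n + m : ℕ) : ℤ) := by push_cast; ring
  rw [e]
  calc ‖tCoeff f m (u (-((n + m : ℕ) : ℤ)))‖ ≤ ‖tCoeff f m‖ * ‖u (-((n + m : ℕ) : ℤ))‖ :=
        ContinuousLinearMap.le_opNorm _ _
    _ ≤ ‖tCoeff f m‖ * (K * r ^ (n + m)) := mul_le_mul_of_nonneg_left h1 (norm_nonneg _)
    _ = ‖tCoeff f m‖ * r ^ m * K * r ^ n := by rw [pow_add]; ring

theorem lagOp_add {f g : ℂ → F →L[ℂ] E} {r ρ : ℝ} (hr : 1 ≤ r) (hrρ : r < ρ)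
    (hf : DifferentiableOn ℂ f (Metric.ball 0 ρ)) (hg : DifferentiableOn ℂ g (Metric.ball 0 ρ))
    {u : ℤ → F} (hu : IsTame r u) (t : ℤ) :
    lagOp (fun z => f z + g z) u t = lagOp f u t + lagOp g u t := by
  rw [lagOp, tCoeff_add (by linarith) hf hg, lagOp, lagOp,
    ← (summable_lagOp hr hrρ hf hu t).tsum_add (summable_lagOp hr hrρ hg hu t)]
  rfl

theorem lagOp_polynomial (c : ℕ → F →L[ℂ] E) (N : ℕ) (u : ℤ → F) (t : ℤ) :
    lagOp (fun z => ∑ m ∈ range N, z ^ m • c m) u t = ∑ m ∈ range N, c m (u (t - m)) := by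
  rw [lagOp, tsum_eq_sum (s := range N)]
  · refine Finset.sum_congr rfl fun n hn => ?_
    rw [tCoeff_polynomial, if_pos (Finset.mem_range.1 hn)]
  · intro n hn
    rw [tCoeff_polynomial, if_neg (by simpa using hn), zero_apply]

theorem lagOp_const (B : F →L[ℂ] E) (u : ℤ → F) (t : ℤ) : lagOp (fun _ => B) u t = B (u t) := by
  have := lagOp_polynomial (fun _ => B) 1 u t
  simpa using this

variable [CompleteSpace F]

/-- The functional calculus is multiplicative. -/
theorem lagOp_comp {f : ℂ → F →L[ℂ] E} {g : ℂ → G →L[ℂ] F} {r ρ : ℝ} (hr : 1 ≤ r) (hrρ : r < ρ)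
    (hf : DifferentiableOn ℂ f (Metric.ball 0 ρ)) (hg : DifferentiableOn ℂ g (Metric.ball 0 ρ))
    {u : ℤ → G} (hu : IsTame r u) (t : ℤ) :
    lagOp (fun z => f z ∘L g z) u t = lagOp f (lagOp g u) t := by
  obtain ⟨K, hK0, hK⟩ := hu.shift hr t
  have hr0 : 0 ≤ r := zero_le_one.trans hr
  let T : ℕ × ℕ → E := fun p => tCoeff f p.1 (tCoeff g p.2 (u (t - p.1 - p.2)))
  have hsum : Summable T := by
    refine Summable.of_norm_bounded ((Summable.mul_of_nonneg
      (summable_norm_tCoeff hf hr0 hrρ) (summable_norm_tCoeff hg hr0 hrρ)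
      (fun n => by positivity) (fun n => by positivity)).mul_right K) fun p => ?_
    have e : t - p.1 - p.2 = t - ((p.1 + p.2 : ℕ) : ℤ) := by push_cast; ring
    have h1 := hK (p.1 + p.2)
    rw [← e] at h1
    calc ‖T p‖ ≤ ‖tCoeff f p.1‖ * ‖tCoeff g p.2 (u (t - p.1 - p.2))‖ :=
          ContinuousLinearMap.le_opNorm _ _
      _ ≤ ‖tCoeff f p.1‖ * (‖tCoeff g p.2‖ * (K * r ^ (p.1 + p.2))) := by
          refine mul_le_mul_of_nonneg_left ?_ (norm_nonneg _)
          exact (ContinuousLinearMap.le_opNorm _ _).trans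
            (mul_le_mul_of_nonneg_left h1 (norm_nonneg _))
      _ = _ := by rw [pow_add]; ring
  have h1 : HasSum (fun i : ℕ => tCoeff f i (lagOp g u (t - i))) (∑' p, T p) :=
    hsum.hasSum.prod_fiberwise fun i =>
      (summable_lagOp hr hrρ hg hu (t - i)).hasSum.mapL (tCoeff f i)
  have h2 := hasSum_sum_antidiagonal hsum.hasSum
  rw [lagOp, tCoeff_comp (by linarith) hf hg, lagOp, h1.tsum_eq, ← h2.tsum_eq]
  refine tsum_congr fun n => ?_
  rw [_root_.sum_apply]
  refine Finset.sum_congr rfl fun p hp => ?_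
  have e : t - p.1 - p.2 = t - n := by
    rw [← Finset.HasAntidiagonal.mem_antidiagonal.1 hp]; push_cast; ring
  simp only [T, e]
  rfl

theorem lagOp_one_sub (u : ℤ → F) (t : ℤ) :
    lagOp (fun z => (1 - z) • (1 : F →L[ℂ] F)) u t = pathDiff u t := by
  have h := lagOp_polynomial (fun m => if m = 0 then (1 : F →L[ℂ] F) else -1) 2 u t
  have e : (fun z : ℂ => (1 - z) • (1 : F →L[ℂ] F))
      = fun z => ∑ m ∈ range 2, z ^ m • (if m = 0 then (1 : F →L[ℂ] F) else -1) := by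
    funext z
    simp [Finset.sum_range_succ, sub_smul, ← sub_eq_add_neg]
  rw [e, h]
  simp [Finset.sum_range_succ, pathDiff, sub_eq_add_neg]

theorem IsTame.pathDiff {r : ℝ} (hr : 1 ≤ r) {u : ℤ → F} (hu : IsTame r u) :
    IsTame r (pathDiff u) := by
  have h : IsTame r (_root_.lagOp (fun z => (1 - z) • (1 : F →L[ℂ] F)) u) :=
    hu.lagOp hr (lt_add_one r) (Differentiable.differentiableOn (by fun_prop))
  rwa [funext (lagOp_one_sub u)] at h

theorem lagOp_mul_one_sub_pow {f : ℂ → F →L[ℂ] E} {r ρ : ℝ} (hr : 1 ≤ r) (hrρ : r < ρ)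
    (hf : DifferentiableOn ℂ f (Metric.ball 0 ρ)) (n : ℕ) {u : ℤ → F} (hu : IsTame r u) (t : ℤ) :
    lagOp (fun z => (1 - z) ^ n • f z) u t = lagOp f (pathDiff^[n] u) t := by
  induction n generalizing u with
  | zero => simp
  | succ n ih =>
    rw [Function.iterate_succ_apply, ← ih (hu.pathDiff hr), ← funext (lagOp_one_sub u),
      ← lagOp_comp (f := fun z => (1 - z) ^ n • f z) (g := fun z => (1 - z) • (1 : F →L[ℂ] F))
        hr hrρ
        (differentiableOn_one_sub_pow_smul hf n)
        (Differentiable.differentiableOn (by fun_prop)) hu]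
    congr 1
    funext z
    ext x
    simp [pow_succ, smul_smul, mul_comm]

/-- Powers of `1 - z` correspond to powers of the difference operator. -/
theorem lagOp_one_sub_pow_smul (B : F →L[ℂ] E) {r : ℝ} (hr : 1 ≤ r) (n : ℕ) {u : ℤ → F}
    (hu : IsTame r u) (t : ℤ) :
    lagOp (fun z => (1 - z) ^ n • B) u t = B (pathDiff^[n] u t) := by
  rw [lagOp_mul_one_sub_pow hr (lt_add_one r) (differentiableOn_const B) n hu, lagOp_const]

end LagCalculus

theorem pathDiff_lagOp {E F : Type*} [NormedAddCommGroup E] [NormedSpace ℂ E] [CompleteSpace E]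
    [NormedAddCommGroup F] [NormedSpace ℂ F] {f : ℂ → F →L[ℂ] E} {r ρ : ℝ} (hr : 1 ≤ r)
    (hrρ : r < ρ)
    (hf : DifferentiableOn ℂ f (Metric.ball 0 ρ)) {u : ℤ → F} (hu : IsTame r u) (t : ℤ) :
    pathDiff (lagOp f u) t = lagOp (fun z => (1 - z) • f z) u t := by
  rw [← lagOp_one_sub, ← lagOp_comp (f := fun z => (1 - z) • (1 : E →L[ℂ] E)) hr hrρ
    (Differentiable.differentiableOn (by fun_prop)) hf hu]
  rfl

/-! ### Second moments -/

section SecondMoments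

variable {Ω : Type*} [MeasurableSpace Ω] {P : Measure Ω}

theorem sq_eLpNorm_two {E : Type*} [NormedAddCommGroup E] {f : Ω → E} (hf : MemLp f 2 P) :
    (eLpNorm f 2 P).toReal ^ 2 = ∫ ω, ‖f ω‖ ^ 2 ∂P := by
  have h0 : 0 ≤ ∫ ω, ‖f ω‖ ^ 2 ∂P := integral_nonneg fun _ => by positivity
  rw [hf.eLpNorm_eq_integral_rpow_norm two_ne_zero ENNReal.ofNat_ne_top,
    ENNReal.toReal_ofReal (by positivity)]
  simp only [ENNReal.toReal_ofNat, Real.rpow_ofNat]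
  rw [← Real.rpow_natCast, ← Real.rpow_mul h0]
  norm_num

theorem ae_summable_of_summable_integral_norm {E : Type*} [NormedAddCommGroup E]
    {F : ℕ → Ω → E} (hF : ∀ n, Integrable (F n) P) (hs : Summable fun n => ∫ ω, ‖F n ω‖ ∂P) :
    ∀ᵐ ω ∂P, Summable fun n => ‖F n ω‖ := by
  have h1 : ∫⁻ ω, ∑' n, ‖F n ω‖ₑ ∂P ≠ ⊤ := by
    rw [lintegral_tsum fun n => (hF n).1.enorm]
    have h2 : ∀ n, ∫⁻ ω, ‖F n ω‖ₑ ∂P = ENNReal.ofReal (∫ ω, ‖F n ω‖ ∂P) := fun n =>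
      (ofReal_integral_norm_eq_lintegral_enorm (hF n)).symm
    simp_rw [h2]
    exact hs.tsum_ofReal_ne_top
  filter_upwards [ae_lt_top' (AEMeasurable.tsum fun n => (hF n).1.enorm) h1] with ω hω
  have h3 : Summable fun n => ‖F n ω‖₊ := ENNReal.tsum_coe_ne_top_iff_summable.1 hω.ne
  exact NNReal.summable_coe.2 h3

/-- An almost surely convergent series whose `L²` norms are summable has its sum in `L²`. -/
theorem memLp_two_of_hasSum {E : Type*} [NormedAddCommGroup E] [CompleteSpace E]
    {F : ℕ → Ω → E} {S : Ω → E} {b : ℕ → ℝ} (hF : ∀ n, MemLp (F n) 2 P)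
    (hFb : ∀ n, (eLpNorm (F n) 2 P).toReal ≤ b n) (hb : Summable b)
    (hS : ∀ᵐ ω ∂P, HasSum (fun n => F n ω) (S ω)) :
    MemLp S 2 P ∧ (eLpNorm S 2 P).toReal ≤ ∑' n, b n := by
  have hn : ∀ n, ‖(hF n).toLp (F n)‖ ≤ b n := fun n => by rw [Lp.norm_toLp]; exact hFb n
  have hs : Summable fun n => (hF n).toLp (F n) := Summable.of_norm_bounded hb hn
  obtain ⟨ns, hns, hlim⟩ :=
    (tendstoInMeasure_of_tendsto_Lp hs.hasSum.tendsto_sum_nat).exists_seq_tendsto_ae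
  have hpart : ∀ᵐ ω ∂P, ∀ N, (∑ n ∈ range N, (hF n).toLp (F n) : Lp E 2 P) ω
      = ∑ n ∈ range N, F n ω := by
    rw [ae_all_iff]
    intro N
    have h1 : ∀ᵐ ω ∂P, ∀ n, ((hF n).toLp (F n) : Ω → E) ω = F n ω :=
      ae_all_iff.2 fun n => (hF n).coeFn_toLp
    filter_upwards [h1, Lp.coeFn_finsetSum (range N) fun n => (hF n).toLp (F n)] with ω h2 h3
    rw [h3, Finset.sum_apply]
    exact Finset.sum_congr rfl fun n _ => h2 n
  have hae : (∑' n, (hF n).toLp (F n) : Lp E 2 P) =ᵐ[P] S := by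
    filter_upwards [hlim, hpart, hS] with ω h1 h2 h3
    simp only [h2] at h1
    exact tendsto_nhds_unique h1 (h3.tendsto_sum_nat.comp hns.tendsto_atTop)
  refine ⟨(memLp_congr_ae hae).1 (Lp.memLp _), ?_⟩
  rw [← eLpNorm_congr_ae hae, ← Lp.norm_def]
  exact tsum_of_norm_bounded hb.hasSum hn

/-- Polynomial growth of the second moments implies subexponential growth of almost every path,
because `∑ r^{-n} ‖x_{-n}‖` has finite expectation. -/
theorem ae_isTame_of_growth {E : Type*} [NormedAddCommGroup E] [IsProbabilityMeasure P]
    {x : ℤ → Ω → E} (hx : ∀ t, MemLp (x t) 2 P) {K : ℝ} {m : ℕ}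
    (hK : ∀ n : ℕ, ∫ ω, ‖x (-n) ω‖ ^ 2 ∂P ≤ K * (1 + (n : ℝ)) ^ m) {r : ℝ} (hr : 1 < r) :
    ∀ᵐ ω ∂P, IsTame r fun t => x t ω := by
  have hr0 : 0 < r := one_pos.trans hr
  have hint : ∀ t, Integrable (x t) P := fun t => (hx t).integrable one_le_two
  have h1 : ∀ n : ℕ, ∫ ω, ‖x (-n) ω‖ ∂P ≤ 1 + K * (1 + (n : ℝ)) ^ m := by
    intro n
    have h2 : Integrable (fun ω => ‖x (-n) ω‖ ^ 2) P :=
      (memLp_two_iff_integrable_sq_norm (hx _).1).1 (hx _)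
    calc ∫ ω, ‖x (-n) ω‖ ∂P ≤ ∫ ω, (1 + ‖x (-n) ω‖ ^ 2) ∂P :=
          integral_mono (hint _).norm ((integrable_const 1).add h2) fun ω => by
            nlinarith [sq_nonneg (‖x (-n) ω‖ - 1), norm_nonneg (x (-n) ω)]
      _ = 1 + ∫ ω, ‖x (-n) ω‖ ^ 2 ∂P := by rw [integral_add (integrable_const 1) h2]; simp
      _ ≤ _ := by linarith [hK n]
  have hq : ‖r⁻¹‖ < 1 := by
    rw [norm_inv, Real.norm_of_nonneg hr0.le]; exact inv_lt_one_of_one_lt₀ hr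
  have hs : Summable fun n : ℕ => (1 + K * (1 + (n : ℝ)) ^ m) * r⁻¹ ^ n := by
    have h2 : Summable fun n : ℕ => ((n + 1 : ℕ) : ℝ) ^ m * r⁻¹ ^ (n + 1) :=
      (summable_nat_add_iff (f := fun n : ℕ => (n : ℝ) ^ m * r⁻¹ ^ n) 1).2
        (summable_pow_mul_geometric_of_norm_lt_one m hq)
    have h3 : Summable fun n : ℕ => r⁻¹ ^ n :=
      summable_geometric_of_norm_lt_one hq
    refine (h3.add (h2.mul_left (K * r))).congr fun n => ?_
    have : r * r⁻¹ = 1 := mul_inv_cancel₀ hr0.ne'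
    push_cast
    rw [pow_succ]
    linear_combination K * ((n : ℝ) + 1) ^ m * r⁻¹ ^ n * this
  have hs2 : Summable fun n : ℕ => ∫ ω, ‖(r⁻¹ ^ n) • ‖x (-n) ω‖‖ ∂P := by
    refine Summable.of_nonneg_of_le (fun n => integral_nonneg fun _ => norm_nonneg _)
      (fun n => ?_) hs
    have : ∀ ω, ‖(r⁻¹ ^ n) • ‖x (-n) ω‖‖ = r⁻¹ ^ n * ‖x (-n) ω‖ := fun ω => by
      rw [smul_eq_mul, Real.norm_of_nonneg (by positivity)]
    simp only [this]
    rw [integral_const_mul, mul_comm]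
    exact mul_le_mul_of_nonneg_right (h1 n) (by positivity)
  filter_upwards [ae_summable_of_summable_integral_norm
    (F := fun n ω => (r⁻¹ ^ n) • ‖x (-n) ω‖) (fun n => (hint (-n)).norm.const_mul (r⁻¹ ^ n)) hs2]
    with ω hω
  refine ⟨∑' n : ℕ, ‖(r⁻¹ ^ n) • ‖x (-n) ω‖‖, fun n => ?_⟩
  have h2 := hω.le_tsum n fun _ _ => norm_nonneg _
  rw [smul_eq_mul, Real.norm_of_nonneg (by positivity), inv_pow] at h2
  calc ‖x (-n) ω‖ = ((r ^ n)⁻¹ * ‖x (-n) ω‖) * r ^ n := by field_simp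
    _ ≤ _ := mul_le_mul_of_nonneg_right h2 (by positivity)

end SecondMoments

/-! ### White noise -/

namespace IsWhiteNoise

variable {Ω : Type*} [MeasurableSpace Ω] {P : Measure Ω}
variable {H : Type*} [NormedAddCommGroup H] [InnerProductSpace ℂ H]
variable {ε : ℤ → Ω → H}

theorem crossCov_eq (h : IsWhiteNoise P ε) (s t : ℤ) (v w : H) :
    crossCov P (ε t) (ε s) v w = ∫ ω, ⟪⟪w, ε s ω⟫_ℂ, ⟪v, ε t ω⟫_ℂ⟫_ℂ ∂P := by
  simp only [crossCov, h.mean_zero, sub_zero]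
  rfl

theorem crossCov_self_eq (h : IsWhiteNoise P ε) (t : ℤ) (v : H) :
    crossCov P (ε t) (ε t) v v = ((∫ ω, ‖⟪v, ε t ω⟫_ℂ‖ ^ 2 ∂P : ℝ) : ℂ) := by
  rw [h.crossCov_eq, ← integral_complex_ofReal]
  refine integral_congr_ae (ae_of_all _ fun ω => ?_)
  simp only [inner_self_eq_norm_sq_to_K]
  norm_cast

theorem integral_sq_inner_eq (h : IsWhiteNoise P ε) (s t : ℤ) (v : H) :
    ∫ ω, ‖⟪v, ε t ω⟫_ℂ‖ ^ 2 ∂P = ∫ ω, ‖⟪v, ε s ω⟫_ℂ‖ ^ 2 ∂P := by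
  have h1 := h.cov t t (s - t) v v
  rw [add_sub_cancel, h.crossCov_self_eq, h.crossCov_self_eq] at h1
  exact_mod_cast h1

variable [CompleteSpace H]

/-- White noise has constant second moments, by Parseval's identity in a countable orthonormal
basis. -/
theorem integral_sq_norm_eq [TopologicalSpace.SeparableSpace H] (h : IsWhiteNoise P ε) (s t : ℤ) :
    ∫ ω, ‖ε t ω‖ ^ 2 ∂P = ∫ ω, ‖ε s ω‖ ^ 2 ∂P := by
  obtain ⟨w, b, hb⟩ := exists_hilbertBasis ℂ H
  have hcount : Countable w := by
    refine Pairwise.countable_of_isOpen_disjoint (s := fun i : w => Metric.ball (b i) (1 / 2)) ?_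
      (fun i => Metric.isOpen_ball) (fun i => ⟨b i, Metric.mem_ball_self (by norm_num)⟩)
    intro i j hij
    refine Metric.ball_disjoint_ball ?_
    have h1 : ‖b i - b j‖ ^ 2 = 2 := by
      rw [@norm_sub_sq ℂ, b.orthonormal.1, b.orthonormal.1, b.orthonormal.2 hij]
      norm_num
    rw [dist_eq_norm]
    nlinarith [norm_nonneg (b i - b j)]
  have pars : ∀ y : H, ENNReal.ofReal (‖y‖ ^ 2) = ∑' i, ENNReal.ofReal (‖⟪b i, y⟫_ℂ‖ ^ 2) := by
    intro y
    have h1 : HasSum (fun i => ‖⟪b i, y⟫_ℂ‖ ^ 2) (‖y‖ ^ 2) := by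
      have h2 := (b.hasSum_inner_mul_inner y y).mapL Complex.reCLM
      convert h2 using 1
      · funext i
        rw [← inner_conj_symm y (b i), Complex.reCLM_apply, RCLike.conj_mul]
        norm_cast
      · rw [Complex.reCLM_apply, inner_self_eq_norm_sq_to_K]
        norm_cast
    rw [← h1.tsum_eq, ENNReal.ofReal_tsum_of_nonneg (fun _ => by positivity) h1.summable]
  have hm : ∀ t v, AEStronglyMeasurable (fun ω => ‖⟪v, ε t ω⟫_ℂ‖ ^ 2) P := fun t v =>
    ((h.memLp t).const_inner v).1.norm.pow 2
  have key : ∀ t, ∫⁻ ω, ENNReal.ofReal (‖ε t ω‖ ^ 2) ∂P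
      = ∑' i, ENNReal.ofReal (∫ ω, ‖⟪b i, ε t ω⟫_ℂ‖ ^ 2 ∂P) := by
    intro t
    simp_rw [pars]
    rw [lintegral_tsum fun i => (hm t (b i)).aemeasurable.ennreal_ofReal]
    refine tsum_congr fun i => (ofReal_integral_eq_lintegral_ofReal ?_
      (ae_of_all _ fun _ => by positivity)).symm
    exact (memLp_two_iff_integrable_sq_norm ((h.memLp t).const_inner _).1).1
      ((h.memLp t).const_inner _)
  have h3 : ∀ t, ∫ ω, ‖ε t ω‖ ^ 2 ∂P = (∫⁻ ω, ENNReal.ofReal (‖ε t ω‖ ^ 2) ∂P).toReal := fun t =>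
    integral_eq_lintegral_of_nonneg_ae (ae_of_all _ fun _ => by positivity)
      ((h.memLp t).1.norm.pow 2)
  rw [h3, h3, key, key]
  simp_rw [h.integral_sq_inner_eq s t]

theorem eLpNorm_eq [TopologicalSpace.SeparableSpace H] (h : IsWhiteNoise P ε) (t : ℤ) :
    (eLpNorm (ε t) 2 P).toReal = (eLpNorm (ε 0) 2 P).toReal := by
  have h1 : (eLpNorm (ε t) 2 P).toReal ^ 2 = (eLpNorm (ε 0) 2 P).toReal ^ 2 := by
    rw [sq_eLpNorm_two (h.memLp t), sq_eLpNorm_two (h.memLp 0), h.integral_sq_norm_eq 0 t]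
  exact (pow_left_inj₀ ENNReal.toReal_nonneg ENNReal.toReal_nonneg two_ne_zero).1 h1

theorem eLpNorm_clm_le [TopologicalSpace.SeparableSpace H] {E : Type*} [NormedAddCommGroup E]
    [NormedSpace ℂ E] (h : IsWhiteNoise P ε) (B : H →L[ℂ] E) (t : ℤ) :
    (eLpNorm (fun ω => B (ε t ω)) 2 P).toReal ≤ ‖B‖ * (eLpNorm (ε 0) 2 P).toReal := by
  rw [← h.eLpNorm_eq t]
  have h1 : eLpNorm (fun ω => B (ε t ω)) 2 P ≤ ENNReal.ofReal ‖B‖ * eLpNorm (ε t) 2 P :=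
    eLpNorm_le_mul_eLpNorm_of_ae_le_mul (ae_of_all _ fun ω => B.le_opNorm _) 2
  have h2 := ENNReal.toReal_mono (ENNReal.mul_ne_top ENNReal.ofReal_ne_top (h.memLp t).2.ne) h1
  rwa [ENNReal.toReal_mul, ENNReal.toReal_ofReal (norm_nonneg _)] at h2

theorem ae_isTame [TopologicalSpace.SeparableSpace H] [IsProbabilityMeasure P]
    (h : IsWhiteNoise P ε) {r : ℝ} (hr : 1 < r) : ∀ᵐ ω ∂P, IsTame r fun t => ε t ω :=
  ae_isTame_of_growth h.memLp (K := ∫ ω, ‖ε 0 ω‖ ^ 2 ∂P) (m := 0)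
    (fun n => by rw [pow_zero, mul_one, h.integral_sq_norm_eq 0]) hr

variable {E : Type*} [NormedAddCommGroup E] [NormedSpace ℂ E] [CompleteSpace E]
variable [TopologicalSpace.SeparableSpace H] [IsProbabilityMeasure P]
variable {f : ℂ → H →L[ℂ] E} {ρ : ℝ}

theorem ae_hasSum_lagOp (h : IsWhiteNoise P ε) (hρ : 1 < ρ)
    (hf : DifferentiableOn ℂ f (Metric.ball 0 ρ)) :
    ∀ᵐ ω ∂P, ∀ t : ℤ, HasSum (fun n : ℕ => tCoeff f n (ε (t - n) ω))
      (lagOp f (fun s => ε s ω) t) := by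
  obtain ⟨r, hr1, hrρ⟩ := exists_between hρ
  filter_upwards [h.ae_isTame hr1] with ω hω t
  exact (summable_lagOp hr1.le hrρ hf hω t).hasSum

theorem exists_memLp_lagOp (h : IsWhiteNoise P ε) (hρ : 1 < ρ)
    (hf : DifferentiableOn ℂ f (Metric.ball 0 ρ)) :
    ∃ K, ∀ t, MemLp (fun ω => lagOp f (fun s => ε s ω) t) 2 P ∧
      (eLpNorm (fun ω => lagOp f (fun s => ε s ω) t) 2 P).toReal ≤ K := by
  have hs : Summable fun n => ‖tCoeff f n‖ * (eLpNorm (ε 0) 2 P).toReal := by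
    have := summable_norm_tCoeff hf zero_le_one hρ
    simp only [one_pow, mul_one] at this
    exact this.mul_right _
  refine ⟨_, fun t => memLp_two_of_hasSum (F := fun n ω => tCoeff f n (ε (t - n) ω))
    (fun n => (tCoeff f n).comp_memLp' (h.memLp _)) (fun n => h.eLpNorm_clm_le _ _) hs ?_⟩
  filter_upwards [h.ae_hasSum_lagOp hρ hf] with ω hω using hω t

theorem memLp_lagOp (h : IsWhiteNoise P ε) (hρ : 1 < ρ)
    (hf : DifferentiableOn ℂ f (Metric.ball 0 ρ)) (t : ℤ) :
    MemLp (fun ω => lagOp f (fun s => ε s ω) t) 2 P :=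
  ((h.exists_memLp_lagOp hρ hf).choose_spec t).1

theorem integral_lagOp (h : IsWhiteNoise P ε) (hρ : 1 < ρ)
    (hf : DifferentiableOn ℂ f (Metric.ball 0 ρ)) (t : ℤ) :
    ∫ ω, lagOp f (fun s => ε s ω) t ∂P = 0 := by
  have hint : ∀ t, Integrable (ε t) P := fun t => (h.memLp t).integrable one_le_two
  have h1 := hasSum_integral_of_summable_integral_norm (μ := P)
    (F := fun (n : ℕ) ω => tCoeff f n (ε (t - n) ω))
    (fun n => (tCoeff f n).integrable_comp (hint _)) ?_
  · have h2 : (fun n : ℕ => ∫ ω, tCoeff f n (ε (t - n) ω) ∂P) = fun _ => 0 := by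
      funext n
      rw [(tCoeff f n).integral_comp_comm (hint _), h.mean_zero, map_zero]
    rw [h2] at h1
    exact (hasSum_zero.unique h1).symm
  · have hs : Summable fun n => ‖tCoeff f n‖ * (1 + ∫ ω, ‖ε 0 ω‖ ^ 2 ∂P) := by
      have := summable_norm_tCoeff hf zero_le_one hρ
      simp only [one_pow, mul_one] at this
      exact this.mul_right _
    refine Summable.of_nonneg_of_le (fun n => integral_nonneg fun _ => norm_nonneg _)
      (fun n => ?_) hs
    have h2 : Integrable (fun ω => ‖ε (t - n) ω‖ ^ 2) P :=
      (memLp_two_iff_integrable_sq_norm (h.memLp _).1).1 (h.memLp _)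
    calc ∫ ω, ‖tCoeff f n (ε (t - n) ω)‖ ∂P
        ≤ ∫ ω, ‖tCoeff f n‖ * (1 + ‖ε (t - n) ω‖ ^ 2) ∂P := by
          refine integral_mono ((tCoeff f n).integrable_comp (hint _)).norm
            (((integrable_const 1).add h2).const_mul _) fun ω => ?_
          refine ((tCoeff f n).le_opNorm _).trans (mul_le_mul_of_nonneg_left ?_ (norm_nonneg _))
          nlinarith [sq_nonneg (‖ε (t - n) ω‖ - 1), norm_nonneg (ε (t - n) ω)]
      _ = _ := by
          rw [integral_const_mul, integral_add (integrable_const 1) h2, h.integral_sq_norm_eq 0]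
          simp

end IsWhiteNoise

/-! ### Linear processes and their long-run coefficients -/

section LongRun

variable {Ω : Type*} [MeasurableSpace Ω] {P : Measure Ω}
variable {H : Type*} [NormedAddCommGroup H] [InnerProductSpace ℂ H]

theorem tsum_tCoeff {E : Type*} [NormedAddCommGroup E] [NormedSpace ℂ E] [CompleteSpace E]
    {f : ℂ → E} {ρ : ℝ} (hρ : 1 < ρ) (hf : DifferentiableOn ℂ f (Metric.ball 0 ρ)) :
    ∑' n, tCoeff f n = f 1 := by
  have h := hasSum_tCoeff hf (z := 1) (by simpa using hρ)
  simp only [one_pow, one_smul] at h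
  exact h.tsum_eq

theorem isAbsConvergent_tCoeff {E : Type*} [NormedAddCommGroup E] [InnerProductSpace ℂ E]
    [CompleteSpace E] {f : ℂ → H →L[ℂ] E} {ρ : ℝ} (hρ : 1 < ρ)
    (hf : DifferentiableOn ℂ f (Metric.ball 0 ρ)) : IsAbsConvergent (tCoeff f) :=
  ⟨ρ, hρ, fun _ hz => summable_norm_tCoeff hf (norm_nonneg _) hz⟩

/-- An absolutely convergent coefficient sequence consists of the Taylor coefficients of a
holomorphic function. -/
theorem IsAbsConvergent.exists_differentiableOn {E : Type*} [NormedAddCommGroup E]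
    [InnerProductSpace ℂ E] [CompleteSpace E] {B : ℕ → H →L[ℂ] E} (hB : IsAbsConvergent B) :
    ∃ (ρ : ℝ) (f : ℂ → H →L[ℂ] E), 1 < ρ ∧ DifferentiableOn ℂ f (Metric.ball 0 ρ) ∧
      tCoeff f = B ∧ f 1 = ∑' n, B n := by
  obtain ⟨ρ', hρ', hs⟩ := hB
  obtain ⟨ρ, hρ, hlt⟩ := exists_between hρ'
  have hρ0 : 0 < ρ := one_pos.trans hρ
  have hs1 : Summable fun n => ‖B n‖ * ρ ^ n := by
    simpa [abs_of_pos hρ0] using hs (ρ : ℂ) (by simpa [abs_of_pos hρ0] using hlt)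
  have hle : ∀ (n : ℕ) (z : ℂ), z ∈ Metric.ball (0 : ℂ) ρ → ‖z ^ n • B n‖ ≤ ‖B n‖ * ρ ^ n := by
    intro n z hz
    rw [norm_smul, norm_pow, mul_comm]
    exact mul_le_mul_of_nonneg_left
      (pow_le_pow_left₀ (norm_nonneg z) (by simpa using (Metric.mem_ball.1 hz).le) n)
      (norm_nonneg _)
  have hf : DifferentiableOn ℂ (fun z : ℂ => ∑' n, z ^ n • B n) (Metric.ball 0 ρ) :=
    Complex.differentiableOn_tsum_of_summable_norm hs1
      (fun n => Differentiable.differentiableOn (by fun_prop)) Metric.isOpen_ball hle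
  refine ⟨ρ, fun z => ∑' n, z ^ n • B n, hρ, hf, ?_, by simp⟩
  refine tCoeff_eq_of_hasSum hρ0 (fun z hz => ?_) hf
  exact (Summable.of_norm_bounded hs1 fun n => hle n z (by simpa using hz)).hasSum

/-- Removing the value at `1` from a holomorphic function leaves a multiple of `1 - z`. -/
theorem exists_eq_add_one_sub_smul {E : Type*} [NormedAddCommGroup E] [NormedSpace ℂ E]
    [CompleteSpace E] {f : ℂ → E} {ρ : ℝ} (hρ : 1 < ρ)
    (hf : DifferentiableOn ℂ f (Metric.ball 0 ρ)) :
    ∃ g : ℂ → E, DifferentiableOn ℂ g (Metric.ball 0 ρ) ∧ ∀ z, f z = f 1 + (1 - z) • g z := by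
  refine ⟨fun z => -dslope f 1 z, DifferentiableOn.fun_neg ?_, fun z => ?_⟩
  · exact (Complex.differentiableOn_dslope (Metric.isOpen_ball.mem_nhds (by simpa using hρ))).2 hf
  · have h := sub_smul_dslope f 1 z
    rw [smul_neg, ← neg_smul, neg_sub, h]
    abel

theorem pathDiff_iterate_lagOp {E : Type*} [NormedAddCommGroup E] [NormedSpace ℂ E]
    [CompleteSpace E] {f : ℂ → H →L[ℂ] E} {r ρ : ℝ} (hr : 1 ≤ r) (hrρ : r < ρ)
    (hf : DifferentiableOn ℂ f (Metric.ball 0 ρ)) (n : ℕ) {u : ℤ → H} (hu : IsTame r u) (t : ℤ) :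
    pathDiff^[n] (lagOp f u) t = lagOp (fun z => (1 - z) ^ n • f z) u t := by
  induction n generalizing f with
  | zero => simp
  | succ n ih =>
    rw [Function.iterate_succ_apply, funext (pathDiff_lagOp hr hrρ hf hu),
      ih (f := fun z => (1 - z) • f z) (differentiableOn_one_sub_smul hf)]
    congr 1
    funext z
    rw [smul_smul, pow_succ]

variable [CompleteSpace H]

/-- Partial sums of a white noise of functionals have second moments that grow linearly, so they
cannot telescope to a process that is bounded in `L²`. -/
theorem IsWhiteNoise.functional_eq_zero {ε : ℤ → Ω → H} (h : IsWhiteNoise P ε)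
    (hns : HasNonsingularCov P ε) (φ : H →L[ℂ] ℂ)
    {u : ℤ → Ω → ℂ} {K : ℝ} (hu : ∀ t, MemLp (u t) 2 P ∧ (eLpNorm (u t) 2 P).toReal ≤ K)
    (heq : ∀ t, ∀ᵐ ω ∂P, φ (ε t ω) = u t ω - u (t - 1) ω) : φ = 0 := by
  obtain ⟨v, rfl⟩ := (InnerProductSpace.toDual ℂ H).surjective φ
  have hX : ∀ t, MemLp (fun ω => ⟪v, ε t ω⟫_ℂ) 2 P := fun t => (h.memLp t).const_inner v
  let e : ℤ → Lp ℂ 2 P := fun t => (hX t).toLp _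
  let U : ℤ → Lp ℂ 2 P := fun t => (hu t).1.toLp _
  have he : ∀ t, e t = U t - U (t - 1) := by
    intro t
    rw [← MemLp.toLp_sub, MemLp.toLp_eq_toLp_iff]
    filter_upwards [heq t] with ω hω using hω
  have hinner : ∀ s t, ⟪e s, e t⟫_ℂ = crossCov P (ε t) (ε s) v v := by
    intro s t
    rw [h.crossCov_eq, L2.inner_def]
    refine integral_congr_ae ?_
    filter_upwards [(hX s).coeFn_toLp, (hX t).coeFn_toLp] with ω h1 h2
    rw [h1, h2]
  have hnorm : ∀ t, ‖e t‖ ^ 2 = ‖e 0‖ ^ 2 := by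
    intro t
    have h1 : ⟪e t, e t⟫_ℂ = ⟪e 0, e 0⟫_ℂ := by
      rw [hinner, hinner]
      simpa using h.cov t t (-t) v v
    rw [inner_self_eq_norm_sq_to_K, inner_self_eq_norm_sq_to_K] at h1
    exact_mod_cast h1
  have hsum : ∀ T : ℕ, ‖∑ i ∈ range T, e (i + 1)‖ ^ 2 = T * ‖e 0‖ ^ 2 := by
    intro T
    induction T with
    | zero => simp
    | succ T ih =>
      have h1 : ⟪∑ i ∈ range T, e (i + 1), e (T + 1)⟫_ℂ = 0 := by
        rw [sum_inner]
        refine Finset.sum_eq_zero fun i hi => ?_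
        rw [hinner]
        refine h.uncorrelated _ _ v v ?_
        have := Finset.mem_range.1 hi
        omega
      rw [Finset.sum_range_succ, @norm_add_sq ℂ, h1, ih, hnorm (T + 1), map_zero]
      push_cast
      ring
  have htel : ∀ T : ℕ, ∑ i ∈ range T, e (i + 1) = U T - U 0 := by
    intro T
    induction T with
    | zero => simp
    | succ T ih =>
      rw [Finset.sum_range_succ, ih, he]
      simp
  have hbound : ∀ T : ℕ, T * ‖e 0‖ ^ 2 ≤ (2 * K) ^ 2 := by
    intro T
    rw [← hsum, htel]
    have h1 : ∀ t, ‖U t‖ ≤ K := fun t => by rw [Lp.norm_toLp]; exact (hu t).2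
    refine pow_le_pow_left₀ (norm_nonneg _) ((norm_sub_le _ _).trans ?_) 2
    linarith [h1 T, h1 0]
  have he0 : ‖e 0‖ ^ 2 = 0 := by
    by_contra hne
    have hpos : 0 < ‖e 0‖ ^ 2 := lt_of_le_of_ne (by positivity) (Ne.symm hne)
    obtain ⟨T, hT⟩ := exists_nat_gt ((2 * K) ^ 2 / ‖e 0‖ ^ 2)
    rw [div_lt_iff₀ hpos] at hT
    exact absurd (hbound T) (not_le.2 hT)
  have hv : v = 0 := by
    by_contra hv
    refine hns 0 v hv ?_
    rw [← hinner, inner_self_eq_zero, ← norm_eq_zero]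
    exact pow_eq_zero_iff two_ne_zero |>.1 he0
  rw [hv, map_zero]

variable [IsProbabilityMeasure P] [TopologicalSpace.SeparableSpace H]

namespace IsWhiteNoise

variable {ε η : ℤ → Ω → H}

theorem isLinearIn_of_eq_lagOp (h : IsWhiteNoise P ε) {E : Type*} [NormedAddCommGroup E]
    [InnerProductSpace ℂ E] [CompleteSpace E] {f : ℂ → H →L[ℂ] E} {ρ : ℝ} (hρ : 1 < ρ)
    (hf : DifferentiableOn ℂ f (Metric.ball 0 ρ)) {u : ℤ → Ω → E}
    (hu : ∀ t, ∀ᵐ ω ∂P, u t ω = lagOp f (fun s => ε s ω) t) : IsLinearIn P ε (tCoeff f) u := by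
  refine ⟨isAbsConvergent_tCoeff hρ hf, fun t => ?_, fun t => ?_⟩
  · exact ((h.memLp_lagOp hρ hf t).integrable one_le_two).congr ((hu t).mono fun _ h => h.symm)
  · rw [integral_congr_ae (hu t), h.integral_lagOp hρ hf]
    filter_upwards [hu t, h.ae_hasSum_lagOp hρ hf] with ω h1 h2
    rw [h1, sub_zero]
    exact h2 t

/-- If a linear process `f(L) ε_t` coincides with a difference `Δ^p g(L) η_t`, `p ≥ 1`, of another
linear process, then `f(1) = 0`. -/
theorem apply_one_eq_zero (h : IsWhiteNoise P ε) (hns : HasNonsingularCov P ε)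
    (hη : IsWhiteNoise P η) {E : Type*} [NormedAddCommGroup E] [NormedSpace ℂ E] [CompleteSpace E]
    {f g : ℂ → H →L[ℂ] E} {ρ ρ' : ℝ} (hρ : 1 < ρ) (hρ' : 1 < ρ')
    (hf : DifferentiableOn ℂ f (Metric.ball 0 ρ)) (hg : DifferentiableOn ℂ g (Metric.ball 0 ρ'))
    {p : ℕ} (hp : 1 ≤ p)
    (heq : ∀ t, ∀ᵐ ω ∂P, lagOp f (fun s => ε s ω) t
      = pathDiff^[p] (lagOp g fun s => η s ω) t) : f 1 = 0 := by
  obtain ⟨q, rfl⟩ : ∃ q, p = q + 1 := ⟨p - 1, by omega⟩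
  ext x
  refine SeparatingDual.eq_zero_of_forall_dual_eq_zero (R := ℂ) fun φ => ?_
  -- for `φ f(z) = φ f(1) + (1 - z) f₁(z)`, the noise `φ f(1) ε_t` is the difference of
  -- `φ Δ^q g(L) η_t - f₁(L) ε_t`
  have hφf : DifferentiableOn ℂ (fun z => φ ∘L f z) (Metric.ball 0 ρ) :=
    (differentiableOn_const φ).clm_comp hf
  have hφg : DifferentiableOn ℂ (fun z => φ ∘L ((1 - z) ^ q • g z)) (Metric.ball 0 ρ') :=
    (differentiableOn_const φ).clm_comp (differentiableOn_one_sub_pow_smul hg q)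
  obtain ⟨f₁, hf₁, hff₁⟩ := exists_eq_add_one_sub_smul hρ hφf
  obtain ⟨K₁, hK₁⟩ := hη.exists_memLp_lagOp hρ' hφg
  obtain ⟨K₂, hK₂⟩ := h.exists_memLp_lagOp hρ hf₁
  have hzero : φ ∘L f 1 = 0 := by
    refine h.functional_eq_zero hns (φ ∘L f 1) (K := K₁ + K₂)
      (u := fun t ω => lagOp (fun z => φ ∘L ((1 - z) ^ q • g z)) (fun s => η s ω) t
        - lagOp f₁ (fun s => ε s ω) t) (fun t => ⟨(hK₁ t).1.sub (hK₂ t).1, ?_⟩) fun t => ?_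
    · refine le_trans (ENNReal.toReal_mono ?_
        (eLpNorm_sub_le (hK₁ t).1.1 (hK₂ t).1.1 one_le_two)) ?_
      · exact ENNReal.add_ne_top.2 ⟨(hK₁ t).1.2.ne, (hK₂ t).1.2.ne⟩
      · rw [ENNReal.toReal_add (hK₁ t).1.2.ne (hK₂ t).1.2.ne]
        exact add_le_add (hK₁ t).2 (hK₂ t).2
    · obtain ⟨r, hr, hrρ⟩ := exists_between (lt_min hρ hρ')
      have hrρ1 := hrρ.trans_le (min_le_left _ _)
      have hrρ2 := hrρ.trans_le (min_le_right _ _)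
      filter_upwards [heq t, h.ae_isTame hr, hη.ae_isTame hr] with ω hω hε hηω
      have e1 : lagOp (fun z => φ ∘L f z) (fun s => ε s ω) t
          = φ (lagOp f (fun s => ε s ω) t) := by
        rw [lagOp_comp (f := fun _ => φ) hr.le hrρ1 (differentiableOn_const φ) hf hε, lagOp_const]
      have hgq : DifferentiableOn ℂ (fun z => (1 - z) ^ q • g z) (Metric.ball 0 ρ') :=
        differentiableOn_one_sub_pow_smul hg _
      have e2 : ∀ s, lagOp (fun z => φ ∘L ((1 - z) ^ q • g z)) (fun s => η s ω) s
          = φ (lagOp (fun z => (1 - z) ^ q • g z) (fun s => η s ω) s) := by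
        intro s
        rw [lagOp_comp (f := fun _ => φ) hr.le hrρ2 (differentiableOn_const φ) hgq hηω, lagOp_const]
      have e3 : lagOp (fun z => φ ∘L f z) (fun s => ε s ω) t
          = (φ ∘L f 1) (ε t ω) + pathDiff (lagOp f₁ fun s => ε s ω) t := by
        rw [lagOp_congr (ρ := ρ) (by linarith) (fun z _ => hff₁ z),
          lagOp_add hr.le hrρ1 (differentiableOn_const _)
            (differentiableOn_one_sub_smul hf₁) hε,
          lagOp_const, pathDiff_lagOp hr.le hrρ1 hf₁ hε]
      rw [Function.iterate_succ_apply', funext (pathDiff_iterate_lagOp hr.le hrρ2 hg q hηω)] at hω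
      rw [hω] at e1
      rw [e1] at e3
      simp only [pathDiff, map_sub, ← e2] at e3
      linear_combination -e3
  exact congrArg (fun T : H →L[ℂ] ℂ => T x) hzero

/-- Of two differences of a process that are linear processes up to their means, the one of higher
order has vanishing long-run coefficient. -/
theorem apply_one_eq_zero_of_lt (h : IsWhiteNoise P ε) (hns : HasNonsingularCov P ε)
    (hη : IsWhiteNoise P η) {E : Type*} [NormedAddCommGroup E] [NormedSpace ℂ E] [CompleteSpace E]
    {f g : ℂ → H →L[ℂ] E} {ρ ρ' : ℝ} (hρ : 1 < ρ) (hρ' : 1 < ρ')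
    (hf : DifferentiableOn ℂ f (Metric.ball 0 ρ)) (hg : DifferentiableOn ℂ g (Metric.ball 0 ρ'))
    {d₁ d₂ : ℕ} (hd : d₂ < d₁) {X : ℤ → Ω → E} {m₁ m₂ : ℤ → E}
    (h₁ : ∀ t, ∀ᵐ ω ∂P, diffOp^[d₁] X t ω - m₁ t = lagOp f (fun s => ε s ω) t)
    (h₂ : ∀ t, ∀ᵐ ω ∂P, diffOp^[d₂] X t ω - m₂ t = lagOp g (fun s => η s ω) t) : f 1 = 0 := by
  obtain ⟨p, rfl⟩ : ∃ p, d₁ = p + d₂ := ⟨d₁ - d₂, by omega⟩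
  obtain ⟨r, hr, hrρ⟩ := exists_between hρ'
  have hgp : DifferentiableOn ℂ (fun z => (1 - z) ^ p • g z) (Metric.ball 0 ρ') :=
    differentiableOn_one_sub_pow_smul hg _
  have key : ∀ t, ∀ᵐ ω ∂P, lagOp f (fun s => ε s ω) t + m₁ t
      = pathDiff^[p] m₂ t + pathDiff^[p] (lagOp g fun s => η s ω) t := by
    intro t
    filter_upwards [h₁ t, ae_all_iff.2 h₂] with ω hω₁ hω₂
    have e1 : pathDiff^[d₂] (fun s => X s ω) = m₂ + lagOp g fun s => η s ω := by
      funext s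
      rw [← diffOp_iterate_apply, Pi.add_apply, ← hω₂ s]
      abel
    rw [diffOp_iterate_apply, Function.iterate_add_apply, e1, pathDiff_iterate_add,
      Pi.add_apply] at hω₁
    rw [← hω₁]
    abel
  have hmean : ∀ t, m₁ t = pathDiff^[p] m₂ t := by
    intro t
    have e1 : ∀ᵐ ω ∂P, lagOp f (fun s => ε s ω) t + m₁ t
        = pathDiff^[p] m₂ t + lagOp (fun z => (1 - z) ^ p • g z) (fun s => η s ω) t := by
      filter_upwards [key t, hη.ae_isTame hr] with ω hω hηω
      rw [hω, pathDiff_iterate_lagOp hr.le hrρ hg p hηω]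
    have e2 := integral_congr_ae e1
    rw [integral_add ((h.memLp_lagOp hρ hf t).integrable one_le_two) (integrable_const _),
      integral_add (integrable_const _) ((hη.memLp_lagOp hρ' hgp t).integrable one_le_two),
      h.integral_lagOp hρ hf, hη.integral_lagOp hρ' hgp] at e2
    simpa using e2
  refine h.apply_one_eq_zero hns hη hρ hρ' hf hg (p := p) (by omega) fun t => ?_
  filter_upwards [key t] with ω hω
  rw [hmean t, add_comm] at hω
  exact add_left_cancel hω

end IsWhiteNoise

end LongRun

/-! ### The inverse of the autoregressive polynomial -/

section Inverse

variable {H : Type*} [NormedAddCommGroup H] [InnerProductSpace ℂ H]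
variable {k : ℕ} {A : ℕ → H →L[ℂ] H}

theorem arCoeff_eq_zero {n : ℕ} (hn : k < n) : arCoeff k A n = 0 := by
  rw [arCoeff, if_neg (by omega), Finset.Icc_eq_empty (by omega), Finset.sum_empty, smul_zero]

theorem arOp_zero : arOp k A 0 = 1 := by
  rw [arOp, Finset.sum_eq_zero, sub_zero]
  intro h hh
  rw [zero_pow (by have := (Finset.mem_Icc.1 hh).1; omega), zero_smul]

theorem arOp_one : arOp k A 1 = arCoeff k A 0 := by
  simp [arOp, arCoeff]

theorem HasUnitRootOfFiniteType.isFredholm (hA : HasUnitRootOfFiniteType k A) :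
    (arCoeff k A 0).IsFredholm := by
  rw [← arOp_one]; exact hA.1.fredholm

variable [CompleteSpace H]

theorem polyOp_eq_sum (a : ℕ → H →L[ℂ] H) (k : ℕ) (w : ℂ) :
    polyOp a k w = ∑ n ∈ range (k + 1), w ^ n • a n := by
  rw [polyOp, lrfTail, Finset.sum_range_succ', pow_zero, one_smul, add_comm]
  congr 1
  rw [← Finset.Ico_add_one_right_eq_Icc, Finset.sum_Ico_eq_sum_range]
  simp only [zero_add, lrfA_one, Nat.add_sub_cancel, add_comm 1]

/-- The binomial expansion of the autoregressive polynomial around `z = 1`. -/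
theorem arOp_eq_polyOp (z : ℂ) : arOp k A z = polyOp (arCoeff k A) k (1 - z) := by
  have h1 : ∀ h ∈ Icc 1 k, z ^ h • A h = A h + ∑ n ∈ Icc 1 k,
      (1 - z) ^ n • (if n ≤ h then ((-1 : ℂ) ^ n * (h.choose n : ℂ)) • A h else 0) := by
    intro h hh
    have hz : z ^ h = 1 + ∑ n ∈ Icc 1 h, (1 - z) ^ n * ((-1 : ℂ) ^ n * (h.choose n : ℂ)) := by
      have e : z = -(1 - z) + 1 := by ring
      conv_lhs => rw [e, add_pow, Finset.sum_range_succ']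
      rw [← Finset.Ico_add_one_right_eq_Icc, Finset.sum_Ico_eq_sum_range, add_comm]
      simp only [one_pow, mul_one, pow_zero, Nat.choose_zero_right, Nat.cast_one,
        Nat.add_sub_cancel, add_comm 1, neg_pow (1 - z)]
      congr 1
      exact Finset.sum_congr rfl fun n _ => by ring
    have hle := (Finset.mem_Icc.1 hh).2
    rw [hz, add_smul, one_smul, Finset.sum_smul]
    congr 1
    rw [← Finset.sum_subset (Finset.Icc_subset_Icc_right hle)]
    · refine Finset.sum_congr rfl fun n hn => ?_
      rw [if_pos (Finset.mem_Icc.1 hn).2, smul_smul]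
    · intro n hn hn'
      rw [if_neg, smul_zero]
      intro hnh
      exact hn' (Finset.mem_Icc.2 ⟨(Finset.mem_Icc.1 hn).1, hnh⟩)
  have h2 : ∀ n ∈ Icc 1 k, ∑ h ∈ Icc 1 k,
      (1 - z) ^ n • (if n ≤ h then ((-1 : ℂ) ^ n * (h.choose n : ℂ)) • A h else 0)
      = -((1 - z) ^ n • arCoeff k A n) := by
    intro n hn
    have hn1 := (Finset.mem_Icc.1 hn).1
    rw [arCoeff, if_neg (by omega), ← Finset.smul_sum, ← smul_neg, ← Finset.sum_filter]
    congr 1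
    have e : (Icc 1 k).filter (fun h => n ≤ h) = Icc n k := by
      ext h; simp only [Finset.mem_filter, Finset.mem_Icc]; omega
    rw [e, pow_succ, mul_neg_one, neg_smul, neg_neg, Finset.smul_sum]
    exact Finset.sum_congr rfl fun h _ => by rw [smul_smul]
  rw [arOp, Finset.sum_congr rfl h1, Finset.sum_add_distrib, Finset.sum_comm,
    Finset.sum_congr rfl h2, Finset.sum_neg_distrib, polyOp, lrfTail, arCoeff, if_pos rfl]
  simp only [lrfA_one, zero_add]
  abel

theorem differentiable_arOp : Differentiable ℂ (arOp k A) := by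
  unfold arOp
  fun_prop

theorem HasUnitRootOfFiniteType.hasGenInverses (hA : HasUnitRootOfFiniteType k A) :
    HasGenInverses (arCoeff k A) := hasGenInverses_of_isFredholm hA.isFredholm

/-- After multiplication by `(1 - z)^d` the inverse of the autoregressive polynomial is holomorphic
on a disc of radius larger than `1`, with the value `S_d⁺` at `z = 1`. -/
theorem HasUnitRootOfFiniteType.exists_inverse (hA : HasUnitRootOfFiniteType k A) {d : ℕ}
    (hd : lrfT (arCoeff k A) (d + 1) = ⊤) :
    ∃ (ρ : ℝ) (f : ℂ → H →L[ℂ] H), 1 < ρ ∧ DifferentiableOn ℂ f (Metric.ball 0 ρ) ∧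
      f 1 = genInverse (lrfS (arCoeff k A) d) ∧
      (∀ z : ℂ, ‖z‖ < ρ → f z * arOp k A z = (1 - z) ^ d • 1) ∧
      (∀ z : ℂ, ‖z‖ < ρ → arOp k A z * f z = (1 - z) ^ d • 1) ∧
      ∀ z : ℂ, ‖z‖ < ρ → z ≠ 1 → IsUnit (arOp k A z) := by
  obtain ⟨ρ, hρ, hunit⟩ := hA.2
  obtain ⟨g, hg, hg0, hgA⟩ := hA.hasGenInverses.exists_analytic_inverse
    (fun n => arCoeff_eq_zero) hd
  let f : ℂ → H →L[ℂ] H := fun z =>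
    if z = 1 then g 0 else (1 - z) ^ d • Ring.inverse (arOp k A z)
  have hf1 : f 1 = g 0 := if_pos rfl
  have hfne : ∀ z, z ≠ 1 → f z = (1 - z) ^ d • Ring.inverse (arOp k A z) := fun z hz => if_neg hz
  have hsub : Tendsto (fun z : ℂ => 1 - z) (𝓝 1) (𝓝 0) := by
    have : Continuous fun z : ℂ => 1 - z := by fun_prop
    simpa using this.tendsto 1
  have hfg : f =ᶠ[𝓝 1] fun z => g (1 - z) := by
    have h1 : ∀ᶠ z : ℂ in 𝓝 1, ‖z‖ < ρ :=
      continuous_norm.continuousAt.eventually_lt continuousAt_const (by simpa using hρ)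
    filter_upwards [hsub.eventually hgA, h1] with z hz hzρ
    by_cases h : z = 1
    · rw [h, hf1, sub_self]
    · rw [← arOp_eq_polyOp] at hz
      rw [hfne z h, ← mul_one (g (1 - z)), ← Ring.mul_inverse_cancel _ (hunit z hzρ h), ← mul_assoc,
        hz, smul_mul_assoc, one_mul]
  have hfd : DifferentiableOn ℂ f (Metric.ball 0 ρ) := by
    intro z hz
    refine DifferentiableAt.differentiableWithinAt ?_
    by_cases h : z = 1
    · rw [h]
      refine DifferentiableAt.congr_of_eventuallyEq ?_ hfg
      have h1 : DifferentiableAt ℂ g (1 - 1) := by rw [sub_self]; exact hg.differentiableAt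
      have h2 : DifferentiableAt ℂ (fun z : ℂ => 1 - z) 1 := by fun_prop
      exact h1.comp 1 h2
    · have h1 : f =ᶠ[𝓝 z] fun z => (1 - z) ^ d • Ring.inverse (arOp k A z) := by
        filter_upwards [isOpen_ne.mem_nhds h] with y hy using hfne y hy
      refine DifferentiableAt.congr_of_eventuallyEq ?_ h1
      have h2 : DifferentiableAt ℂ (fun z : ℂ => (1 - z) ^ d) z := by fun_prop
      refine h2.smul ?_
      exact (differentiableAt_inverse (hunit z (by simpa using hz) h)).comp z
        differentiable_arOp.differentiableAt
  have hcont1 : ContinuousAt f 1 :=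
    (hfd.differentiableAt (Metric.isOpen_ball.mem_nhds (by simpa using hρ))).continuousAt
  have hAcont : ContinuousAt (arOp k A) 1 := differentiable_arOp.continuous.continuousAt
  have hpcont : ContinuousAt (fun z : ℂ => (1 - z) ^ d • (1 : H →L[ℂ] H)) 1 := by fun_prop
  have hball : ∀ᶠ z : ℂ in 𝓝[≠] 1, ‖z‖ < ρ ∧ z ≠ 1 := by
    refine Filter.Eventually.and (Filter.Eventually.filter_mono nhdsWithin_le_nhds ?_)
      self_mem_nhdsWithin
    exact continuous_norm.continuousAt.eventually_lt continuousAt_const (by simpa using hρ)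
  -- the two products are known off `z = 1` and extend by continuity
  have hleft : ∀ z : ℂ, ‖z‖ < ρ → z ≠ 1 → f z * arOp k A z = (1 - z) ^ d • 1 := by
    intro z hz h
    rw [hfne z h, smul_mul_assoc, Ring.inverse_mul_cancel _ (hunit z hz h)]
  have hright : ∀ z : ℂ, ‖z‖ < ρ → z ≠ 1 → arOp k A z * f z = (1 - z) ^ d • 1 := by
    intro z hz h
    rw [hfne z h, mul_smul_comm, Ring.mul_inverse_cancel _ (hunit z hz h)]
  refine ⟨ρ, f, hρ, hfd, hf1.trans hg0, fun z hz => ?_, fun z hz => ?_, hunit⟩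
  · by_cases h : z = 1
    · rw [h]
      refine tendsto_nhds_unique ((hcont1.mul hAcont).tendsto.mono_left nhdsWithin_le_nhds)
        ((hpcont.tendsto.mono_left (nhdsWithin_le_nhds (s := {1}ᶜ))).congr' ?_)
      filter_upwards [hball] with y hy using (hleft y hy.1 hy.2).symm
    · exact hleft z hz h
  · by_cases h : z = 1
    · rw [h]
      refine tendsto_nhds_unique ((hAcont.mul hcont1).tendsto.mono_left nhdsWithin_le_nhds)
        ((hpcont.tendsto.mono_left (nhdsWithin_le_nhds (s := {1}ᶜ))).congr' ?_)
      filter_upwards [hball] with y hy using (hright y hy.1 hy.2).symm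
    · exact hright z hz h

end Inverse

section LaurentCoefficients

theorem differentiableOn_comp_one_sub {E : Type*} [NormedAddCommGroup E] [NormedSpace ℂ E]
    {f : ℂ → E} {ρ : ℝ} (hf : DifferentiableOn ℂ f (Metric.ball 0 ρ)) :
    DifferentiableOn ℂ (fun w => f (1 - w)) (Metric.ball 0 (ρ - 1)) := by
  refine hf.comp (Differentiable.differentiableOn (by fun_prop)) fun w hw => ?_
  have h1 : ‖w‖ < ρ - 1 := by simpa using hw
  have h2 : ‖1 - w‖ ≤ 1 + ‖w‖ := (norm_sub_le _ _).trans (by simp)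
  simpa using h2.trans_lt (by linarith)

variable {E : Type*} [NormedAddCommGroup E] [NormedSpace ℂ E] [CompleteSpace E]

/-- The expansion of a holomorphic function at `z = 1` in powers of `1 - z`, with a holomorphic
remainder. -/
theorem exists_eq_sum_add_one_sub_pow_smul {f : ℂ → E} {ρ : ℝ} (hρ : 1 < ρ)
    (hf : DifferentiableOn ℂ f (Metric.ball 0 ρ)) (d : ℕ) :
    ∃ g : ℂ → E, DifferentiableOn ℂ g (Metric.ball 0 ρ) ∧ ∀ z,
      f z = ∑ n ∈ range d, (1 - z) ^ n • tCoeff (fun w => f (1 - w)) n + (1 - z) ^ d • g z := by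
  induction d generalizing f with
  | zero => exact ⟨f, hf, fun z => by simp⟩
  | succ d ih =>
    obtain ⟨g, hg, hfg⟩ := exists_eq_add_one_sub_smul hρ hf
    obtain ⟨q, hq, hgq⟩ := ih hg
    refine ⟨q, hq, fun z => ?_⟩
    have hcoeff : tCoeff (fun w => f (1 - w))
        = fun n => if n = 0 then f 1 else tCoeff (fun w => g (1 - w)) (n - 1) := by
      refine tCoeff_eq_of_hasSum (by linarith) (fun w hw => ?_) (differentiableOn_comp_one_sub hf)
      have h1 := (hasSum_tCoeff (differentiableOn_comp_one_sub hg) hw).const_smul w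
      rw [← hasSum_nat_add_iff' 1]
      simp only [Finset.range_one, Finset.sum_singleton, pow_zero, one_smul, if_true]
      have h2 : f (1 - w) - f 1 = w • g (1 - w) := by
        rw [hfg (1 - w), sub_sub_cancel]; abel
      rw [h2]
      convert h1 using 2 with n
      simp [pow_succ', smul_smul]
    rw [hfg z, hgq z, Finset.sum_range_succ', hcoeff, smul_add, Finset.smul_sum]
    simp only [smul_smul, pow_succ', Nat.add_sub_cancel, if_true, pow_zero, one_smul,
      Nat.succ_ne_zero, if_false]
    abel

end LaurentCoefficients

section PrincipalPart

variable {H : Type*} [NormedAddCommGroup H] [InnerProductSpace ℂ H]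
variable {k : ℕ} {A : ℕ → H →L[ℂ] H}

theorem finiteDimensional_range_of_comp {S T : H →L[ℂ] H} (hT : FiniteDimensional ℂ T.ker)
    (h : FiniteDimensional ℂ (T * S).range) : FiniteDimensional ℂ S.range := by
  refine Module.Finite.iff_fg.2 (Submodule.fg_of_fg_map_of_fg_inf_ker (T : H →ₗ[ℂ] H) ?_ ?_)
  · have e : S.range.map (T : H →ₗ[ℂ] H) = (T * S).range := (LinearMap.range_comp _ _).symm
    rw [e]
    exact Module.Finite.iff_fg.1 h
  · have : FiniteDimensional ℂ (S.range ⊓ T.ker : Submodule ℂ H) :=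
      Submodule.finiteDimensional_of_le inf_le_right
    exact Module.Finite.iff_fg.1 this

theorem inverse_eq_of_mul_eq {f : ℂ → H →L[ℂ] H} {d : ℕ} {z : ℂ} (hz : z ≠ 1)
    (hu : IsUnit (arOp k A z)) (hfA : f z * arOp k A z = (1 - z) ^ d • 1) :
    Ring.inverse (arOp k A z) = ((1 - z) ^ d)⁻¹ • f z := by
  have h1 : (1 - z) ^ d ≠ 0 := pow_ne_zero _ (sub_ne_zero.2 hz.symm)
  rw [eq_inv_smul_iff₀ h1, ← mul_one (f z), ← Ring.mul_inverse_cancel _ hu, ← mul_assoc, hfA,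
    smul_mul_assoc, one_mul]

variable [CompleteSpace H]

/-- The coefficients of the principal part have finite rank, because `∑_{i ≤ n} A_i C_{n-i} = 0` for
`n < d` and `A_0` has a finite-dimensional kernel. -/
theorem finiteDimensional_range_coeff (hker : FiniteDimensional ℂ (arCoeff k A 0).ker)
    {f : ℂ → H →L[ℂ] H} {ρ : ℝ} (hρ : 1 < ρ) (hf : DifferentiableOn ℂ f (Metric.ball 0 ρ)) {d : ℕ}
    (hAf : ∀ z : ℂ, ‖z‖ < ρ → arOp k A z * f z = (1 - z) ^ d • 1) {n : ℕ} (hn : n < d) :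
    FiniteDimensional ℂ (tCoeff (fun w => f (1 - w)) n).range := by
  induction n using Nat.strong_induction_on with
  | _ n ih =>
    have hρ1 : 0 < ρ - 1 := by linarith
    have h1 : tCoeff (fun w => polyOp (arCoeff k A) k w ∘L f (1 - w)) n = 0 := by
      have e : ∀ w : ℂ, ‖w‖ < ρ - 1 → polyOp (arCoeff k A) k w ∘L f (1 - w)
          = ∑ m ∈ range (d + 1), w ^ m • (if m = d then (1 : H →L[ℂ] H) else 0) := by
        intro w hw
        have h2 := hAf (1 - w) ((norm_sub_le _ _).trans_lt (by rw [norm_one]; linarith))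
        rw [arOp_eq_polyOp, sub_sub_cancel] at h2
        simp only [smul_ite, smul_zero, Finset.sum_ite_eq', Finset.mem_range, Nat.lt_succ_self,
          if_true]
        exact h2
      rw [tCoeff_congr hρ1 e, tCoeff_polynomial, if_pos (by omega), if_neg hn.ne]
    have hpoly : tCoeff (polyOp (arCoeff k A) k) 0 = arCoeff k A 0 := by
      rw [funext (polyOp_eq_sum (arCoeff k A) k), tCoeff_polynomial, if_pos (by omega)]
    rw [tCoeff_comp hρ1 (differentiable_polyOp _ _).differentiableOn
      (differentiableOn_comp_one_sub hf)] at h1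
    beta_reduce at h1
    rw [Finset.Nat.sum_antidiagonal_eq_sum_range_succ
        (fun i j => tCoeff (polyOp (arCoeff k A) k) i ∘L tCoeff (fun w => f (1 - w)) j),
      Finset.sum_range_succ', hpoly, Nat.sub_zero] at h1
    refine finiteDimensional_range_of_comp hker ?_
    have h2 : arCoeff k A 0 * tCoeff (fun w => f (1 - w)) n = -∑ i ∈ range n,
        tCoeff (polyOp (arCoeff k A) k) (i + 1) * tCoeff (fun w => f (1 - w)) (n - (i + 1)) :=
      eq_neg_of_add_eq_zero_right h1
    have h3 : (arCoeff k A 0 * tCoeff (fun w => f (1 - w)) n).range ≤ (range n).sup fun i =>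
        (tCoeff (polyOp (arCoeff k A) k) (i + 1)
          * tCoeff (fun w => f (1 - w)) (n - (i + 1))).range := by
      rw [h2]
      rintro _ ⟨x, rfl⟩
      simp only [ContinuousLinearMap.coe_coe, neg_apply, _root_.sum_apply]
      refine Submodule.neg_mem _ (Submodule.sum_mem _ fun i hi => ?_)
      exact Finset.le_sup (f := fun i => (tCoeff (polyOp (arCoeff k A) k) (i + 1)
          * tCoeff (fun w => f (1 - w)) (n - (i + 1))).range) hi ⟨x, rfl⟩
    rcases Nat.eq_zero_or_pos n with h0 | hpos
    · rw [h2, h0, Finset.range_zero, Finset.sum_empty, neg_zero,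
        ContinuousLinearMap.toLinearMap_zero, LinearMap.range_zero]
      infer_instance
    · have h4 : ∀ i, FiniteDimensional ℂ (tCoeff (polyOp (arCoeff k A) k) (i + 1)
          * tCoeff (fun w => f (1 - w)) (n - (i + 1))).range := by
        intro i
        have := ih (n - (i + 1)) (by omega) (by omega)
        have e : (tCoeff (polyOp (arCoeff k A) k) (i + 1)
            * tCoeff (fun w => f (1 - w)) (n - (i + 1))).range
            = (tCoeff (fun w => f (1 - w)) (n - (i + 1))).range.map
              (tCoeff (polyOp (arCoeff k A) k) (i + 1)).toLinearMap := LinearMap.range_comp _ _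
        rw [e]
        infer_instance
      exact Submodule.finiteDimensional_of_le h3

theorem isLaurentExpansion_tCoeff {f : ℂ → H →L[ℂ] H} {ρ : ℝ} (hρ : 1 < ρ)
    (hf : DifferentiableOn ℂ f (Metric.ball 0 ρ)) {d : ℕ}
    (hfA : ∀ z : ℂ, ‖z‖ < ρ → f z * arOp k A z = (1 - z) ^ d • 1)
    (hu : ∀ z : ℂ, ‖z‖ < ρ → z ≠ 1 → IsUnit (arOp k A z)) :
    IsLaurentExpansion k A d (tCoeff fun w => f (1 - w)) := by
  refine ⟨ρ - 1, by linarith, fun z h0 hz => ?_⟩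
  have hz1 : z ≠ 1 := sub_ne_zero.1 (norm_pos_iff.1 h0)
  have hzρ : ‖z‖ < ρ := by
    have := norm_add_le (z - 1) 1
    rw [sub_add_cancel, norm_one] at this
    linarith
  have hw : (1 - z) ≠ 0 := sub_ne_zero.2 hz1.symm
  refine ⟨hu z hzρ hz1, ?_⟩
  rw [inverse_eq_of_mul_eq hz1 (hu z hzρ hz1) (hfA z hzρ)]
  have h1 := (hasSum_tCoeff (differentiableOn_comp_one_sub hf) (z := 1 - z)
    (by rwa [norm_sub_rev])).const_smul ((1 - z) ^ d)⁻¹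
  rw [sub_sub_cancel] at h1
  have e : (fun n : ℕ => (1 - z) ^ ((n : ℤ) - (d : ℤ)) • tCoeff (fun w => f (1 - w)) n)
      = fun n => ((1 - z) ^ d)⁻¹ • (1 - z) ^ n • tCoeff (fun w => f (1 - w)) n := ?_
  · rw [e]; exact h1
  funext n
  rw [smul_smul, zpow_sub₀ hw, zpow_natCast, zpow_natCast, div_eq_mul_inv, mul_comm]

theorem isRegularPart_tCoeff {f g : ℂ → H →L[ℂ] H} {ρ : ℝ} (hρ : 1 < ρ)
    (hg : DifferentiableOn ℂ g (Metric.ball 0 ρ)) {d : ℕ} {C : ℕ → H →L[ℂ] H}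
    (hfA : ∀ z : ℂ, ‖z‖ < ρ → f z * arOp k A z = (1 - z) ^ d • 1)
    (hu : ∀ z : ℂ, ‖z‖ < ρ → z ≠ 1 → IsUnit (arOp k A z))
    (hfg : ∀ z, f z = ∑ n ∈ range d, (1 - z) ^ n • C n + (1 - z) ^ d • g z) :
    IsRegularPart k A d C (tCoeff g) := by
  refine ⟨ρ, hρ, fun z hz => ⟨summable_norm_tCoeff hg (norm_nonneg z) hz, fun hz1 =>
    ⟨hu z hz hz1, ?_⟩⟩⟩
  have hw : (1 - z) ≠ 0 := sub_ne_zero.2 hz1.symm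
  have h1 : Ring.inverse (arOp k A z)
      - ∑ n ∈ range d, (1 - z) ^ ((n : ℤ) - (d : ℤ)) • C n = g z := by
    rw [inverse_eq_of_mul_eq hz1 (hu z hz hz1) (hfA z hz), hfg z, smul_add, smul_smul,
      inv_mul_cancel₀ (pow_ne_zero _ hw), one_smul, Finset.smul_sum, add_comm, add_sub_assoc,
      add_eq_left, sub_eq_zero]
    refine Finset.sum_congr rfl fun n _ => ?_
    rw [smul_smul, zpow_sub₀ hw, zpow_natCast, zpow_natCast, div_eq_mul_inv, mul_comm]
  rw [h1]
  exact hasSum_tCoeff hg hz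

end PrincipalPart

/-! ### Differences and polynomial paths -/

section Paths

theorem pathDiff_iterate_map {E F : Type*} [AddCommGroup E] [AddCommGroup F] (φ : E →+ F) (n : ℕ)
    (u : ℤ → E) (t : ℤ) : pathDiff^[n] (fun s => φ (u s)) t = φ (pathDiff^[n] u t) := by
  induction n generalizing u with
  | zero => rfl
  | succ n ih =>
    simp only [Function.iterate_succ_apply]
    rw [← ih, show pathDiff (fun s => φ (u s)) = fun s => φ (pathDiff u s) from
      funext fun s => by simp [pathDiff]]

theorem pathDiff_iterate_zero {E : Type*} [AddCommGroup E] (n : ℕ) :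
    pathDiff^[n] (0 : ℤ → E) = 0 := by
  have h := pathDiff_iterate_add n (0 : ℤ → E) 0
  rw [add_zero] at h
  exact left_eq_add.1 h

theorem pathDiff_iterate_sum {E ι : Type*} [AddCommGroup E] (n : ℕ) (s : Finset ι) (u : ι → ℤ → E) :
    pathDiff^[n] (∑ i ∈ s, u i) = ∑ i ∈ s, pathDiff^[n] (u i) := by
  classical
  induction s using Finset.induction_on with
  | empty => simp [pathDiff_iterate_zero]
  | insert i s hi ih => rw [Finset.sum_insert hi, Finset.sum_insert hi, pathDiff_iterate_add, ih]

theorem pathDiff_iterate_eq_fwdDiff {E : Type*} [AddCommGroup E] (n : ℕ) (u : ℤ → E) (t : ℤ) :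
    pathDiff^[n] u t = (fwdDiff (1 : ℤ))^[n] u (t - n) := by
  induction n generalizing t with
  | zero => simp
  | succ n ih =>
    rw [Function.iterate_succ_apply', Function.iterate_succ_apply', pathDiff, ih, ih, fwdDiff]
    rw [show t - ((n + 1 : ℕ) : ℤ) + 1 = t - n by push_cast; ring,
      show t - ((n + 1 : ℕ) : ℤ) = t - 1 - n by push_cast; ring]

/-- A path with vanishing `d`-th difference that vanishes at `d` consecutive times is zero. -/
theorem eq_zero_of_pathDiff_iterate_eq_zero {E : Type*} [AddCommGroup E] (d : ℕ) (u : ℤ → E)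
    (hu : pathDiff^[d] u = 0) (b : ℤ) (h0 : ∀ i : ℕ, i < d → u (b + i) = 0) : u = 0 := by
  induction d generalizing u b with
  | zero => exact hu
  | succ d ih =>
    have h1 : pathDiff u = 0 := by
      refine ih (pathDiff u) hu (b + 1) fun i hi => ?_
      have h2 := h0 (i + 1) (by omega)
      have h3 := h0 i (by omega)
      push_cast at h2
      have e : b + 1 + (i : ℤ) - 1 = b + i := by ring
      rw [pathDiff, e, h3, sub_zero, add_assoc, add_comm 1 (i : ℤ), h2]
    have h4 : ∀ t, u t = u (t - 1) := fun t => sub_eq_zero.1 (congrFun h1 t)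
    have h5 : ∀ t : ℤ, u (b + t) = 0 := by
      intro t
      induction t using Int.induction_on with
      | zero => simpa using h0 0 (by omega)
      | succ i hi => rw [h4, ← hi]; congr 1; ring
      | pred i hi => rw [← hi, h4 (b + -i)]; congr 1; ring
    funext t
    simpa using h5 (t - b)

/-- A path with vanishing `d`-th difference is a polynomial of degree less than `d`, with the
coefficients given by Lagrange interpolation at `0, …, d - 1`. -/
theorem eq_polynomial_of_pathDiff_iterate_eq_zero {E : Type*} [AddCommGroup E] [Module ℂ E] (d : ℕ)
    (u : ℤ → E) (hu : pathDiff^[d] u = 0) (t : ℤ) :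
    u t = ∑ n ∈ range d, ((t : ℂ) ^ n) • ∑ j ∈ range d,
      (Lagrange.basis (range d) (fun i : ℕ => (i : ℂ)) j).coeff n • u j := by
  let L : ℕ → Polynomial ℂ := fun j => Lagrange.basis (range d) (fun i : ℕ => (i : ℂ)) j
  let c : ℕ → E := fun n => ∑ j ∈ range d, (L j).coeff n • u j
  let R : ℤ → E := fun t => ∑ n ∈ range d, ((t : ℂ) ^ n) • c n
  have hR : pathDiff^[d] R = 0 := by
    have e : R = ∑ n ∈ range d, fun t : ℤ => ((t : ℂ) ^ n) • c n := by
      funext t; simp [R]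
    rw [e, pathDiff_iterate_sum]
    refine Finset.sum_eq_zero fun n hn => ?_
    funext t
    let φ : ℤ →+ E :=
      { toFun := fun m => (m : ℂ) • c n
        map_zero' := by simp
        map_add' := fun a b => by push_cast; rw [add_smul] }
    have h1 := pathDiff_iterate_map φ d (fun s : ℤ => s ^ n) t
    rw [pathDiff_iterate_eq_fwdDiff, pathDiff_iterate_eq_fwdDiff,
      fwdDiff_iter_pow_eq_zero_of_lt (Finset.mem_range.1 hn)] at h1
    rw [pathDiff_iterate_eq_fwdDiff]
    simpa [φ] using h1
  have hinj : Set.InjOn (fun i : ℕ => (i : ℂ)) (range d) := fun a _ b _ h => Nat.cast_injective h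
  have hnode : ∀ i : ℕ, i < d → R i = u i := by
    intro i hi
    have hi' := Finset.mem_range.2 hi
    have h1 : R i = ∑ j ∈ range d, (L j).eval (i : ℂ) • u j := by
      simp only [R, c, Finset.smul_sum]
      rw [Finset.sum_comm]
      refine Finset.sum_congr rfl fun j hj => ?_
      have hdeg : (L j).natDegree < d := by
        have h2 := Lagrange.natDegree_basis hinj hj
        rw [show (L j).natDegree = _ from h2, Finset.card_range]
        omega
      rw [Polynomial.eval_eq_sum_range' hdeg, Finset.sum_smul]
      refine Finset.sum_congr rfl fun n _ => ?_
      rw [smul_smul, mul_comm, Int.cast_natCast]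
    rw [h1, Finset.sum_eq_single i]
    · rw [Lagrange.eval_basis_self hinj hi', one_smul]
    · intro j hj hji
      have : (L j).eval (i : ℂ) = 0 := Lagrange.eval_basis_of_ne hji hi'
      rw [this, zero_smul]
    · intro h; exact absurd hi' h
  have hneg : pathDiff^[d] (-R) = 0 := by
    funext t
    have := pathDiff_iterate_map (negAddMonoidHom (α := E)) d R t
    rw [hR] at this
    exact this.trans neg_zero
  have hsub := eq_zero_of_pathDiff_iterate_eq_zero d (u + -R)
    (by rw [pathDiff_iterate_add, hu, hneg, add_zero]) 0 fun i hi => by simp [hnode i hi]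
  have := congrFun hsub t
  simp only [Pi.add_apply, Pi.neg_apply, Pi.zero_apply] at this
  exact add_neg_eq_zero.1 this

theorem diffOp_cumOp {Ω E : Type*} [AddCommGroup E] (w : ℤ → Ω → E) : diffOp (cumOp w) = w := by
  funext t ω
  have hIcc : ∀ a b : ℤ, a ≤ b + 1 → ∑ i ∈ Icc a (b + 1), w i ω
      = ∑ i ∈ Icc a b, w i ω + w (b + 1) ω := by
    intro a b hab
    have : Icc a (b + 1) = insert (b + 1) (Icc a b) := by
      ext i; simp only [Finset.mem_Icc, Finset.mem_insert]; omega
    rw [this, Finset.sum_insert (by simp), add_comm]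
  have hIcc' : ∀ a b : ℤ, a ≤ b → ∑ i ∈ Icc a b, w i ω
      = w a ω + ∑ i ∈ Icc (a + 1) b, w i ω := by
    intro a b hab
    have : Icc a b = insert a (Icc (a + 1) b) := by
      ext i; simp only [Finset.mem_Icc, Finset.mem_insert]; omega
    rw [this, Finset.sum_insert (by simp)]
  simp only [diffOp, cumOp]
  rcases lt_trichotomy t 0 with ht | rfl | ht
  · rw [if_neg (by omega), if_pos (by omega), if_neg (by omega), if_pos (by omega),
      show t - 1 + 1 = t by ring, hIcc' t 0 ht.le]
    abel
  · simp
  · rw [if_pos (by omega), if_neg (by omega), if_neg (c := t - 1 ≤ -1) (by omega)]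
    have h1 := hIcc 1 (t - 1) (by omega)
    rw [sub_add_cancel] at h1
    rw [h1]
    by_cases h : 1 ≤ t - 1
    · rw [if_pos h]; abel
    · rw [if_neg h, Finset.Icc_eq_empty (by omega)]; simp

theorem diffOp_iterate_cumOp_iterate {Ω E : Type*} [AddCommGroup E] (n : ℕ) (w : ℤ → Ω → E) :
    diffOp^[n] (cumOp^[n] w) = w := by
  induction n with
  | zero => rfl
  | succ n ih => rw [Function.iterate_succ_apply, Function.iterate_succ_apply', diffOp_cumOp, ih]

/-- The `d`-th difference of `𝒮^{d-n} w` is the `n`-th difference of `w`. -/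
theorem pathDiff_iterate_cumOp_iterate {Ω E : Type*} [AddCommGroup E] {n d : ℕ} (hn : n ≤ d)
    (w : ℤ → Ω → E) (t : ℤ) (ω : Ω) :
    pathDiff^[d] (fun s => cumOp^[d - n] w s ω) t = pathDiff^[n] (fun s => w s ω) t := by
  rw [← diffOp_iterate_apply, ← diffOp_iterate_apply]
  conv_lhs => rw [show d = n + (d - n) by omega, Function.iterate_add_apply]
  rw [show n + (d - n) - n = d - n by omega, diffOp_iterate_cumOp_iterate]

theorem memLp_cumOp {Ω E : Type*} [MeasurableSpace Ω] {P : Measure Ω} [NormedAddCommGroup E]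
    {w : ℤ → Ω → E} (hw : ∀ t, MemLp (w t) 2 P) (t : ℤ) : MemLp (cumOp w t) 2 P := by
  refine MemLp.sub ?_ ?_
  · by_cases h : 1 ≤ t
    · simp only [h, if_true]; exact memLp_finsetSum _ fun i _ => hw i
    · simp only [h, if_false]; exact MemLp.zero'
  · by_cases h : t ≤ -1
    · simp only [h, if_true]; exact memLp_finsetSum _ fun i _ => hw i
    · simp only [h, if_false]; exact MemLp.zero'

theorem integral_cumOp {Ω E : Type*} [MeasurableSpace Ω] {P : Measure Ω} [NormedAddCommGroup E]
    [NormedSpace ℝ E] [IsFiniteMeasure P] {w : ℤ → Ω → E} (hw : ∀ t, MemLp (w t) 2 P)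
    (h0 : ∀ t, ∫ ω, w t ω ∂P = 0) (t : ℤ) : ∫ ω, cumOp w t ω ∂P = 0 := by
  have hint : ∀ t, Integrable (w t) P := fun t => (hw t).integrable one_le_two
  have hsum : ∀ s : Finset ℤ, ∫ ω, ∑ i ∈ s, w i ω ∂P = 0 := fun s => by
    rw [integral_finsetSum _ fun i _ => hint i, Finset.sum_eq_zero fun i _ => h0 i]
  simp only [cumOp]
  by_cases h : 1 ≤ t
  · have h' : ¬ t ≤ -1 := by omega
    simp only [h, h', if_true, if_false, sub_zero, hsum]
  · by_cases h' : t ≤ -1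
    · simp only [h, h', if_true, if_false, zero_sub, integral_neg, hsum, neg_zero]
    · simp only [h, h', if_false, sub_zero, integral_zero]

theorem memLp_cumOp_iterate {Ω E : Type*} [MeasurableSpace Ω] {P : Measure Ω}
    [NormedAddCommGroup E] [NormedSpace ℝ E] [IsFiniteMeasure P] {w : ℤ → Ω → E}
    (hw : ∀ t, MemLp (w t) 2 P) (h0 : ∀ t, ∫ ω, w t ω ∂P = 0) (n : ℕ) :
    ∀ t, MemLp (cumOp^[n] w t) 2 P ∧ ∫ ω, cumOp^[n] w t ω ∂P = 0 := by
  induction n with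
  | zero => exact fun t => ⟨hw t, h0 t⟩
  | succ n ih =>
    intro t
    rw [Function.iterate_succ_apply']
    exact ⟨memLp_cumOp (fun t => (ih t).1) t,
      integral_cumOp (fun t => (ih t).1) (fun t => (ih t).2) t⟩

end Paths

/-! ### The autoregressive equation along paths -/

theorem lagOp_sum {F E ι : Type*} [NormedAddCommGroup F] [NormedSpace ℂ F] [CompleteSpace F]
    [NormedAddCommGroup E] [NormedSpace ℂ E] [CompleteSpace E] (s : Finset ι) (e : ι → ℕ)
    (B : ι → F →L[ℂ] E) {r : ℝ} (hr : 1 ≤ r) {u : ℤ → F} (hu : IsTame r u) (t : ℤ) :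
    lagOp (fun z => ∑ i ∈ s, (1 - z) ^ e i • B i) u t = ∑ i ∈ s, B i (pathDiff^[e i] u t) := by
  classical
  induction s using Finset.induction_on with
  | empty => simpa using lagOp_const (0 : F →L[ℂ] E) u t
  | insert i s hi ih =>
    simp only [Finset.sum_insert hi]
    rw [lagOp_add (f := fun z => (1 - z) ^ e i • B i) hr (lt_add_one r)
      (Differentiable.differentiableOn (by fun_prop))
      (Differentiable.differentiableOn (by fun_prop)) hu, ih, lagOp_one_sub_pow_smul _ hr _ hu]

theorem diffOp_iterate_map {Ω E F : Type*} [AddCommGroup E] [AddCommGroup F] (φ : E →+ F) (n : ℕ)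
    (x : ℤ → Ω → E) (t : ℤ) (ω : Ω) :
    diffOp^[n] (fun s ω => φ (x s ω)) t ω = φ (diffOp^[n] x t ω) := by
  rw [diffOp_iterate_apply, diffOp_iterate_apply, pathDiff_iterate_map φ n (fun s => x s ω)]

/-- The `b`-th difference of a combination of characteristics of differences of `x_t` is the
combination of the differences of order increased by `b`. -/
theorem diffOp_iterate_sum_map {Ω E F ι : Type*} [AddCommGroup E] [AddCommGroup F] (b : ℕ)
    (s : Finset ι) (e : ι → ℕ) (φ : ι → E →+ F) (x : ℤ → Ω → E) (t : ℤ) (ω : Ω) :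
    diffOp^[b] (fun t ω => ∑ i ∈ s, φ i (diffOp^[e i] x t ω)) t ω
      = ∑ i ∈ s, φ i (diffOp^[b + e i] x t ω) := by
  rw [diffOp_iterate_apply]
  have h1 : (fun t => ∑ i ∈ s, φ i (diffOp^[e i] x t ω))
      = ∑ i ∈ s, fun t => φ i (diffOp^[e i] x t ω) := by
    funext t; simp
  rw [h1, pathDiff_iterate_sum, Finset.sum_apply]
  refine Finset.sum_congr rfl fun i _ => ?_
  rw [pathDiff_iterate_map (φ i) b (fun t => diffOp^[e i] x t ω), ← diffOp_iterate_apply,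
    ← Function.iterate_add_apply]

/-- The functions realising a linear representation can be taken holomorphic. -/
theorem IsLinearIn.exists_lagOp {H : Type*} [NormedAddCommGroup H] [InnerProductSpace ℂ H]
    {Ω : Type*} [MeasurableSpace Ω] {P : Measure Ω} {ε : ℤ → Ω → H}
    {E : Type*} [NormedAddCommGroup E] [InnerProductSpace ℂ E]
    [CompleteSpace E] {B : ℕ → H →L[ℂ] E} {u : ℤ → Ω → E} (hu : IsLinearIn P ε B u) :
    ∃ (ρ : ℝ) (g : ℂ → H →L[ℂ] E), 1 < ρ ∧ DifferentiableOn ℂ g (Metric.ball 0 ρ) ∧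
      g 1 = ∑' n, B n ∧
      ∀ t, ∀ᵐ ω ∂P, u t ω - ∫ ω', u t ω' ∂P = lagOp g (fun s => ε s ω) t := by
  obtain ⟨ρ, g, hρ, hg, hgB, hg1⟩ := hu.1.exists_differentiableOn
  refine ⟨ρ, g, hρ, hg, hg1, fun t => ?_⟩
  filter_upwards [hu.2.2 t] with ω hω
  rw [lagOp, hgB, hω.tsum_eq]

theorem IsARProcess.ae_isTame {H : Type*} [NormedAddCommGroup H] [InnerProductSpace ℂ H]
    {Ω : Type*} [MeasurableSpace Ω] {P : Measure Ω} [IsProbabilityMeasure P] {k : ℕ}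
    {A : ℕ → H →L[ℂ] H} {ε x : ℤ → Ω → H} (hx : IsARProcess P k A ε x) {r : ℝ} (hr : 1 < r) :
    ∀ᵐ ω ∂P, IsTame r fun t => x t ω := by
  obtain ⟨K, m, hK⟩ := hx.growth
  refine ae_isTame_of_growth hx.memLp (K := K) (m := m) (fun n => ?_) hr
  simpa using hK (-n) (by omega)

section Autoregression

variable {H : Type*} [NormedAddCommGroup H] [InnerProductSpace ℂ H] [CompleteSpace H]
variable {k : ℕ} {A : ℕ → H →L[ℂ] H}

theorem lagOp_arOp (u : ℤ → H) (t : ℤ) :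
    lagOp (arOp k A) u t = u t - ∑ h ∈ Icc 1 k, A h (u (t - h)) := by
  have e : arOp k A = fun z => ∑ m ∈ range (k + 1), z ^ m • (if m = 0 then 1 else -A m) := by
    funext z
    rw [arOp, Finset.sum_range_succ', ← Finset.Ico_add_one_right_eq_Icc,
      Finset.sum_Ico_eq_sum_range]
    simp [sub_eq_neg_add, add_comm]
  rw [e, lagOp_polynomial, Finset.sum_range_succ', ← Finset.Ico_add_one_right_eq_Icc,
    Finset.sum_Ico_eq_sum_range]
  simp [sub_eq_neg_add, add_comm]

variable {Ω : Type*} [MeasurableSpace Ω] {P : Measure Ω} [IsProbabilityMeasure P]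
variable {ε x : ℤ → Ω → H}

namespace IsARProcess

variable {E : Type*} [NormedAddCommGroup E]

/-- If `g(z) A(z) = Q(z)` near `0`, then `Q(L) x_t = g(L) ε_t`. -/
theorem ae_lagOp_eq [NormedSpace ℂ E] [CompleteSpace E]
    (hx : IsARProcess P k A ε x)
    {g Q : ℂ → H →L[ℂ] E} {ρ : ℝ} (hρ : 1 < ρ) (hg : DifferentiableOn ℂ g (Metric.ball 0 ρ))
    (hgQ : ∀ z : ℂ, ‖z‖ < 1 → g z ∘L arOp k A z = Q z) :
    ∀ᵐ ω ∂P, ∀ t, lagOp Q (fun s => x s ω) t = lagOp g (fun s => ε s ω) t := by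
  obtain ⟨r, hr, hrρ⟩ := exists_between hρ
  filter_upwards [hx.ae_isTame hr, ae_all_iff.2 hx.eqn] with ω hω heq t
  have h1 : lagOp (arOp k A) (fun s => x s ω) = fun s => ε s ω := by
    funext s
    rw [lagOp_arOp, heq s, add_sub_cancel_left]
  rw [← lagOp_congr one_pos hgQ,
    lagOp_comp hr.le hrρ hg differentiable_arOp.differentiableOn hω, h1]

/-- If `g(z) A(z) = ∑ (1-z)^{e_i} B_i`, then `∑ B_i Δ^{e_i} x_t = g(L) ε_t`. -/
theorem ae_sum_eq_lagOp [NormedSpace ℂ E] [CompleteSpace E]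
    (hx : IsARProcess P k A ε x) {ι : Type*} {s : Finset ι} {e : ι → ℕ}
    {B : ι → H →L[ℂ] E} {g : ℂ → H →L[ℂ] E} {ρ : ℝ} (hρ : 1 < ρ)
    (hg : DifferentiableOn ℂ g (Metric.ball 0 ρ))
    (hgQ : ∀ z : ℂ, ‖z‖ < 1 → g z ∘L arOp k A z = ∑ i ∈ s, (1 - z) ^ e i • B i) :
    ∀ᵐ ω ∂P, ∀ t, ∑ i ∈ s, B i (diffOp^[e i] x t ω) = lagOp g (fun s => ε s ω) t := by
  filter_upwards [hx.ae_lagOp_eq hρ hg hgQ, hx.ae_isTame one_lt_two] with ω hω hx t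
  rw [← hω t, lagOp_sum s e B one_le_two hx]
  simp only [diffOp_iterate_apply]

theorem ae_diffOp_eq_lagOp [NormedSpace ℂ E] [CompleteSpace E]
    (hx : IsARProcess P k A ε x) {n : ℕ} {B : H →L[ℂ] E}
    {g : ℂ → H →L[ℂ] E} {ρ : ℝ} (hρ : 1 < ρ) (hg : DifferentiableOn ℂ g (Metric.ball 0 ρ))
    (hgQ : ∀ z : ℂ, ‖z‖ < 1 → g z ∘L arOp k A z = (1 - z) ^ n • B) :
    ∀ᵐ ω ∂P, ∀ t, B (diffOp^[n] x t ω) = lagOp g (fun s => ε s ω) t := by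
  have := hx.ae_sum_eq_lagOp (s := {()}) (e := fun _ => n) (B := fun _ => B) hρ hg
    (by simpa using hgQ)
  simpa using this

end IsARProcess

/-- The criterion used for characteristics: if `g(z) A(z) = ∑ (1-z)^{b + e_i} B_i` with
`g(1) ≠ 0`, then `∑ B_i Δ^{e_i} x_t ∼ I(b)`. -/
theorem IsARProcess.isCharIntegrated [TopologicalSpace.SeparableSpace H]
    (hx : IsARProcess P k A ε x) (hε : IsWhiteNoise P ε) (hcov : HasNonsingularCov P ε) {ι : Type*}
    {s : Finset ι} {e : ι → ℕ} {b : ℕ} {B : ι → H →L[ℂ] ℂ} {g : ℂ → H →L[ℂ] ℂ} {ρ : ℝ} (hρ : 1 < ρ)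
    (hg : DifferentiableOn ℂ g (Metric.ball 0 ρ))
    (hgQ : ∀ z : ℂ, ‖z‖ < 1 → g z ∘L arOp k A z = ∑ i ∈ s, (1 - z) ^ (b + e i) • B i)
    (hg1 : g 1 ≠ 0) :
    IsCharIntegrated H P b fun t ω => ∑ i ∈ s, B i (diffOp^[e i] x t ω) := by
  refine ⟨ε, tCoeff g, hε, hcov, hε.isLinearIn_of_eq_lagOp hρ hg fun t => ?_, ?_⟩
  · filter_upwards [hx.ae_sum_eq_lagOp hρ hg hgQ] with ω hω
    rw [← hω t]
    exact diffOp_iterate_sum_map b s e (fun i => (B i : H →+ ℂ)) x t ω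
  · rwa [tsum_tCoeff hρ hg]

end Autoregression

section Functional

variable {H : Type*} [NormedAddCommGroup H] [InnerProductSpace ℂ H] [CompleteSpace H]
variable {k : ℕ} {A : ℕ → H →L[ℂ] H}

/-- A zero at `z = 1` can be divided out of `f(z) A(z) = (1-z)^{b+1} φ`. -/
theorem exists_div_one_sub {f : ℂ → H →L[ℂ] ℂ} {φ : H →L[ℂ] ℂ} {ρ : ℝ} (hρ : 1 < ρ)
    (hf : DifferentiableOn ℂ f (Metric.ball 0 ρ)) {b : ℕ}
    (hfA : ∀ z : ℂ, ‖z‖ < ρ → f z ∘L arOp k A z = (1 - z) ^ (b + 1) • φ) (hf1 : f 1 = 0) :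
    ∃ g : ℂ → H →L[ℂ] ℂ, DifferentiableOn ℂ g (Metric.ball 0 ρ) ∧
      ∀ z : ℂ, ‖z‖ < ρ → g z ∘L arOp k A z = (1 - z) ^ b • φ := by
  obtain ⟨g, hg, hfg⟩ := exists_eq_add_one_sub_smul hρ hf
  have hne : ∀ z : ℂ, ‖z‖ < ρ → z ≠ 1 → g z ∘L arOp k A z = (1 - z) ^ b • φ := by
    intro z hz h
    have h1 := hfA z hz
    rw [hfg z, hf1, zero_add, ContinuousLinearMap.smul_comp, pow_succ', mul_smul] at h1
    exact smul_right_injective _ (sub_ne_zero.2 h.symm) h1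
  refine ⟨g, hg, fun z hz => ?_⟩
  by_cases h : z = 1
  · rw [h]
    have hc1 : ContinuousAt (fun z => g z ∘L arOp k A z) 1 :=
      (hg.clm_comp differentiable_arOp.differentiableOn).continuousOn.continuousAt
        (Metric.isOpen_ball.mem_nhds (by simpa using hρ))
    have hc2 : ContinuousAt (fun z : ℂ => (1 - z) ^ b • φ) 1 := by fun_prop
    have hball : ∀ᶠ z : ℂ in 𝓝[≠] 1, ‖z‖ < ρ ∧ z ≠ 1 := by
      refine Filter.Eventually.and (Filter.Eventually.filter_mono nhdsWithin_le_nhds ?_)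
        self_mem_nhdsWithin
      exact continuous_norm.continuousAt.eventually_lt continuousAt_const (by simpa using hρ)
    refine tendsto_nhds_unique (hc1.tendsto.mono_left nhdsWithin_le_nhds)
      ((hc2.tendsto.mono_left (nhdsWithin_le_nhds (s := {1}ᶜ))).congr' ?_)
    filter_upwards [hball] with y hy using (hne y hy.1 hy.2).symm
  · exact hne z hz h

/-- Dividing out all zeros at `z = 1`. -/
theorem exists_apply_one_ne_zero {f : ℂ → H →L[ℂ] ℂ} {φ : H →L[ℂ] ℂ} {ρ : ℝ} (hρ : 1 < ρ)
    (hφ : φ ≠ 0) (hf : DifferentiableOn ℂ f (Metric.ball 0 ρ)) {b : ℕ}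
    (hfA : ∀ z : ℂ, ‖z‖ < ρ → f z ∘L arOp k A z = (1 - z) ^ b • φ) :
    ∃ b' ≤ b, ∃ g : ℂ → H →L[ℂ] ℂ, DifferentiableOn ℂ g (Metric.ball 0 ρ) ∧ g 1 ≠ 0 ∧
      ∀ z : ℂ, ‖z‖ < ρ → g z ∘L arOp k A z = (1 - z) ^ b' • φ := by
  induction b generalizing f with
  | zero =>
    refine ⟨0, le_rfl, f, hf, fun h0 => hφ ?_, hfA⟩
    have h1 := hfA 1 (by simpa using hρ)
    rwa [h0, ContinuousLinearMap.zero_comp, pow_zero, one_smul, eq_comm] at h1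
  | succ b ih =>
    by_cases h0 : f 1 = 0
    · obtain ⟨g, hg, hgA⟩ := exists_div_one_sub hρ hf hfA h0
      obtain ⟨b', hb', h⟩ := ih hg hgA
      exact ⟨b', hb'.trans b.le_succ, h⟩
    · exact ⟨b + 1, le_rfl, f, hf, h0, hfA⟩

end Functional

/-! ### Geometry of the pole condition -/

section Geometry

variable {H : Type*} [NormedAddCommGroup H] [InnerProductSpace ℂ H]

theorem orthogonal_eq_of_sup_eq_top {U V : Submodule ℂ H} (h : V ≤ Uᗮ) (ht : U ⊔ V = ⊤) :
    Uᗮ = V := by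
  refine le_antisymm (fun x hx => ?_) h
  obtain ⟨u, hu, v, hv, rfl⟩ := Submodule.mem_sup.1 (ht ▸ Submodule.mem_top : x ∈ U ⊔ V)
  have h1 : u ∈ Uᗮ := by simpa using Uᗮ.sub_mem hx (h hv)
  have h2 : u = 0 := inner_self_eq_zero.1 (Submodule.inner_right_of_mem_orthogonal hu h1)
  rwa [h2, zero_add]

variable [CompleteSpace H] {a : ℕ → H →L[ℂ] H} {d : ℕ}

theorem HasGenInverses.range_genInverse (hG : HasGenInverses a) (j : ℕ) :
    (genInverse (lrfS a j)).range = lrfTau a j := by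
  refine le_antisymm ?_ fun v hv => ⟨lrfS a j v, hG.lrfP_apply_of_mem hv⟩
  rintro _ ⟨y, rfl⟩
  have h1 := congrArg (fun T : H →L[ℂ] H => T y) (hG.lrfP_mul_genInverse j)
  change lrfP a j (genInverse (lrfS a j) y) = genInverse (lrfS a j) y at h1
  change genInverse (lrfS a j) y ∈ lrfTau a j
  rw [← h1]
  exact hG.lrfP_apply_mem j _

/-- For `v ∈ τ_h`, the functional `⟨v, ·⟩` does not see the difference between `S_h⁺ S_h` and the
identity. -/
theorem HasGenInverses.innerSL_comp_lrfP (hG : HasGenInverses a) {j : ℕ} {v : H}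
    (hv : v ∈ lrfTau a j) : innerSL ℂ v ∘L lrfP a j = innerSL ℂ v := by
  ext y
  have h1 : ⟪lrfP a j v, y⟫_ℂ = ⟪v, lrfP a j y⟫_ℂ := (hG j).selfAdjoint_right.isSymmetric v y
  rw [hG.lrfP_apply_of_mem hv] at h1
  exact h1.symm

namespace PoleCondition

theorem orthogonal_lrfT (h : PoleCondition a d) : (lrfT a d)ᗮ = lrfTau a d :=
  orthogonal_eq_of_sup_eq_top (lrfTau_le_orthogonal_lrfT d) (by rw [← lrfT_succ, h.2.1])

theorem orthogonal_lrfTau (h : PoleCondition a d) : (lrfTau a d)ᗮ = lrfT a d :=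
  orthogonal_eq_of_sup_eq_top (Submodule.isOrtho_iff_le.1
    (Submodule.isOrtho_iff_le.2 (lrfTau_le_orthogonal_lrfT (a := a) d)).symm)
    (by rw [sup_comm, ← lrfT_succ, h.2.1])

theorem genInverse_ne_zero (h : PoleCondition a d) (hG : HasGenInverses a) :
    genInverse (lrfS a d) ≠ 0 := by
  intro h0
  refine h.2.2 ?_
  rw [← hG.range_genInverse, h0, ContinuousLinearMap.toLinearMap_zero, LinearMap.range_zero]

theorem lrfTau_lt (h : PoleCondition a d) {j : ℕ} (hj : j < d) :
    lrfTau a j < (lrfT a j)ᗮ := by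
  refine lt_of_le_of_ne (lrfTau_le_orthogonal_lrfT j) fun he => h.2.2 ?_
  have h1 : lrfTau a d ≤ lrfTau a j := by
    rw [he, ← h.orthogonal_lrfT]
    exact Submodule.orthogonal_le (lrfT_mono hj.le)
  exact Submodule.isOrtho_self.1 ((lrfTau_isOrtho hj.ne').mono_right h1)

end PoleCondition

theorem finiteDimensional_lrfTau (hker : FiniteDimensional ℂ (a 0).ker) (hd : 1 ≤ d) :
    FiniteDimensional ℂ (lrfTau a d) := by
  refine Submodule.finiteDimensional_of_le (S₂ := (a 0).ker) fun v hv => ?_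
  have := mem_orthogonal_lrfT.1 (lrfTau_le_orthogonal_lrfT d hv) 0 (by omega)
  rwa [lrfS_zero] at this

theorem HasUnitRootOfFiniteType.exists_poleCondition {k : ℕ} {A : ℕ → H →L[ℂ] H}
    (hA : HasUnitRootOfFiniteType k A) : ∃ d, PoleCondition (arCoeff k A) d := by
  classical
  have hex : ∃ h, lrfT (arCoeff k A) h = ⊤ := by
    refine exists_lrfT_eq_top hA.isFredholm (fun n => arCoeff_eq_zero) ?_
    obtain ⟨δ, hδ, hu⟩ := hA.1.isolated
    filter_upwards [self_mem_nhdsWithin, nhdsWithin_le_nhds (Metric.ball_mem_nhds (0 : ℂ) hδ)]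
      with w hw0 hw
    have h1 := hu (1 - w) (by simpa using hw0) (by simpa using hw)
    rwa [arOp_eq_polyOp, sub_sub_cancel] at h1
  obtain ⟨v, hv, -⟩ := hA.1.eigenvalue
  have hfind := Nat.find_spec hex
  have h0 : Nat.find hex ≠ 0 := by
    intro h0
    rw [h0] at hfind
    have h1 : v ∈ lrfT (arCoeff k A) 0 := hfind ▸ Submodule.mem_top
    rw [lrfT, iSup_of_empty, Submodule.mem_bot] at h1
    exact hv h1
  obtain ⟨d, hd⟩ := Nat.exists_eq_succ_of_ne_zero h0
  rw [hd] at hfind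
  refine ⟨d, fun i j _ _ hij => lrfTau_isOrtho hij, hfind, fun hbot => ?_⟩
  refine Nat.find_min hex (m := d) (by omega) ?_
  rw [Nat.succ_eq_add_one, lrfT_succ, hbot, sup_bot_eq] at hfind
  exact hfind

end Geometry

section Representation

variable {H : Type*} [NormedAddCommGroup H] [InnerProductSpace ℂ H] [CompleteSpace H]
variable [TopologicalSpace.SeparableSpace H]
variable {Ω : Type*} [MeasurableSpace Ω] {P : Measure Ω} [IsProbabilityMeasure P]
variable {k : ℕ} {A : ℕ → H →L[ℂ] H} {ε x : ℤ → Ω → H} {d : ℕ}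

/-! ### Order of integration -/

theorem PoleCondition.isIntegrated (hpole : PoleCondition (arCoeff k A) d)
    (hA : HasUnitRootOfFiniteType k A) (hε : IsWhiteNoise P ε) (hcov : HasNonsingularCov P ε)
    (hx : IsARProcess P k A ε x) : IsIntegrated P d x := by
  obtain ⟨ρ, f, hρ, hf, hf1, hfA, -, -⟩ := hA.exists_inverse hpole.2.1
  refine ⟨ε, tCoeff f, hε, hcov, ?_, hε.isLinearIn_of_eq_lagOp hρ hf fun t => ?_, ?_⟩
  · have h := hfA 0 (by simpa using one_pos.trans hρ)
    rwa [arOp_zero, mul_one, sub_zero, one_pow, one_smul, ← tCoeff_zero f] at h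
  · filter_upwards [hx.ae_diffOp_eq_lagOp (B := 1) hρ hf fun z hz => hfA z (hz.trans hρ)] with ω hω
    exact hω t
  · rw [tsum_tCoeff hρ hf, hf1]
    exact hpole.genInverse_ne_zero hA.hasGenInverses

/-- The order `d'` of the pole is an order of integration, and two different orders are impossible:
the long-run coefficient of the larger one would vanish. -/
theorem poleCondition_of_isIntegrated (hA : HasUnitRootOfFiniteType k A) (hε : IsWhiteNoise P ε)
    (hcov : HasNonsingularCov P ε) (hx : IsARProcess P k A ε x) (hint : IsIntegrated P d x) :
    PoleCondition (arCoeff k A) d := by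
  obtain ⟨d', hpole⟩ := hA.exists_poleCondition
  obtain ⟨ρ, f, hρ, hf, hf1, hfA, -, -⟩ := hA.exists_inverse hpole.2.1
  obtain ⟨η, B, hη, hηcov, -, hlin, hB⟩ := hint
  obtain ⟨ρ', g, hρ', hg, hg1, hgη⟩ := hlin.exists_lagOp
  have hfε : ∀ t, ∀ᵐ ω ∂P, diffOp^[d'] x t ω - 0 = lagOp f (fun s => ε s ω) t := fun t => by
    filter_upwards [hx.ae_diffOp_eq_lagOp (B := 1) hρ hf fun z hz => hfA z (hz.trans hρ)] with ω hω
    rw [sub_zero]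
    exact hω t
  rcases lt_trichotomy d d' with h | rfl | h
  · refine absurd ?_ (hpole.genInverse_ne_zero hA.hasGenInverses)
    rw [← hf1]
    exact hε.apply_one_eq_zero_of_lt hcov hη hρ hρ' hf hg h (m₁ := fun _ => 0) hfε hgη
  · exact hpole
  · refine absurd ?_ hB
    rw [← hg1]
    exact hη.apply_one_eq_zero_of_lt hηcov hε hρ' hρ hg hf h (m₂ := fun _ => 0) hgη hfε

/-! ### Common trends -/

/-- The terms of the expansion of `f` at `z = 1` turn into `C_n 𝒮^{d-n} ε_t` and `g(L) ε_t` up to a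
path that is annihilated by `Δ^d`, hence polynomial. -/
theorem IsARProcess.hasCommonTrends (hx : IsARProcess P k A ε x) (hε : IsWhiteNoise P ε)
    {f g : ℂ → H →L[ℂ] H} {ρ : ℝ} (hρ : 1 < ρ) (hf : DifferentiableOn ℂ f (Metric.ball 0 ρ))
    (hg : DifferentiableOn ℂ g (Metric.ball 0 ρ)) {C : ℕ → H →L[ℂ] H}
    (hfA : ∀ z : ℂ, ‖z‖ < ρ → f z * arOp k A z = (1 - z) ^ d • 1)
    (hfg : ∀ z, f z = ∑ n ∈ range d, (1 - z) ^ n • C n + (1 - z) ^ d • g z) :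
    HasCommonTrends P d C (tCoeff g) ε x := by
  -- trends `T`, stationary part `y`, remainder `μ`, and the coefficients `v` of its interpolation
  -- polynomial at `0, …, d - 1`
  let y : ℤ → Ω → H := fun t ω => lagOp g (fun s => ε s ω) t
  let T : ℤ → Ω → H := fun t ω => ∑ n ∈ range d, C n (cumOp^[d - n] ε t ω)
  let μ : ℤ → Ω → H := fun t ω => x t ω - (T t ω + y t ω)
  let v : ℕ → Ω → H := fun n ω => ∑ j ∈ range d,
    (Lagrange.basis (range d) (fun i : ℕ => (i : ℂ)) j).coeff n • μ j ω
  have hcum := memLp_cumOp_iterate hε.memLp hε.mean_zero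
  have hT : ∀ t, MemLp (T t) 2 P := fun t =>
    memLp_finsetSum _ fun n _ => (C n).comp_memLp' (hcum _ t).1
  have hy : ∀ t, MemLp (y t) 2 P := fun t => hε.memLp_lagOp hρ hg t
  have hy0 : ∀ t, ∫ ω, y t ω ∂P = 0 := fun t => hε.integral_lagOp hρ hg t
  have hT0 : ∀ t, ∫ ω, T t ω ∂P = 0 := fun t => by
    rw [integral_finsetSum _ fun n _ => (C n).integrable_comp ((hcum _ t).1.integrable one_le_two)]
    refine Finset.sum_eq_zero fun n _ => ?_
    rw [(C n).integral_comp_comm ((hcum _ t).1.integrable one_le_two), (hcum _ t).2, map_zero]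
  have hμ : ∀ t, MemLp (μ t) 2 P := fun t => (hx.memLp t).sub ((hT t).add (hy t))
  have hv : ∀ n, MemLp (v n) 2 P := fun n => memLp_finsetSum _ fun j _ => (hμ j).const_smul _
  have hpoly : ∀ᵐ ω ∂P, ∀ t : ℤ, μ t ω = ∑ n ∈ range d, ((t : ℂ) ^ n) • v n ω := by
    obtain ⟨r, hr, hrρ⟩ := exists_between hρ
    filter_upwards [hx.ae_diffOp_eq_lagOp (B := 1) hρ hf fun z hz => hfA z (hz.trans hρ),
      hε.ae_isTame hr] with ω hω hεω
    refine eq_polynomial_of_pathDiff_iterate_eq_zero d (fun t => μ t ω) ?_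
    have hsplit : (fun t => x t ω) = (fun t => μ t ω)
        + ((∑ n ∈ range d, fun t => C n (cumOp^[d - n] ε t ω)) + lagOp g (fun s => ε s ω)) := by
      funext t
      simp [μ, T, y]
    have h1 := congrArg (fun u => pathDiff^[d] u) hsplit
    simp only [pathDiff_iterate_add, pathDiff_iterate_sum] at h1
    -- `Δ^d` of the trends and of `y` add up to `f(L) ε = Δ^d x`
    have h2 : (pathDiff^[d] fun t => x t ω)
        = (∑ i ∈ range d, pathDiff^[d] fun t => C i (cumOp^[d - i] ε t ω))
          + pathDiff^[d] (lagOp g fun s => ε s ω) := by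
      funext t
      have h3 : lagOp f (fun s => ε s ω) t = lagOp (fun z => (∑ n ∈ range d, (1 - z) ^ n • C n)
          + (1 - z) ^ d • g z) (fun s => ε s ω) t := lagOp_congr one_pos (fun z _ => hfg z) _ t
      rw [lagOp_add (ρ := ρ) hr.le hrρ (Differentiable.differentiableOn (by fun_prop))
        (differentiableOn_one_sub_pow_smul hg d) hεω, lagOp_sum _ (fun n => n) C hr.le hεω,
        ← hω t, ← pathDiff_iterate_lagOp hr.le hrρ hg d hεω] at h3
      rw [← diffOp_iterate_apply]
      refine h3.trans ?_
      rw [Pi.add_apply, Finset.sum_apply]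
      congr 1
      refine Finset.sum_congr rfl fun n hn => ?_
      rw [← pathDiff_iterate_cumOp_iterate (Finset.mem_range.1 hn).le]
      exact (pathDiff_iterate_map (C n : H →+ H) d _ t).symm
    rw [← h2] at h1
    exact right_eq_add.1 h1
  refine ⟨y, v, hε.isLinearIn_of_eq_lagOp hρ hg fun t => ae_of_all _ fun ω => rfl, hy0, hv,
    fun t => ?_, fun t => ?_⟩
  · filter_upwards [hpoly] with ω hω
    rw [← hω t]
    simp only [μ, T]
    abel
  · have h1 : ∫ ω, x t ω ∂P = ∫ ω, μ t ω ∂P := by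
      have hTi := (hT t).integrable one_le_two
      have hyi := (hy t).integrable one_le_two
      have h2 : ∫ ω, μ t ω ∂P = ∫ ω, x t ω ∂P - ∫ ω, (T t ω + y t ω) ∂P :=
        integral_sub ((hx.memLp t).integrable one_le_two) (hTi.add hyi)
      rw [h2, integral_add hTi hyi, hT0, hy0, add_zero, sub_zero]
    rw [h1, integral_congr_ae (hpoly.mono fun ω hω => hω t), integral_finsetSum]
    · exact Finset.sum_congr rfl fun n _ => integral_smul _ _
    · exact fun n _ => ((hv n).integrable one_le_two).smul ((t : ℂ) ^ n)

/-! ### Cointegration -/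

/-- `⟨v, x_t⟩`, `v ≠ 0`, is integrated of an order below `d` exactly when `⟨v, S_d⁺ ·⟩ = 0`; the
order is `d` minus the order of the zero of `⟨v, f(z) ·⟩` at `z = 1`. -/
theorem PoleCondition.cointegratingSpace_eq (hpole : PoleCondition (arCoeff k A) d) (hd : 1 ≤ d)
    (hA : HasUnitRootOfFiniteType k A) (hε : IsWhiteNoise P ε) (hcov : HasNonsingularCov P ε)
    (hx : IsARProcess P k A ε x) :
    cointegratingSpace P d x = (lrfT (arCoeff k A) d : Set H) := by
  obtain ⟨ρ, f, hρ, hf, hf1, hfA, -, -⟩ := hA.exists_inverse hpole.2.1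
  have hφ : ∀ v : H, DifferentiableOn ℂ (fun z => innerSL ℂ v ∘L f z) (Metric.ball 0 ρ) :=
    fun v => (differentiableOn_const _).clm_comp hf
  have hφA : ∀ (v : H) (z : ℂ), ‖z‖ < ρ →
      (innerSL ℂ v ∘L f z) ∘L arOp k A z = (1 - z) ^ d • innerSL ℂ v := fun v z hz => by
    have h1 := congrArg (fun T : H →L[ℂ] H => innerSL ℂ v ∘L T) (hfA z hz)
    rw [ContinuousLinearMap.comp_assoc]
    refine h1.trans ?_
    ext y
    simp
  have hφ1 : ∀ v : H, innerSL ℂ v ∘L f 1 = 0 ↔ v ∈ lrfT (arCoeff k A) d := fun v => by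
    rw [hf1, ← hpole.orthogonal_lrfTau, ← hA.hasGenInverses.range_genInverse,
      Submodule.mem_orthogonal']
    constructor
    · rintro h _ ⟨y, rfl⟩
      exact congrArg (fun T : H →L[ℂ] ℂ => T y) h
    · intro h
      ext y
      exact h _ ⟨y, rfl⟩
  ext v
  constructor
  · rintro (⟨b, hb, η, B, hη, hηcov, hlin, hB⟩ | hv)
    · obtain ⟨ρ', g, hρ', hg, -, hgη⟩ := hlin.exists_lagOp
      refine (hφ1 v).1 (hε.apply_one_eq_zero_of_lt hcov hη hρ hρ' (hφ v) hg hb (m₁ := fun _ => 0)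
        (fun t => ?_) hgη)
      filter_upwards [hx.ae_diffOp_eq_lagOp hρ (hφ v) fun z hz => hφA v z (hz.trans hρ)] with ω hω
      rw [sub_zero, ← hω t]
      exact diffOp_iterate_map (innerSL ℂ v : H →+ ℂ) d x t ω
    · rw [hv]
      exact Submodule.zero_mem _
  · intro hv
    by_cases hv0 : v = 0
    · exact Or.inr hv0
    refine Or.inl ?_
    obtain ⟨d, rfl⟩ : ∃ d', d = d' + 1 := ⟨d - 1, by omega⟩
    obtain ⟨g, hg, hgA⟩ := exists_div_one_sub hρ (hφ v) (hφA v) ((hφ1 v).2 hv)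
    obtain ⟨b, hb, g', hg', hg1, hgA'⟩ := exists_apply_one_ne_zero hρ
      (φ := innerSL ℂ v) (fun h => hv0 (inner_self_eq_zero.1
        (congrArg (fun T : H →L[ℂ] ℂ => T v) h))) hg hgA
    refine ⟨b, by omega, ?_⟩
    have := hx.isCharIntegrated hε hcov (s := {()}) (e := fun _ => 0) (b := b)
      (B := fun _ => innerSL ℂ v) hρ hg' (fun z hz => by simpa using hgA' z (hz.trans hρ)) hg1
    simpa using this

/-- For `v ∈ τ_h`, polynomial cointegration of `x_t` with its differences: multiplying
`S_h⁺ F_h(1-z) A(z) = (1-z)^h (S_h⁺ S_h + ∑_n (1-z)^n S_h⁺ A_{h+1,n})` from the left with `⟨v, ·⟩`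
and removing the terms with `n ≥ d - h` by means of `(1-z)^d A(z)⁻¹` leaves a relation for the
combination in question, with a symbol that does not vanish at `z = 1` on `S_h v`. -/
theorem PoleCondition.isCharIntegrated (hpole : PoleCondition (arCoeff k A) d)
    (hA : HasUnitRootOfFiniteType k A) (hε : IsWhiteNoise P ε) (hcov : HasNonsingularCov P ε)
    (hx : IsARProcess P k A ε x) {h : ℕ} (hh : h ≤ d) {v : H}
    (hv : v ∈ lrfTau (arCoeff k A) h) (hv0 : v ≠ 0) :
    IsCharIntegrated H P h fun t ω => ⟪v, x t ω⟫_ℂ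
      + ∑ n ∈ Icc 1 (d - h - 1), ⟪v, genInverse (lrfS (arCoeff k A) h)
          (lrfA (arCoeff k A) (h + 1) n (diffOp^[n] x t ω))⟫_ℂ := by
  obtain ⟨ρ, f, hρ, hf, hf1, hfA, -, -⟩ := hA.exists_inverse hpole.2.1
  have hG := hA.hasGenInverses
  set a := arCoeff k A with ha
  have haz : ∀ n, k < n → a n = 0 := fun n => arCoeff_eq_zero
  let S := genInverse (lrfS a h)
  -- the terms of the elimination identity that `(1 - z)^d A(z)⁻¹` absorbs
  let J := Icc 1 k \ Icc 1 (d - h - 1)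
  let g : ℂ → H →L[ℂ] H := fun z => S * lrfF a h (1 - z)
    - ∑ n ∈ J, (1 - z) ^ (n + h - d) • (S * lrfA a (h + 1) n * f z)
  have hJ : ∀ n ∈ J, d ≤ n + h ∧ 1 ≤ n := by
    intro n hn
    simp only [J, Finset.mem_sdiff, Finset.mem_Icc] at hn
    omega
  have hgd : DifferentiableOn ℂ g (Metric.ball 0 ρ) := by
    refine DifferentiableOn.sub ?_ (DifferentiableOn.fun_sum fun n _ =>
      differentiableOn_one_sub_pow_smul (DifferentiableOn.mul (differentiableOn_const _) hf) _)
    refine Differentiable.differentiableOn ((differentiable_const _).mul ?_)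
    exact (differentiable_lrfF a h).comp (by fun_prop)
  have hgA : ∀ z : ℂ, ‖z‖ < ρ → g z * arOp k A z = (1 - z) ^ h • lrfP a h
      + ∑ n ∈ Icc 1 (d - h - 1), (1 - z) ^ (h + n) • (S * lrfA a (h + 1) n) := by
    intro z hz
    have h1 : ∀ n ∈ J, (1 - z) ^ (n + h - d) • (S * lrfA a (h + 1) n * f z) * arOp k A z
        = (1 - z) ^ (h + n) • (S * lrfA a (h + 1) n) := fun n hn => by
      rw [smul_mul_assoc, mul_assoc, hfA z hz, mul_smul_comm, mul_one, smul_smul, ← pow_add,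
        Nat.sub_add_cancel (hJ n hn).1, add_comm n h]
    have h2 : ∀ n ∈ Icc 1 (d - h - 1) \ Icc 1 k,
        (1 - z) ^ (h + n) • (S * lrfA a (h + 1) n) = 0 := fun n hn => by
      simp only [Finset.mem_sdiff, Finset.mem_Icc] at hn
      rw [lrfA_eq_zero haz h (by omega), mul_zero, smul_zero]
    have h3 : (1 - z) ^ h • (S * lrfTail a k h (1 - z))
        = ∑ n ∈ Icc 1 k, (1 - z) ^ (h + n) • (S * lrfA a (h + 1) n) := by
      rw [lrfTail, Finset.mul_sum, Finset.smul_sum]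
      refine Finset.sum_congr rfl fun n _ => ?_
      rw [mul_smul_comm, smul_smul, ← pow_add]
    simp only [g]
    rw [sub_mul, Finset.sum_mul, Finset.sum_congr rfl h1, arOp_eq_polyOp,
      hG.genInverse_mul_lrfF_mul_polyOp haz, smul_add, h3, add_sub_assoc, add_right_inj]
    rw [← Finset.sum_inter_add_sum_sdiff (Icc 1 k) (Icc 1 (d - h - 1)), add_sub_cancel_right,
      Finset.inter_comm, ← Finset.sum_inter_add_sum_sdiff (Icc 1 (d - h - 1)) (Icc 1 k),
      Finset.sum_eq_zero h2, add_zero]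
  -- in the term `n = d - h` of `g 1`, the factor `f 1 = S_d⁺` annihilates `S_h`
  have hg1 : ⟪v, g 1 (lrfS a h v)⟫_ℂ ≠ 0 := by
    have h1 : g 1 * lrfS a h = lrfP a h := by
      simp only [g]
      rw [sub_mul, sub_self, lrfF_at_zero, mul_one, Finset.sum_mul, Finset.sum_eq_zero, sub_zero]
      · rfl
      · intro n hn
        have h2 := hJ n hn
        rcases eq_or_lt_of_le hh with hd | hd
        · rw [zero_pow (by omega), zero_smul, zero_mul]
        · rw [smul_mul_assoc, mul_assoc, hf1, hG.genInverse_mul_lrfS_of_ne hd.ne', mul_zero,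
            smul_zero]
    have h2 : g 1 (lrfS a h v) = v :=
      (congrArg (fun T : H →L[ℂ] H => T v) h1).trans (hG.lrfP_apply_of_mem hv)
    rw [h2]
    exact inner_self_ne_zero.2 hv0
  let B : ℕ → H →L[ℂ] ℂ := fun n =>
    if n = 0 then innerSL ℂ v else innerSL ℂ v ∘L (S * lrfA a (h + 1) n)
  have hB : ∀ n ∈ Icc 1 (d - h - 1), B n = innerSL ℂ v ∘L (S * lrfA a (h + 1) n) := fun n hn =>
    if_neg (by have := Finset.mem_Icc.1 hn; omega)
  have key := hx.isCharIntegrated hε hcov (s := insert 0 (Icc 1 (d - h - 1))) (e := fun n => n)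
    (b := h) (B := B) (g := fun z => innerSL ℂ v ∘L g z) hρ
    ((differentiableOn_const _).clm_comp hgd) (fun z hz => ?_)
    (fun h0 => hg1 (congrArg (fun T : H →L[ℂ] ℂ => T (lrfS a h v)) h0))
  · convert key using 3 with t ω
    rw [Finset.sum_insert (by simp)]
    congr 1
    refine Finset.sum_congr rfl fun n hn => ?_
    rw [hB n hn]
    rfl
  · have h1 := congrArg (fun T : H →L[ℂ] H => innerSL ℂ v ∘L T) (hgA z (hz.trans hρ))
    refine Eq.trans ?_ (h1.trans ?_)
    · rfl
    · rw [Finset.sum_insert (by simp), ContinuousLinearMap.comp_add, ContinuousLinearMap.comp_smul,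
        hG.innerSL_comp_lrfP hv, ContinuousLinearMap.comp_finsetSum, add_zero]
      congr 1
      refine Finset.sum_congr rfl fun n hn => ?_
      rw [hB n hn, ContinuousLinearMap.comp_smul]

end Representation

/-! ### The representation theorem -/

theorem mainTheorem1
    {H : Type*} [NormedAddCommGroup H] [InnerProductSpace ℂ H] [CompleteSpace H]
    [TopologicalSpace.SeparableSpace H] (hH : ¬ FiniteDimensional ℂ H)
    {Ω : Type*} [MeasurableSpace Ω] (P : Measure Ω) [IsProbabilityMeasure P]
    (k : ℕ) (A : ℕ → H →L[ℂ] H) (hA : HasUnitRootOfFiniteType k A)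
    (ε x : ℤ → Ω → H) (hε : IsWhiteNoise P ε) (hcov : HasNonsingularCov P ε)
    (hx : IsARProcess P k A ε x) (d : ℕ) (hd : 1 ≤ d) :
    (IsIntegrated P d x ↔ PoleCondition (arCoeff k A) d) ∧
    (PoleCondition (arCoeff k A) d →
      (∃ C D : ℕ → H →L[ℂ] H,
        IsLaurentExpansion k A d C ∧ IsRegularPart k A d C D ∧
        (∀ n < d, FiniteDimensional ℂ (C n).range) ∧
        HasCommonTrends P d C D ε x ∧
        (C 0).range = lrfTau (arCoeff k A) d) ∧
      attractorSpace P d x = lrfTau (arCoeff k A) d ∧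
      FiniteDimensional ℂ (lrfTau (arCoeff k A) d) ∧
      cointegratingSpace P d x = (lrfT (arCoeff k A) d : Set H) ∧
      ¬ FiniteDimensional ℂ (lrfT (arCoeff k A) d) ∧
      (∀ h ≤ d, ∀ v ∈ lrfTau (arCoeff k A) h, v ≠ 0 →
        IsCharIntegrated H P h fun t ω =>
          inner ℂ v (x t ω)
            + ∑ n ∈ Finset.Icc 1 (d - h - 1),
                inner ℂ v (genInverse (lrfS (arCoeff k A) h)
                  (lrfA (arCoeff k A) (h + 1) n (diffOp^[n] x t ω)))) ∧
      (∀ h, 1 ≤ h → h < d → lrfTau (arCoeff k A) h < (lrfT (arCoeff k A) h)ᗮ) ∧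
      lrfTau (arCoeff k A) d = (lrfT (arCoeff k A) d)ᗮ ∧
      lrfTau (arCoeff k A) d ≠ ⊥) := by
  have hG := hA.hasGenInverses
  have hker : FiniteDimensional ℂ (arCoeff k A 0).ker := hA.isFredholm.finite_ker
  refine ⟨⟨poleCondition_of_isIntegrated hA hε hcov hx,
    fun hpole => hpole.isIntegrated hA hε hcov hx⟩, fun hpole => ?_⟩
  have hfin : FiniteDimensional ℂ (lrfTau (arCoeff k A) d) := finiteDimensional_lrfTau hker hd
  have hcoint := hpole.cointegratingSpace_eq hd hA hε hcov hx
  refine ⟨?_, ?_, hfin, hcoint, fun hT => hH ?_, fun h hh v hv hv0 =>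
    hpole.isCharIntegrated hA hε hcov hx hh hv hv0, fun h _ hh => hpole.lrfTau_lt hh,
    hpole.orthogonal_lrfT.symm, hpole.2.2⟩
  · obtain ⟨ρ, f, hρ, hf, hf1, hfA, hAf, hu⟩ := hA.exists_inverse hpole.2.1
    obtain ⟨g, hg, hfg⟩ := exists_eq_sum_add_one_sub_pow_smul hρ hf d
    refine ⟨tCoeff fun w => f (1 - w), tCoeff g, isLaurentExpansion_tCoeff hρ hf hfA hu,
      isRegularPart_tCoeff hρ hg hfA hu hfg,
      fun n hn => finiteDimensional_range_coeff hker hρ hf hAf hn,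
      hx.hasCommonTrends hε hρ hf hg hfA hfg, ?_⟩
    rw [tCoeff_zero, sub_zero, hf1, hG.range_genInverse]
  · rw [attractorSpace, hcoint, Submodule.span_eq, hpole.orthogonal_lrfT]
  · have h1 : FiniteDimensional ℂ (lrfT (arCoeff k A) d ⊔ lrfTau (arCoeff k A) d : Submodule ℂ H) :=
      Submodule.finiteDimensional_sup _ _
    rw [← lrfT_succ, hpole.2.1] at h1
    exact Submodule.topEquiv.finiteDimensional
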